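/- **Setting.** Let $t_0=1.255$. A *packing* is a set $\Lambda\subset\mathbb R^3$ whose distinct points have distance at least $2$; it is *saturated* if every $x\in\mathbb R^3$ has distance less than $2$ from some point of $\Lambda$. Points of $\Lambda$ are called vertices. For $v\in\Lambda$ let $\Omega(v)$ be the set of points closer to $v$ than to every other vertex. A function $a:\Lambda\to\mathbb R$ is *negligible* if there is a constant $C_1$ with $\sum_{v\in\Lambda\cap B(x,r)}a(v)\le C_1r^2$ for all $x\in\mathbb R^3$ and $r\ge 1$, where $B(x,r)$ is the closed ball; it is *fcc-compatible* if $\sqrt{32}\le \mathrm{vol}\,\Omega(v)+a(v)$ for all $v\in\Lambda$. Let $\delta_{tet}$ (resp. $\delta_{oct}$) be the fraction of the volume of a regular tetrahedron (resp. octahedron) of edge length $2$ that lies within distance $1$ of a vertex, and let $pt=-\pi/3+\sqrt2\,\delta_{tet}$. **The Q-system.** All vertices below lie in $\Lambda$, and a simplex is a set $S$ of four vertices; its convex hull is $|S|$. Two simplices *overlap* if their convex hulls have a common interior point. A *quasi-regular* triangle or tetrahedron has all edges in $[2,2t_0]$. A *strict diagonal* is a pair $\{p,q\}$ with $2t_0<|p-q|<\sqrt8$;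 a *strict quarter* is a simplex with one edge a strict diagonal (its diagonal) and the five other edges in $[2,2t_0]$. An *anchor* of a strict diagonal is a vertex at distance at most $2t_0$ from both of its ends. A *quartered octahedron* is a set of six vertices that is the union of four pairwise non-overlapping strict quarters with a common diagonal; for each quartered octahedron fix, once and for all, one diagonal with this property. The *Q-system* $\mathcal Q=\mathcal Q(\Lambda)$ consists of (1) all quasi-regular tetrahedra; (2) every strict quarter such that none of the quarters along its diagonal overlaps another quasi-regular tetrahedron or strict quarter; (3) every strict quarter whose diagonal has at least four anchors, unless it has exactly four and they form a quartered octahedron with that diagonal; (4) the four quarters of each quartered octahedron along its fixed diagonal; (5) every strict quarter whose vertices can be labelled $v_1,v_2,v_3,v_4$ with diagonal $\{v_1,v_3\}$ such that, for some vertex $v_5$, the diagonal $\{v_1,v_3\}$ has exactly the three anchors $v_2,v_4,v_5$, the pair $\{v_4,v_5\}$ is a strict diagonal with exactly the three anchors $v_1,v_3,v_2$, and the sum of the dihedral angles along $\{v_1,v_3\}$ of the simplices $\{v_1,v_2,v_3,v_4\}$ and $\{v_1,v_2,v_3,v_5\}$ exceeds $\pi$. **Decomposition stars.** A *barrier* is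 a quasi-regular triangle or a face of a simplex of $\mathcal Q$. A vertex is *obstructed* from $x$ if the segment joining them meets the relative interior of the convex hull of a barrier. Let $\Lambda(x)$ be the set of vertices at distance less than $2$ from $x$ and not obstructed from $x$. The *V-cell* $VC(v)$ is the set of $x$ with $v\in\Lambda(x)$ and $|x-v|<|x-w|$ for all $w\in\Lambda(x)$, $w\ne v$. The decomposition star $D(v,\Lambda)$ at $v\in\Lambda$ consists of $v$, the vertices at distance at most $4$ from $v$, the set $\mathcal Q_v$ of simplices of $\mathcal Q$ with vertex $v$, and $VC(v)$. Let $X$ be the set of all $D(v,\Lambda)$, where $\Lambda$ runs over saturated packings and $v$ over $\Lambda$. **The score.** For a set $C$ let $\mathrm{sol}_v(C)$ be the solid angle that it subtends at $v$ (with total $4\pi$), and $\mathrm{sovo}_v(C)=4\bigl(-\delta_{oct}\,\mathrm{vol}(C)+\mathrm{sol}_v(C)/3\bigr)$. For a simplex $S$ with vertex $v$ let - $\Gamma(S)=-\delta_{oct}\,\mathrm{vol}|S|+\frac13\sum_{w\in S}\mathrm{sol}_w(|S|)$; - $\mathrm{vor}(S,v)=4\bigl(-\delta_{oct}V(S,v)+\mathrm{sol}_v(|S|)/3\bigr)$,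 where $V(S,v)$ is the sum, over the six orderings $f_0=v,f_1,f_2,f_3$ of the vertices of $S$, of the volumes of the Rogers simplices spanned by $v$, the midpoint of $f_0f_1$, the circumcenter of $f_0f_1f_2$ and the circumcenter of $S$, counted negatively when the orientation of the Rogers simplex is opposite to that of $(f_0,f_1,f_2,f_3)$; - $\mathrm{vor}_0(S,v)=\mathrm{sovo}_v(C)$, where $C$ is the set of points $x$ of the cone over $|S|$ at $v$ with $|x-v|\le t_0$ and $|x-v|\le|x-w|$ for all $w\in S$; - $\mu(S,v)=\Gamma(S)$ if $S$ is a quasi-regular tetrahedron of circumradius at most $1.41$ or a strict quarter whose two faces along the diagonal have circumradius at most $\sqrt2$, and $\mu(S,v)=\mathrm{vor}(S,v)$ otherwise. For $S\in\mathcal Q_v$ let $\sigma(S,v)=\mu(S,v)$, unless $S$ is a strict quarter whose diagonal is $\{v,\hat v\}$ for some $\hat v$. In that case let $m$ be the number of anchors of $\{v,\hat v\}$ and $k$ the number of quarters of $\mathcal Q$ with this diagonal. Then $\sigma(S,v)=\mu(S,v)$ if $(m,k)=(2,1)$; $\sigma(S,v)=\frac12(\mu(S,v)+\mu(S,\hat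 v))$ if $(m,k)=(4,4)$; and $\sigma(S,v)=\frac12(\mu(S,v)+\mu(S,\hat v))+\frac12(\mathrm{vor}_0(S,v)-\mathrm{vor}_0(S,\hat v))$ otherwise. Finally $$\sigma(D(v,\Lambda))=\mathrm{sovo}_v\Bigl(VC(v)\setminus\bigcup_{S\in\mathcal Q_v}|S|\Bigr)+\sum_{S\in\mathcal Q_v}\sigma(S,v).$$ **Lemma.** Suppose that the maximum of $\sigma$ on $X$ is $8\,pt$. Then every saturated packing $\Lambda$ admits a negligible fcc-compatible function; namely, the function $$a(v)=-\frac{\sigma(D(v,\Lambda))}{4\delta_{oct}}+\frac{4\pi}{3\delta_{oct}}-\mathrm{vol}\,\Omega(v)\qquad(v\in\Lambda)$$ is negligible and fcc-compatible. -/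

import Mathlib

open MeasureTheory

noncomputable section

namespace Kepler

/-- Euclidean three-space. -/
abbrev E3 := EuclideanSpace ℝ (Fin 3)

/-! ### Packings, Voronoi cells, negligible and fcc-compatible functions -/

/-- The set of centers of a packing of balls of radius one. -/
def IsPacking (P : Set E3) : Prop :=
  ∀ v ∈ P, ∀ w ∈ P, v ≠ w → 2 ≤ dist v w

/-- A packing to which no further ball of radius one can be added. -/
def IsSaturated (P : Set E3) : Prop :=
  IsPacking P ∧ ∀ x : E3, ∃ v ∈ P, dist x v < 2

/-- The points closer to `v` than to any other center. -/
def voronoiCell (P : Set E3) (v : E3) : Set E3 :=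
  {x | ∀ w ∈ P, w ≠ v → dist x v < dist x w}

/-- The sum runs over the centers in the ball `B(x, r)`; there are finitely many of them whenever
`P` is a packing. -/
def IsNegligible (P : Set E3) (a : P → ℝ) : Prop :=
  ∃ C : ℝ, ∀ (x : E3) (r : ℝ), 1 ≤ r →
    ∑ᶠ (v : P) (_ : (v : E3) ∈ Metric.closedBall x r), a v ≤ C * r ^ 2

def IsFccCompatible (P : Set E3) (a : P → ℝ) : Prop :=
  ∀ v : P, Real.sqrt 32 ≤ volume.real (voronoiCell P v) + a v

/-! ### The constants -/

/-- The fraction of the polytope with vertex set `V` that lies within distance one of a vertex. -/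
def polytopeDensity (V : Set E3) : ℝ :=
  volume.real (convexHull ℝ V ∩ {x | ∃ v ∈ V, dist x v ≤ 1}) / volume.real (convexHull ℝ V)

/-- The vertices of a regular tetrahedron of edge length two. -/
def regularTetrahedron : Set E3 :=
  (fun u : E3 => (Real.sqrt 2)⁻¹ • u) ''
    {!₂[1, 1, 1], !₂[1, -1, -1], !₂[-1, 1, -1], !₂[-1, -1, 1]}

/-- The vertices of a regular octahedron of edge length two. -/
def regularOctahedron : Set E3 :=
  (fun u : E3 => Real.sqrt 2 • u) ''
    {!₂[1, 0, 0], !₂[-1, 0, 0], !₂[0, 1, 0], !₂[0, -1, 0], !₂[0, 0, 1], !₂[0, 0, -1]}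

def deltaTet : ℝ := polytopeDensity regularTetrahedron

def deltaOct : ℝ := polytopeDensity regularOctahedron

def pt : ℝ := -Real.pi / 3 + Real.sqrt 2 * deltaTet

/-- The truncation parameter. -/
def t0 : ℝ := 1.255

/-! ### Quasi-regular tetrahedra, quarters, quartered octahedra -/

def IsQuasiRegularTriangle (T : Finset E3) : Prop :=
  T.card = 3 ∧ ∀ v ∈ T, ∀ w ∈ T, v ≠ w → 2 ≤ dist v w ∧ dist v w ≤ 2 * t0

def IsQuasiRegularTetrahedron (S : Finset E3) : Prop :=
  S.card = 4 ∧ ∀ v ∈ S, ∀ w ∈ S, v ≠ w → 2 ≤ dist v w ∧ dist v w ≤ 2 * t0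

/-- The segment from `p` to `q` has the length of the diagonal of a strict quarter. -/
def IsStrictDiagonal (p q : E3) : Prop :=
  2 * t0 < dist p q ∧ dist p q < Real.sqrt 8

/-- `S` is a strict quarter with diagonal `{p, q}`: a simplex whose edges other than `{p, q}` have
length between `2` and `2 * t0`. -/
def IsStrictQuarter (p q : E3) (S : Finset E3) : Prop :=
  S.card = 4 ∧ p ∈ S ∧ q ∈ S ∧ IsStrictDiagonal p q ∧
    ∀ v ∈ S, ∀ w ∈ S, v ≠ w → ¬(v = p ∧ w = q) → ¬(v = q ∧ w = p) →
      2 ≤ dist v w ∧ dist v w ≤ 2 * t0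

/-- Two simplices overlap if their convex hulls have a common interior point. -/
def Overlap (S S' : Finset E3) : Prop :=
  (interior (convexHull ℝ (S : Set E3)) ∩ interior (convexHull ℝ (S' : Set E3))).Nonempty

/-- The anchors of a strict diagonal `{p, q}`. -/
def anchors (P : Set E3) (p q : E3) : Set E3 :=
  {u | u ∈ P ∧ dist u p ≤ 2 * t0 ∧ dist u q ≤ 2 * t0}

/-- `O` is a quartered octahedron, by means of four quarters along the diagonal `{p, q}`: six
vertices that are the union of four pairwise non-overlapping strict quarters with that diagonal. -/
def IsQuarteredOctahedron (p q : E3) (O : Finset E3) : Prop :=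
  O.card = 6 ∧ IsPacking (O : Set E3) ∧
    ∃ S : Fin 4 → Finset E3, (∀ i, IsStrictQuarter p q (S i)) ∧
      (∀ i j, i ≠ j → ¬Overlap (S i) (S j)) ∧ ∀ x, x ∈ O ↔ ∃ i, x ∈ S i

/-- A quartered octahedron may be cut into four quarters along more than one of its diagonals.
A diagonal choice fixes, once and for all, one such diagonal of every quartered octahedron. -/
def IsDiagonalChoice (c : Finset E3 → E3 × E3) : Prop :=
  ∀ (O : Finset E3) (p q : E3),
    IsQuarteredOctahedron p q O → IsQuarteredOctahedron (c O).1 (c O).2 O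

/-- The dihedral angle along the line `p q` between the half-planes through `x` and `y`. -/
def dihedralAngle (p q x y : E3) : ℝ :=
  InnerProductGeometry.angle
    ((Submodule.span ℝ {q - p})ᗮ.starProjection (x - p))
    ((Submodule.span ℝ {q - p})ᗮ.starProjection (y - p))

/-! ### The Q-system -/

/-- `S` is a quasi-regular tetrahedron or a strict quarter with vertices in `P`. -/
def IsCandidate (P : Set E3) (S : Finset E3) : Prop :=
  (S : Set E3) ⊆ P ∧ (IsQuasiRegularTetrahedron S ∨ ∃ p q, IsStrictQuarter p q S)

/-- Strict quarters such that none of the quarters along their diagonal overlaps any other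
quasi-regular tetrahedron or strict quarter. -/
def IsFreeQuarter (P : Set E3) (S : Finset E3) : Prop :=
  ∃ p q, IsStrictQuarter p q S ∧
    ∀ S' : Finset E3, (S' : Set E3) ⊆ P → IsStrictQuarter p q S' →
      ∀ S'' : Finset E3, IsCandidate P S'' → S'' ≠ S' → ¬Overlap S' S''

/-- Strict quarters whose diagonal has at least four anchors, unless there are exactly four and they
form, with the diagonal, a quartered octahedron. -/
def IsManyAnchorQuarter (P : Set E3) (S : Finset E3) : Prop :=
  ∃ p q, IsStrictQuarter p q S ∧ 4 ≤ (anchors P p q).ncard ∧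
    ¬((anchors P p q).ncard = 4 ∧
      ∃ O : Finset E3, (O : Set E3) ⊆ P ∧ IsQuarteredOctahedron p q O)

/-- The chosen four quarters of a quartered octahedron. -/
def IsOctahedronQuarter (c : Finset E3 → E3 × E3) (P : Set E3) (S : Finset E3) : Prop :=
  ∃ O : Finset E3, (O : Set E3) ⊆ P ∧ (∃ p q, IsQuarteredOctahedron p q O) ∧
    S ⊆ O ∧ IsStrictQuarter (c O).1 (c O).2 S

/-- Quarters of an adjacent pair in the interior position of two conflicting diagonals: the diagonal
`{v₁, v₃}` has exactly the three anchors `v₂, v₄, v₅`, the other diagonal `{v₄, v₅}` has exactly the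
three anchors `v₁, v₃, v₂`, and `{v₁, v₃}` lies between `v₂` and `{v₄, v₅}`. -/
def IsInteriorQuarter (P : Set E3) (S : Finset E3) : Prop :=
  ∃ v₁ v₂ v₃ v₄ v₅ : E3, IsStrictQuarter v₁ v₃ S ∧ v₂ ∈ S ∧ v₄ ∈ S ∧
    (anchors P v₁ v₃).ncard = 3 ∧ anchors P v₁ v₃ = {v₂, v₄, v₅} ∧
    IsStrictDiagonal v₄ v₅ ∧
    (anchors P v₄ v₅).ncard = 3 ∧ anchors P v₄ v₅ = {v₁, v₃, v₂} ∧
    Real.pi < dihedralAngle v₁ v₃ v₂ v₄ + dihedralAngle v₁ v₃ v₂ v₅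

def qSystem (c : Finset E3 → E3 × E3) (P : Set E3) : Set (Finset E3) :=
  {S | (S : Set E3) ⊆ P ∧
    (IsQuasiRegularTetrahedron S ∨ IsFreeQuarter P S ∨ IsManyAnchorQuarter P S ∨
      IsOctahedronQuarter c P S ∨ IsInteriorQuarter P S)}

/-! ### Barriers and V-cells -/

/-- The convex combinations of the points of `T` with positive weights: the relative interior of the
convex hull of `T`. -/
def openHull (T : Finset E3) : Set E3 :=
  {x | ∃ w : E3 → ℝ, (∀ y ∈ T, 0 < w y) ∧ ∑ y ∈ T, w y = 1 ∧ ∑ y ∈ T, w y • y = x}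

/-- The barriers: quasi-regular triangles and faces of simplices of the Q-system. -/
def barriers (c : Finset E3 → E3 × E3) (P : Set E3) : Set (Finset E3) :=
  {T | (T : Set E3) ⊆ P ∧
    (IsQuasiRegularTriangle T ∨ T.card = 3 ∧ ∃ S ∈ qSystem c P, T ⊆ S)}

/-- The segment from `x` to `y` passes through the interior of a barrier. -/
def Obstructed (c : Finset E3 → E3 × E3) (P : Set E3) (x y : E3) : Prop :=
  ∃ T ∈ barriers c P, (segment ℝ x y ∩ openHull T).Nonempty

/-- The vertices at distance less than two from `x` that are not obstructed from `x`. -/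
def visibleVertices (c : Finset E3 → E3 × E3) (P : Set E3) (x : E3) : Set E3 :=
  {w | w ∈ P ∧ dist x w < 2 ∧ ¬Obstructed c P x w}

def vCell (c : Finset E3 → E3 × E3) (P : Set E3) (v : E3) : Set E3 :=
  {x | v ∈ visibleVertices c P x ∧
    ∀ w ∈ visibleVertices c P x, w ≠ v → dist x v < dist x w}

/-! ### Decomposition stars -/

/-- The local data at a vertex of a packing that a decomposition star records. -/
structure DecompositionStar where
  /-- the vertex around which the star is constructed -/
  center : E3
  /-- the vertices of the packing at distance at most four from the center -/
  vertices : Set E3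
  /-- the simplices of the Q-system that have the center as a vertex -/
  simplices : Set (Finset E3)
  /-- the V-cell of the center -/
  cell : Set E3

/-- The decomposition star at the vertex `v` of `P`. -/
def decompositionStar (c : Finset E3 → E3 × E3) (P : Set E3) (v : E3) : DecompositionStar where
  center := v
  vertices := P ∩ Metric.closedBall v 4
  simplices := {S | S ∈ qSystem c P ∧ v ∈ S}
  cell := vCell c P v

/-- The space `X` of all decomposition stars. -/
def decompositionStars (c : Finset E3 → E3 × E3) : Set DecompositionStar :=
  {D | ∃ P : Set E3, ∃ v ∈ P, IsSaturated P ∧ D = decompositionStar c P v}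

/-! ### Solid angles and volumes -/

/-- The union of the open rays from `v` through the points of `C`. -/
def coneAt (v : E3) (C : Set E3) : Set E3 :=
  {x | ∃ t : ℝ, 0 < t ∧ v + t • (x - v) ∈ C}

/-- The solid angle that `C` subtends at `v` (the full solid angle is `4π`). -/
def solidAngle (v : E3) (C : Set E3) : ℝ :=
  3 * volume.real (coneAt v C ∩ Metric.ball v 1)

/-- The combination `4 (- δ_oct vol + sol / 3)` of the volume of a region and of its solid angle. -/
def sovo (v : E3) (C : Set E3) : ℝ :=
  4 * (-deltaOct * volume.real C + solidAngle v C / 3)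

open Classical in
/-- The circumcenter of affinely independent points (`0` for dependent ones). -/
def circumcenter {n : ℕ} (f : Fin (n + 1) → E3) : E3 :=
  if h : AffineIndependent ℝ f then (⟨f, h⟩ : Affine.Simplex ℝ E3 n).circumcenter else 0

open Classical in
/-- The circumradius of affinely independent points (`0` for dependent ones). -/
def circumradius {n : ℕ} (f : Fin (n + 1) → E3) : ℝ :=
  if h : AffineIndependent ℝ f then (⟨f, h⟩ : Affine.Simplex ℝ E3 n).circumradius else 0

/-- The determinant with rows `x, y, z`. -/
def det3 (x y z : E3) : ℝ :=
  Matrix.det (Matrix.of fun i j : Fin 3 => (![x, y, z] i) j)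

/-- The volume of the Rogers simplex of the ordered simplex `f`, spanned by `f 0`, the midpoint of
its first two vertices, the circumcenter of its first three and its circumcenter, counted negatively
if the orientation of the Rogers simplex is opposite to that of `f`. -/
def rogersVolume (f : Fin 4 → E3) : ℝ :=
  SignType.sign (det3 (f 1 - f 0) (f 2 - f 0) (f 3 - f 0)) *
    det3 (midpoint ℝ (f 0) (f 1) - f 0) (circumcenter ![f 0, f 1, f 2] - f 0)
      (circumcenter f - f 0) / 6

/-- The analytic Voronoi volume of the simplex `S` at its vertex `v`: the sum of the signed volumes
of its six Rogers simplices at `v`. If `S` contains its circumcenter and its faces contain theirs,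
this is the volume of the set of points of `S` that are closest to `v` among the vertices of `S`;
in general, it is the analytic continuation of that volume. -/
def voronoiVolume (S : Finset E3) (v : E3) : ℝ :=
  ∑ᶠ f ∈ {f : Fin 4 → E3 | f 0 = v ∧ Set.range f = (S : Set E3)}, rogersVolume f

/-! ### The score -/

/-- The compression of a simplex. -/
def compression (S : Finset E3) : ℝ :=
  -deltaOct * volume.real (convexHull ℝ (S : Set E3)) +
    (∑ v ∈ S, solidAngle v (convexHull ℝ (S : Set E3))) / 3

/-- The analytic Voronoi score of a simplex at one of its vertices. -/
def vor (S : Finset E3) (v : E3) : ℝ :=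
  4 * (-deltaOct * voronoiVolume S v + solidAngle v (convexHull ℝ (S : Set E3)) / 3)

/-- The Voronoi score of a simplex at one of its vertices, truncated at distance `t0`. -/
def vorTruncated (S : Finset E3) (v : E3) : ℝ :=
  sovo v {x | x ∈ coneAt v (convexHull ℝ (S : Set E3)) ∧ dist x v ≤ t0 ∧
    ∀ w ∈ S, dist x v ≤ dist x w}

/-- The simplices that are scored by compression: the quasi-regular tetrahedra of circumradius at
most `1.41`, and the quarters such that both faces along the diagonal have circumradius at most
`√2`. -/
def IsCompressed (S : Finset E3) : Prop :=
  (IsQuasiRegularTetrahedron S ∧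
    ∀ f : Fin 4 → E3, Set.range f = (S : Set E3) → circumradius f ≤ 1.41) ∨
  ∃ p q, IsStrictQuarter p q S ∧
    ∀ x ∈ S, x ≠ p → x ≠ q → circumradius ![p, q, x] ≤ Real.sqrt 2

open Classical in
def mu (S : Finset E3) (v : E3) : ℝ :=
  if IsCompressed S then compression S else vor S v

namespace DecompositionStar

/-- The number of anchors of the diagonal from the center to `w`. -/
def anchorCount (D : DecompositionStar) (w : E3) : ℕ :=
  (anchors D.vertices D.center w).ncard

/-- The number of quarters of the Q-system along the diagonal from the center to `w`. -/
def quarterCount (D : DecompositionStar) (w : E3) : ℕ :=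
  {S | S ∈ D.simplices ∧ IsStrictQuarter D.center w S}.ncard

open Classical in
/-- The score of an upright quarter whose diagonal runs from the center to `w`. It depends on the
context `(m, m - k)` of the diagonal, where `m` is the number of its anchors and `k` the number of
quarters along it; the first two cases are the contexts `(2, 1)` and `(4, 0)`. -/
def uprightScore (D : DecompositionStar) (S : Finset E3) (w : E3) : ℝ :=
  if D.anchorCount w = 2 ∧ D.quarterCount w = 1 then mu S D.center
  else if D.anchorCount w = 4 ∧ D.quarterCount w = 4 then (mu S D.center + mu S w) / 2
  else (mu S D.center + mu S w) / 2 + (vorTruncated S D.center - vorTruncated S w) / 2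

open Classical in
/-- The score of a simplex of the Q-system at the center. A quarter is upright if the center is an
endpoint of its diagonal, and flat otherwise. -/
def simplexScore (D : DecompositionStar) (S : Finset E3) : ℝ :=
  if h : ∃ w, IsStrictQuarter D.center w S then D.uprightScore S h.choose else mu S D.center

/-- The score `σ` of a decomposition star: the score of the part of the V-cell outside the simplices
of the Q-system, plus the scores of these simplices. -/
def sigma (D : DecompositionStar) : ℝ :=
  sovo D.center (D.cell \ ⋃ S ∈ D.simplices, convexHull ℝ (S : Set E3)) +
    ∑ᶠ S ∈ D.simplices, D.simplexScore S

end DecompositionStar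

end Kepler

end

/-! ### Crossings of segments and triangles by an energy identity -/

namespace Kepler

/-! Compatibility is a computation. The four planes through the origin parallel to the faces of a
regular tetrahedron cut the unit ball into eight cones congruent to a vertex cone of the tetrahedron
and six congruent to one of the octahedron. Counting volumes gives `π = √2 δ_tet + 2√2 δ_oct`
(`pi_eq_densities`), and with it the bound `σ ≤ 8 pt` becomes exactly `√32 ≤ vol Ω(v) + a(v)`
(`sqrt_thirtyTwo_le`).

For negligibility, call the part of the V-cell of `v` outside the simplices of the Q-system at `v`
the residue. Almost every point of the unit ball around `v` lies in the V-cell, because a barrier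
without the vertex `v` stays more than one away from it. Hence the residue and the simplices
together subtend at least `4π` at `v` (`four_pi_le_solidAngle`), and `-σ + 16π/3` is at most `4
δ_oct vol(residue)` plus the sum of `4/3 sol_v(S) - σ(S, v)` over the simplices `S` at `v`
(`neg_sigma_le`). Over the four vertices of one simplex these last terms add up to `4 δ_oct vol |S|`
(`sum_simplexScore`): the analytic Voronoi volumes sum to the volume of the simplex, and the
corrections for upright quarters cancel between the two ends of the diagonal.

Summed over a ball of radius `r`, the function `a` is therefore bounded by the volume of residues
and simplices, minus that of the Voronoi cells, up to the simplices that stick out of the ball.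
Residues and simplices are almost disjoint and fit into radius `r + 2` (`sum_volume_le`); the
Voronoi cells cover radius `r - 2`; the difference is `O(r²)`. The simplices that stick out sit at
`O(r²)` vertices and have uniformly bounded scores (`exists_simplexScore_bound`). For the bound on
analytic scores, volumes of simplices are bounded below by compactness, which bounds the
circumradii.

Disjointness is the geometric core. A residue is almost disjoint from every simplex, since the faces
are barriers and almost every point of a simplex sees only its vertices
(`ae_visibleVertices_subset`). Two simplices of the Q-system do not overlap (`not_overlap_qSystem`).
Indeed, an overlap gives, after a Radon–Carathéodory reduction to five points, an edge of one
simplex crossing a face of the other, and comparing mean squared distances shows that this edge is a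
strict diagonal. The anchors of the diagonals involved are then so restricted that the rules of the
Q-system can only hold on both sides when six points form an octahedron quartered along two
diagonals; the fixed choice of one diagonal excludes this. The hardest estimate is that only one
anchor of a diagonal can lie behind a diagonal crossing it (`EdgeFace.anchor_unique`). -/

lemma dist_sq_eq (x y : E3) :
    dist x y ^ 2 = (x 0 - y 0) ^ 2 + (x 1 - y 1) ^ 2 + (x 2 - y 2) ^ 2 := by
  rw [EuclideanSpace.dist_eq, Real.sq_sqrt (by positivity), Fin.sum_univ_three]
  simp [Real.dist_eq, sq_abs]

/-- Stewart's theorem. -/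
lemma dist_sq_combo_two {p q u : E3} {s t : ℝ} (h : s + t = 1) :
    dist (s • p + t • q) u ^ 2 =
      s * dist p u ^ 2 + t * dist q u ^ 2 - s * t * dist p q ^ 2 := by
  obtain rfl : t = 1 - s := by linarith
  simp only [dist_sq_eq, PiLp.add_apply, PiLp.smul_apply, smul_eq_mul]
  ring

lemma dist_sq_combo_three {x y z u : E3} {a b c : ℝ} (h : a + b + c = 1) :
    dist (a • x + b • y + c • z) u ^ 2 =
      a * dist x u ^ 2 + b * dist y u ^ 2 + c * dist z u ^ 2 -
        (a * b * dist x y ^ 2 + a * c * dist x z ^ 2 + b * c * dist y z ^ 2) := by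
  obtain rfl : c = 1 - a - b := by linarith
  simp only [dist_sq_eq, PiLp.add_apply, PiLp.smul_apply, smul_eq_mul]
  ring

/-- If a point of the segment `p q` is a point of the triangle `x y z`, then the mean square
distance between the vertices is the sum of the variances. -/
lemma energy_two_three {p q x y z : E3} {s t a b c : ℝ} (hst : s + t = 1) (habc : a + b + c = 1)
    (h : s • p + t • q = a • x + b • y + c • z) :
    s * (a * dist p x ^ 2 + b * dist p y ^ 2 + c * dist p z ^ 2) +
      t * (a * dist q x ^ 2 + b * dist q y ^ 2 + c * dist q z ^ 2) =
    s * t * dist p q ^ 2 +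
      (a * b * dist x y ^ 2 + a * c * dist x z ^ 2 + b * c * dist y z ^ 2) := by
  have h1 := dist_sq_combo_three (u := p) (x := x) (y := y) (z := z) habc
  have h2 := dist_sq_combo_three (u := q) (x := x) (y := y) (z := z) habc
  have h3 := dist_sq_combo_two (u := a • x + b • y + c • z) (p := p) (q := q) hst
  rw [h, dist_self] at h3
  simp only [dist_comm _ p, dist_comm _ q] at h1 h2
  rw [h1, h2] at h3
  linear_combination -h3 +
    (a * b * dist x y ^ 2 + a * c * dist x z ^ 2 + b * c * dist y z ^ 2) * hst

/-- The segment `p q` meets the triangle `x y z`. -/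
def Crosses (p q x y z : E3) : Prop :=
  ∃ s t a b c : ℝ, 0 ≤ s ∧ 0 ≤ t ∧ 0 ≤ a ∧ 0 ≤ b ∧ 0 ≤ c ∧ s + t = 1 ∧ a + b + c = 1 ∧
    s • p + t • q = a • x + b • y + c • z

lemma mem_convexHull_pair {p q u : E3} :
    u ∈ convexHull ℝ ({p, q} : Set E3) ↔
      ∃ s t : ℝ, 0 ≤ s ∧ 0 ≤ t ∧ s + t = 1 ∧ s • p + t • q = u := by
  rw [convexHull_pair, segment]
  simp

lemma mem_convexHull_triple {x y z u : E3} :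
    u ∈ convexHull ℝ ({x, y, z} : Set E3) ↔
      ∃ a b c : ℝ, 0 ≤ a ∧ 0 ≤ b ∧ 0 ≤ c ∧ a + b + c = 1 ∧ a • x + b • y + c • z = u := by
  rw [convexHull_insert (by simp), convexHull_pair]
  simp only [convexJoin, Set.mem_singleton_iff, Set.mem_iUnion, exists_prop, exists_eq_left]
  constructor
  · rintro ⟨v, ⟨b, c, hb, hc, hbc, rfl⟩, ⟨a, d, ha, hd, had, rfl⟩⟩
    exact ⟨a, d * b, d * c, ha, by positivity, by positivity,
      by rw [add_assoc, ← mul_add, hbc, mul_one, had], by rw [smul_add, smul_smul, smul_smul, add_assoc]⟩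
  · rintro ⟨a, b, c, ha, hb, hc, h, rfl⟩
    rcases eq_or_lt_of_le (add_nonneg hb hc) with h0 | h0
    · obtain rfl : b = 0 := by linarith
      obtain rfl : c = 0 := by linarith
      refine ⟨y, left_mem_segment _ _ _, 1, 0, by norm_num, le_rfl, by norm_num, ?_⟩
      obtain rfl : a = 1 := by linarith
      simp
    · refine ⟨(b / (b + c)) • y + (c / (b + c)) • z, ⟨_, _, by positivity, by positivity,
        by field_simp, rfl⟩, a, b + c, ha, h0.le, by linarith, ?_⟩
      rw [smul_add, smul_smul, smul_smul, mul_div_cancel₀ _ h0.ne', mul_div_cancel₀ _ h0.ne',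
        add_assoc]

lemma crosses_iff {p q x y z : E3} :
    Crosses p q x y z ↔
      (convexHull ℝ ({p, q} : Set E3) ∩ convexHull ℝ ({x, y, z} : Set E3)).Nonempty := by
  constructor
  · rintro ⟨s, t, a, b, c, hs, ht, ha, hb, hc, h1, h2, h⟩
    exact ⟨_, mem_convexHull_pair.2 ⟨s, t, hs, ht, h1, rfl⟩,
      mem_convexHull_triple.2 ⟨a, b, c, ha, hb, hc, h2, h.symm⟩⟩
  · rintro ⟨u, h1, h2⟩
    obtain ⟨s, t, hs, ht, hst, rfl⟩ := mem_convexHull_pair.1 h1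
    obtain ⟨a, b, c, ha, hb, hc, habc, h⟩ := mem_convexHull_triple.1 h2
    exact ⟨s, t, a, b, c, hs, ht, ha, hb, hc, hst, habc, h.symm⟩

/-- Two edges of length at most `√8` of a packing, one of them shorter, do not cross. -/
lemma not_cross_segments {p q x y : E3} {s t a b : ℝ} (hs : 0 ≤ s) (ht : 0 ≤ t) (ha : 0 ≤ a)
    (hb : 0 ≤ b) (hst : s + t = 1) (hab : a + b = 1) (h : s • p + t • q = a • x + b • y)
    (hpx : 4 ≤ dist p x ^ 2) (hpy : 4 ≤ dist p y ^ 2) (hqx : 4 ≤ dist q x ^ 2)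
    (hqy : 4 ≤ dist q y ^ 2) (hpq : dist p q ^ 2 ≤ 8) (hxy : dist x y ^ 2 < 8) : False := by
  -- The segment `x y` is taken as the degenerate triangle `x y y` with weight zero at its third
  -- vertex.
  have h1 := energy_two_three (p := p) (q := q) (x := x) (y := y) (z := y) (a := a) (b := b)
    (c := 0) hst (by linarith) (by simpa using h)
  simp only [zero_mul, mul_zero, add_zero] at h1
  have e1 := mul_le_mul_of_nonneg_left hpx (mul_nonneg hs ha)
  have e2 := mul_le_mul_of_nonneg_left hpy (mul_nonneg hs hb)
  have e3 := mul_le_mul_of_nonneg_left hqx (mul_nonneg ht ha)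
  have e4 := mul_le_mul_of_nonneg_left hqy (mul_nonneg ht hb)
  obtain rfl : t = 1 - s := by linarith
  obtain rfl : b = 1 - a := by linarith
  -- Each variance is at most a quarter of the squared length, so together they are below `2 + 2`,
  -- while the mean square distance is at least `4`.
  have f1 : s * (1 - s) ≤ 1 / 4 := by nlinarith [sq_nonneg (s - 1 / 2)]
  have f2 : a * (1 - a) ≤ 1 / 4 := by nlinarith [sq_nonneg (a - 1 / 2)]
  have f3 : s * (1 - s) * dist p q ^ 2 ≤ 1 / 4 * dist p q ^ 2 := by gcongr
  have f4 : a * (1 - a) * dist x y ^ 2 ≤ 1 / 4 * dist x y ^ 2 := by gcongr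
  nlinarith

/-- The six products of weights in `energy_two_three` sum to one, so the squared distances may be
replaced by `4`. Only the excess at `p x` is kept: `dist_sq_le_of_crosses` bounds that distance. -/
lemma energy_lower {p q x y z : E3} {s t a b c : ℝ} (hs : 0 ≤ s) (ht : 0 ≤ t) (ha : 0 ≤ a)
    (hb : 0 ≤ b) (hc : 0 ≤ c) (hst : s + t = 1) (habc : a + b + c = 1)
    (h : s • p + t • q = a • x + b • y + c • z)
    (hpy : 4 ≤ dist p y ^ 2) (hpz : 4 ≤ dist p z ^ 2)
    (hqx : 4 ≤ dist q x ^ 2) (hqy : 4 ≤ dist q y ^ 2) (hqz : 4 ≤ dist q z ^ 2) :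
    4 + s * a * (dist p x ^ 2 - 4) ≤ s * t * dist p q ^ 2 +
      (a * b * dist x y ^ 2 + a * c * dist x z ^ 2 + b * c * dist y z ^ 2) := by
  rw [← energy_two_three hst habc h]
  have e2 := mul_le_mul_of_nonneg_left hpy (mul_nonneg hs hb)
  have e3 := mul_le_mul_of_nonneg_left hpz (mul_nonneg hs hc)
  have e4 := mul_le_mul_of_nonneg_left hqx (mul_nonneg ht ha)
  have e5 := mul_le_mul_of_nonneg_left hqy (mul_nonneg ht hb)
  have e6 := mul_le_mul_of_nonneg_left hqz (mul_nonneg ht hc)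
  have : (s + t) * (a + b + c) = 1 := by rw [hst, habc, one_mul]
  nlinarith

/-- Short edges do not cross faces of quarters. -/
lemma not_crosses_of_short {p q x y z : E3} (hc : Crosses p q x y z)
    (hpx : 4 ≤ dist p x ^ 2) (hpy : 4 ≤ dist p y ^ 2) (hpz : 4 ≤ dist p z ^ 2)
    (hqx : 4 ≤ dist q x ^ 2) (hqy : 4 ≤ dist q y ^ 2) (hqz : 4 ≤ dist q z ^ 2)
    (hpq : dist p q ^ 2 ≤ 6.3001) (hxy : dist x y ^ 2 ≤ 8) (hxz : dist x z ^ 2 ≤ 6.3001)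
    (hyz : dist y z ^ 2 ≤ 6.3001) : False := by
  obtain ⟨s, t, a, b, c, hs, ht, ha, hb, hc, hst, habc, h⟩ := hc
  have h1 := energy_lower hs ht ha hb hc hst habc h hpy hpz hqx hqy hqz
  have h0 : 0 ≤ s * a * (dist p x ^ 2 - 4) :=
    mul_nonneg (mul_nonneg hs ha) (by linarith)
  have e1 := mul_le_mul_of_nonneg_left hpq (mul_nonneg hs ht)
  have e2 := mul_le_mul_of_nonneg_left hxy (mul_nonneg ha hb)
  have e3 := mul_le_mul_of_nonneg_left hxz (mul_nonneg ha hc)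
  have e4 := mul_le_mul_of_nonneg_left hyz (mul_nonneg hb hc)
  obtain rfl : t = 1 - s := by linarith
  obtain rfl : c = 1 - a - b := by linarith
  have f1 : s * (1 - s) ≤ 1 / 4 := by nlinarith [sq_nonneg (s - 1 / 2)]
  -- Here `6.3001 = (2 * t0) ^ 2`. The variance of the triangle is largest at `a = b`, `a + b =
  -- 6.3001 / 8.6002`, with value about `2.308`; adding `6.3001 / 4` for the segment stays below
  -- `4`.
  nlinarith [sq_nonneg (a - b), sq_nonneg (a + b - 0.733)]

/-- The ends of an edge of a triangle crossed by a diagonal are anchors of the diagonal. -/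
lemma dist_sq_le_of_crosses {p q x y z : E3} (hc : Crosses p q x y z)
    (hpy : 4 ≤ dist p y ^ 2) (hpz : 4 ≤ dist p z ^ 2)
    (hqx : 4 ≤ dist q x ^ 2) (hqy : 4 ≤ dist q y ^ 2) (hqz : 4 ≤ dist q z ^ 2)
    (hpq : dist p q ^ 2 ≤ 8) (hxy : dist x y ^ 2 ≤ 8) (hxz : dist x z ^ 2 ≤ 6.3001)
    (hyz : dist y z ^ 2 ≤ 6.3001) : dist p x ^ 2 ≤ 6.3001 := by
  by_contra! hlt
  obtain ⟨s, t, a, b, c, hs, ht, ha, hb, hc, hst, habc, h⟩ := hc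
  have h1 := energy_lower hs ht ha hb hc hst habc h hpy hpz hqx hqy hqz
  have h0 : s * a * 2.3001 ≤ s * a * (dist p x ^ 2 - 4) :=
    mul_le_mul_of_nonneg_left (by linarith) (mul_nonneg hs ha)
  have e1 := mul_le_mul_of_nonneg_left hpq (mul_nonneg hs ht)
  have e2 := mul_le_mul_of_nonneg_left hxy (mul_nonneg ha hb)
  have e3 := mul_le_mul_of_nonneg_left hxz (mul_nonneg ha hc)
  have e4 := mul_le_mul_of_nonneg_left hyz (mul_nonneg hb hc)
  have key : s * a * 2.3001 + 4 ≤ s * t * 8 + (a * b * 8 + a * c * 6.3001 + b * c * 6.3001) := by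
    linarith
  clear h0 h1 e1 e2 e3 e4
  obtain rfl : t = 1 - s := by linarith
  obtain rfl : b = 1 - a - c := by linarith
  -- The squares complete a concave quadratic, first in `s`, then in `a`, then in `c`; its maximum
  -- is about `3.96`, below `4`.
  nlinarith [sq_nonneg (s + 0.143756 * a - 1 / 2), sq_nonneg (a + 0.51055 * c - 0.43715),
    sq_nonneg (c - 0.3291)]

end Kepler

/-! ### Affine dependencies: reduction to five points and exchange -/

namespace Kepler

/-- A dependency can be moved along another one until one of its coefficients vanishes; it may
acquire a nonnegative coefficient on `W`, which has at most one element. -/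
lemma exists_dependency_vanishing {A B W : Finset E3}
    (hW : W.card ≤ 1) {m : E3 → ℝ} (hA : ∀ i ∈ A, 0 < m i)
    (hB : ∀ i ∈ B, m i < 0) (hmW : ∀ i ∈ W, m i = 0) (hne : (A ∪ B).Nonempty)
    (h0 : ∑ i ∈ A ∪ B ∪ W, m i = 0) (h1 : ∑ i ∈ A ∪ B ∪ W, m i • i = 0)
    (hcard : 6 ≤ (A ∪ B ∪ W).card) :
    ∃ m' : E3 → ℝ, ∑ i ∈ A ∪ B ∪ W, m' i = 0 ∧ ∑ i ∈ A ∪ B ∪ W, m' i • i = 0 ∧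
      (∀ i ∈ A ∪ W, 0 ≤ m' i) ∧ (∀ i ∈ B, m' i ≤ 0) ∧ (∃ i ∈ A ∪ B ∪ W, m' i ≠ 0) ∧
      ∃ i ∈ A ∪ B, m' i = 0 := by
  classical
  set T := A ∪ B ∪ W with hT
  -- An element of the kernel is a dependency orthogonal to `m`: six unknowns against `1 + 3 + 1`
  -- equations. Orthogonality ensures that adding a multiple of `m` never produces zero.
  let L : (T → ℝ) →ₗ[ℝ] ℝ × E3 × ℝ :=
    { toFun := fun f => (∑ i, f i, ∑ i, f i • (i : E3), ∑ i, f i * m i)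
      map_add' := fun f g => by
        simp [add_smul, add_mul, Finset.sum_add_distrib]
      map_smul' := fun c f => by
        simp [mul_smul, mul_assoc, Finset.mul_sum, Finset.smul_sum] }
  have hker : LinearMap.ker L ≠ ⊥ := by
    apply LinearMap.ker_ne_bot_of_finrank_lt
    simp only [Module.finrank_prod, Module.finrank_self, finrank_euclideanSpace, Fintype.card_fin,
      Module.finrank_fintype_fun_eq_card, Fintype.card_coe]
    omega
  obtain ⟨f, hf, hf0⟩ := (Submodule.ne_bot_iff _).1 hker
  have hfL : (∑ i, f i, ∑ i, f i • (i : E3), ∑ i, f i * m i) = (0 : ℝ × E3 × ℝ) := hf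
  simp only [Prod.mk_eq_zero] at hfL
  have hD : ∃ D : E3 → ℝ, ∑ i ∈ T, D i = 0 ∧ ∑ i ∈ T, D i • i = 0 ∧ ∑ i ∈ T, D i * m i = 0 ∧
      (∃ i ∈ T, D i ≠ 0) ∧ ∀ i ∈ W, 0 ≤ D i := by
    let D : E3 → ℝ := fun i => if h : i ∈ T then f ⟨i, h⟩ else 0
    have e1 : ∑ i ∈ T, D i = 0 := by
      rw [← Finset.sum_coe_sort]; simpa [D] using hfL.1
    have e2 : ∑ i ∈ T, D i • i = 0 := by
      rw [← Finset.sum_coe_sort]; simpa [D] using hfL.2.1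
    have e3 : ∑ i ∈ T, D i * m i = 0 := by
      rw [← Finset.sum_coe_sort]; simpa [D] using hfL.2.2
    have e4 : ∃ i ∈ T, D i ≠ 0 := by
      by_contra! hc
      exact hf0 (funext fun i => by simpa [D] using hc i i.2)
    rcases Finset.card_le_one_iff_subset_singleton.1 hW with ⟨w, hw⟩
    by_cases hs : 0 ≤ D w
    · exact ⟨D, e1, e2, e3, e4, fun i hi => by rwa [Finset.mem_singleton.1 (hw hi)]⟩
    · refine ⟨fun i => -D i, by simp [e1], by simp [e2], by simp [e3], by simpa using e4,
        fun i hi => ?_⟩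
      rw [Finset.mem_singleton.1 (hw hi)]
      linarith
  obtain ⟨D, e1, e2, e3, ⟨j, hj, hj0⟩, e5⟩ := hD
  -- The maximum of `-D i / m i` is the least `lam` for which `D + lam * m` has the weak signs of
  -- `m` on `A` and `B`; at the maximizing index the coefficient vanishes.
  obtain ⟨i0, hi0, hmax⟩ := Finset.exists_max_image (A ∪ B) (fun i => -D i / m i) hne
  set lam := -D i0 / m i0 with hlam
  have hm0 : ∀ i ∈ A ∪ B, m i ≠ 0 := by
    intro i hi
    rcases Finset.mem_union.1 hi with h | h
    · exact (hA i h).ne'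
    · exact (hB i h).ne
  refine ⟨fun i => D i + lam * m i, ?_, ?_, ?_, ?_, ?_, i0, hi0, ?_⟩
  · rw [Finset.sum_add_distrib, ← Finset.mul_sum, h0, e1]; simp
  · simp only [add_smul, mul_smul, Finset.sum_add_distrib, ← Finset.smul_sum, h1, e2]; simp
  · intro i hi
    rcases Finset.mem_union.1 hi with h | h
    · have := hmax i (Finset.mem_union_left _ h)
      rw [div_le_iff₀ (hA i h)] at this
      linarith
    · simpa [hmW i h] using e5 i h
  · intro i hi
    have := hmax i (Finset.mem_union_right _ hi)
    rw [div_le_iff_of_neg (hB i hi)] at this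
    linarith
  · by_contra! hc
    have : ∑ i ∈ T, D i * D i = 0 := by
      have h2 : ∑ i ∈ T, D i * D i = ∑ i ∈ T, (-lam) * (D i * m i) := by
        refine Finset.sum_congr rfl fun i hi => ?_
        linear_combination D i * hc i hi
      rw [h2, ← Finset.mul_sum, e3, mul_zero]
    rw [Finset.sum_eq_zero_iff_of_nonneg (fun i _ => mul_self_nonneg _)] at this
    exact hj0 (mul_self_eq_zero.1 (this j hj))
  · have := hm0 i0 hi0
    simp only [hlam]
    field_simp
    ring

/-- The convex hulls of the positive and of the negative part of a dependency meet. -/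
lemma hull_inter_of_dependency {A B : Finset E3} (hAB : Disjoint A B) {m : E3 → ℝ}
    (h0 : ∑ i ∈ A ∪ B, m i = 0) (h1 : ∑ i ∈ A ∪ B, m i • i = 0) (hA : ∀ i ∈ A, 0 ≤ m i)
    (hB : ∀ i ∈ B, m i ≤ 0) (hne : ∃ i ∈ A ∪ B, m i ≠ 0) {A' B' : Finset E3} (hA' : A' ⊆ A)
    (hB' : B' ⊆ B) (hAz : ∀ i ∈ A, i ∉ A' → m i = 0) (hBz : ∀ i ∈ B, i ∉ B' → m i = 0) :
    (convexHull ℝ (A' : Set E3) ∩ convexHull ℝ (B' : Set E3)).Nonempty := by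
  classical
  rw [Finset.sum_union hAB] at h0 h1
  have a0 : ∑ i ∈ A', m i = ∑ i ∈ A, m i := Finset.sum_subset hA' hAz
  have b0 : ∑ i ∈ B', m i = ∑ i ∈ B, m i := Finset.sum_subset hB' hBz
  have a1 : ∑ i ∈ A', m i • i = ∑ i ∈ A, m i • i :=
    Finset.sum_subset hA' fun i h h' => by rw [hAz i h h', zero_smul]
  have b1 : ∑ i ∈ B', m i • i = ∑ i ∈ B, m i • i :=
    Finset.sum_subset hB' fun i h h' => by rw [hBz i h h', zero_smul]
  set s := ∑ i ∈ A, m i with hs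
  have hs0 : 0 < s := by
    refine lt_of_le_of_ne (Finset.sum_nonneg hA) fun hz => ?_
    obtain ⟨i, hi, hi0⟩ := hne
    rcases Finset.mem_union.1 hi with h | h
    · exact hi0 ((Finset.sum_eq_zero_iff_of_nonneg hA).1 hz.symm i h)
    · have : ∑ i ∈ B, m i = 0 := by linarith
      exact hi0 ((Finset.sum_eq_zero_iff_of_nonpos hB).1 this i h)
  refine ⟨s⁻¹ • ∑ i ∈ A, m i • i, ?_, ?_⟩
  · rw [← a1, Finset.mem_convexHull']
    refine ⟨fun i => s⁻¹ * m i, fun i hi => mul_nonneg (by positivity) (hA i (hA' hi)), ?_, ?_⟩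
    · rw [← Finset.mul_sum, a0, inv_mul_cancel₀ hs0.ne']
    · simp only [mul_smul, Finset.smul_sum]
  · rw [eq_neg_of_add_eq_zero_left h1, ← b1, Finset.mem_convexHull']
    refine ⟨fun i => -(s⁻¹ * m i), fun i hi => ?_, ?_, ?_⟩
    · have := mul_nonneg (inv_nonneg.2 hs0.le) (neg_nonneg.2 (hB i (hB' hi)))
      linarith
    · rw [Finset.sum_neg_distrib, ← Finset.mul_sum, b0,
        show ∑ i ∈ B, m i = -s by linarith, mul_neg, neg_neg, inv_mul_cancel₀ hs0.ne']
    · simp only [neg_smul, mul_smul, Finset.sum_neg_distrib, Finset.smul_sum, smul_neg]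

/-- The dependency defined by a common point of two convex hulls. -/
lemma exists_dependency_of_hull_inter {A B : Finset E3} (hAB : Disjoint A B)
    (h : (convexHull ℝ (A : Set E3) ∩ convexHull ℝ (B : Set E3)).Nonempty) :
    ∃ m : E3 → ℝ, ∑ i ∈ A ∪ B, m i = 0 ∧ ∑ i ∈ A ∪ B, m i • i = 0 ∧ (∀ i ∈ A, 0 ≤ m i) ∧
      (∀ i ∈ B, m i ≤ 0) ∧ ∃ i ∈ A ∪ B, m i ≠ 0 := by
  classical
  obtain ⟨z, hz1, hz2⟩ := h
  obtain ⟨a, ha, ha1, ha2⟩ := Finset.mem_convexHull'.1 hz1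
  obtain ⟨b, hb, hb1, hb2⟩ := Finset.mem_convexHull'.1 hz2
  have hmA : ∀ i ∈ A, (if i ∈ A then a i else -b i) = a i := fun i hi => if_pos hi
  have hmB : ∀ i ∈ B, (if i ∈ A then a i else -b i) = -b i :=
    fun i hi => if_neg (Finset.disjoint_right.1 hAB hi)
  refine ⟨fun i => if i ∈ A then a i else -b i, ?_, ?_, ?_, ?_, ?_⟩
  · rw [Finset.sum_union hAB, Finset.sum_congr rfl hmA, Finset.sum_congr rfl hmB,
      Finset.sum_neg_distrib, ha1, hb1]; ring
  · have hA : ∀ i ∈ A, (if i ∈ A then a i else -b i) • i = a i • i :=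
      fun i hi => by rw [hmA i hi]
    have hB : ∀ i ∈ B, (if i ∈ A then a i else -b i) • i = -(b i • i) :=
      fun i hi => by rw [hmB i hi, neg_smul]
    rw [Finset.sum_union hAB, Finset.sum_congr rfl hA, Finset.sum_congr rfl hB,
      Finset.sum_neg_distrib, ha2, hb2, add_neg_cancel]
  · intro i hi
    simpa only [hmA i hi] using ha i hi
  · intro i hi
    simpa only [hmB i hi, neg_nonpos] using hb i hi
  · by_contra! hc
    have : ∑ i ∈ A, a i = 0 := Finset.sum_eq_zero fun i hi => by
      rw [← hmA i hi]; exact hc i (Finset.mem_union_left _ hi)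
    linarith

/-- A version of the theorems of Carathéodory and Radon. -/
lemma exists_small_hull_inter (n : ℕ) : ∀ {A B : Finset E3}, A.card + B.card ≤ n → Disjoint A B →
    (convexHull ℝ (A : Set E3) ∩ convexHull ℝ (B : Set E3)).Nonempty →
    ∃ A' B' : Finset E3, A' ⊆ A ∧ B' ⊆ B ∧ A'.card + B'.card ≤ 5 ∧
      (convexHull ℝ (A' : Set E3) ∩ convexHull ℝ (B' : Set E3)).Nonempty := by
  classical
  induction n with
  | zero => exact fun {A B} hn _ h => ⟨A, B, subset_rfl, subset_rfl, by omega, h⟩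
  | succ n ih =>
    intro A B hn hAB h
    by_cases h5 : A.card + B.card ≤ 5
    · exact ⟨A, B, subset_rfl, subset_rfl, h5, h⟩
    have step : ∃ m : E3 → ℝ, ∑ i ∈ A ∪ B, m i = 0 ∧ ∑ i ∈ A ∪ B, m i • i = 0 ∧
        (∀ i ∈ A, 0 ≤ m i) ∧ (∀ i ∈ B, m i ≤ 0) ∧ (∃ i ∈ A ∪ B, m i ≠ 0) ∧
        ∃ i ∈ A ∪ B, m i = 0 := by
      obtain ⟨m, m1, m2, m3, m4, m5⟩ := exists_dependency_of_hull_inter hAB h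
      by_cases hz : ∃ i ∈ A ∪ B, m i = 0
      · exact ⟨m, m1, m2, m3, m4, m5, hz⟩
      push Not at hz
      have := exists_dependency_vanishing (W := ∅) (by simp)
        (fun i hi => lt_of_le_of_ne (m3 i hi) (hz i (Finset.mem_union_left _ hi)).symm)
        (fun i hi => lt_of_le_of_ne (m4 i hi) (hz i (Finset.mem_union_right _ hi))) (by simp)
        (by obtain ⟨i, hi, _⟩ := m5; exact ⟨i, hi⟩) (by simpa using m1) (by simpa using m2)
        (by rw [Finset.union_empty, Finset.card_union_of_disjoint hAB]; omega)
      simpa only [Finset.union_empty] using this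
    obtain ⟨m, m1, m2, m3, m4, m5, i, hi, hi0⟩ := step
    have hh := hull_inter_of_dependency hAB m1 m2 m3 m4 m5 (Finset.erase_subset i A)
      (Finset.erase_subset i B)
      (fun j hj hj' => by
        rw [Finset.mem_erase] at hj'
        obtain rfl : j = i := by by_contra hne; exact hj' ⟨hne, hj⟩
        exact hi0)
      (fun j hj hj' => by
        rw [Finset.mem_erase] at hj'
        obtain rfl : j = i := by by_contra hne; exact hj' ⟨hne, hj⟩
        exact hi0)
    have hcard : (A.erase i).card + (B.erase i).card ≤ n := by
      have hA := Finset.card_erase_le (s := A) (a := i)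
      have hB := Finset.card_erase_le (s := B) (a := i)
      rcases Finset.mem_union.1 hi with h | h
      · have := Finset.card_erase_of_mem h
        have := Finset.card_pos.2 ⟨i, h⟩
        omega
      · have := Finset.card_erase_of_mem h
        have := Finset.card_pos.2 ⟨i, h⟩
        omega
    obtain ⟨A', B', hA', hB', h1, h2⟩ := ih hcard
      (Finset.disjoint_of_subset_left (Finset.erase_subset _ _)
        (Finset.disjoint_of_subset_right (Finset.erase_subset _ _) hAB)) hh
    exact ⟨A', B', hA'.trans (Finset.erase_subset _ _), hB'.trans (Finset.erase_subset _ _), h1, h2⟩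

/-- If the hulls of `A` and `B` meet, and no proper part of one of them does, then `w` can replace
an element of `A`, or be added to `A` when an element of `B` is removed. -/
lemma hull_inter_exchange {A B : Finset E3} {w : E3} (hAB : Disjoint A B) (hwA : w ∉ A)
    (hwB : w ∉ B) (hcard : A.card + B.card = 5)
    (h : (convexHull ℝ (A : Set E3) ∩ convexHull ℝ (B : Set E3)).Nonempty)
    (hA : ∀ i ∈ A, ¬(convexHull ℝ (A.erase i : Set E3) ∩ convexHull ℝ (B : Set E3)).Nonempty)
    (hB : ∀ i ∈ B, ¬(convexHull ℝ (A : Set E3) ∩ convexHull ℝ (B.erase i : Set E3)).Nonempty) :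
    (∃ i ∈ A, (convexHull ℝ (insert w (A.erase i) : Set E3) ∩
        convexHull ℝ (B : Set E3)).Nonempty) ∨
      ∃ i ∈ B, (convexHull ℝ (insert w A : Set E3) ∩
        convexHull ℝ (B.erase i : Set E3)).Nonempty := by
  classical
  obtain ⟨m, m1, m2, m3, m4, m5⟩ := exists_dependency_of_hull_inter hAB h
  have hzA : ∀ i ∈ A, m i ≠ 0 := fun i hi hi0 => hA i hi <| by
    have := hull_inter_of_dependency hAB m1 m2 m3 m4 m5 (Finset.erase_subset i A)
      (subset_refl B) (fun j hj hj' => by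
        rw [Finset.mem_erase] at hj'
        obtain rfl : j = i := by by_contra hne; exact hj' ⟨hne, hj⟩
        exact hi0) (fun j hj hj' => absurd hj hj')
    simpa using this
  have hzB : ∀ i ∈ B, m i ≠ 0 := fun i hi hi0 => hB i hi <| by
    have := hull_inter_of_dependency hAB m1 m2 m3 m4 m5 (subset_refl A)
      (Finset.erase_subset i B) (fun j hj hj' => absurd hj hj') (fun j hj hj' => by
        rw [Finset.mem_erase] at hj'
        obtain rfl : j = i := by by_contra hne; exact hj' ⟨hne, hj⟩
        exact hi0)
    simpa using this
  -- By minimality all five coefficients are nonzero. With coefficient zero at `w` there are six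
  -- points, and the dependency can be moved until an old coefficient vanishes while `w` joins the
  -- side of `A`.
  set m₀ : E3 → ℝ := fun i => if i = w then 0 else m i with hm₀
  have hm₀e : ∀ i ∈ A ∪ B, m₀ i = m i := fun i hi => by
    have : i ≠ w := by rintro rfl; simp [hwA, hwB] at hi
    simp [hm₀, this]
  have hw : w ∉ A ∪ B := by simp [hwA, hwB]
  have hdABw : Disjoint (A ∪ B) {w} := by simpa using hw
  obtain ⟨m', e1, e2, e3, e4, e5, i, hi, hi0⟩ := exists_dependency_vanishing (W := {w}) (m := m₀)
    (by simp)
    (fun i hi => by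
      rw [hm₀e i (Finset.mem_union_left _ hi)]
      exact lt_of_le_of_ne (m3 i hi) (hzA i hi).symm)
    (fun i hi => by
      rw [hm₀e i (Finset.mem_union_right _ hi)]
      exact lt_of_le_of_ne (m4 i hi) (hzB i hi))
    (fun i hi => by simp [hm₀, Finset.mem_singleton.1 hi])
    (by obtain ⟨i, hi, _⟩ := m5; exact ⟨i, hi⟩)
    (by rw [Finset.sum_union hdABw, Finset.sum_congr rfl hm₀e, m1]; simp [hm₀])
    (by rw [Finset.sum_union hdABw,
          Finset.sum_congr rfl fun i hi => by rw [hm₀e i hi], m2]; simp [hm₀])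
    (by rw [Finset.card_union_of_disjoint hdABw, Finset.card_union_of_disjoint hAB,
          Finset.card_singleton]; omega)
  have hset : A ∪ B ∪ {w} = insert w A ∪ B := by ext; simp
  have hd : Disjoint (insert w A) B := by
    rw [Finset.disjoint_insert_left]; exact ⟨hwB, hAB⟩
  rw [hset] at e1 e2 e5
  have e3' : ∀ i ∈ insert w A, 0 ≤ m' i := fun i hi => e3 i (by simp at hi ⊢; tauto)
  rcases Finset.mem_union.1 hi with h | h
  · left
    refine ⟨i, h, ?_⟩
    have := hull_inter_of_dependency hd e1 e2 e3' e4 e5 (A' := insert w (A.erase i)) (B' := B)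
      (Finset.insert_subset_insert _ (Finset.erase_subset _ _)) subset_rfl
      (fun j hj hj' => by
        simp only [Finset.mem_insert, Finset.mem_erase, not_or, not_and] at hj hj'
        obtain rfl : j = i := by
          by_contra hne
          exact hj'.2 hne (hj.resolve_left hj'.1)
        exact hi0) (fun j hj hj' => absurd hj hj')
    simpa using this
  · right
    refine ⟨i, h, ?_⟩
    have := hull_inter_of_dependency hd e1 e2 e3' e4 e5 (A' := insert w A) (B' := B.erase i)
      subset_rfl (Finset.erase_subset _ _) (fun j hj hj' => absurd hj hj') (fun j hj hj' => by
        rw [Finset.mem_erase] at hj'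
        obtain rfl : j = i := by by_contra hne; exact hj' ⟨hne, hj⟩
        exact hi0)
    simpa using this

end Kepler

/-! ### Edges crossing faces in a packing -/

namespace Kepler

/-- The parallel axis theorem. -/
lemma sum_weights_dist_sq {B : Finset E3} {w : E3 → ℝ} {z : E3} (h1 : ∑ i ∈ B, w i = 1)
    (h2 : ∑ i ∈ B, w i • i = z) (u : E3) :
    ∑ i ∈ B, w i * dist i u ^ 2 = dist z u ^ 2 + ∑ i ∈ B, w i * dist i z ^ 2 := by
  have h3 : ∑ i ∈ B, w i • (i - z) = 0 := by
    simp only [smul_sub, Finset.sum_sub_distrib, ← Finset.sum_smul, h1, h2, one_smul, sub_self]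
  have h4 : ∑ i ∈ B, w i * (2 * inner ℝ (i - z) (z - u)) = 0 := by
    have : ∑ i ∈ B, w i * inner ℝ (i - z) (z - u) = 0 := by
      rw [← inner_zero_left (𝕜 := ℝ) (z - u), ← h3, sum_inner]
      simp only [inner_smul_left]; simp
    calc _ = 2 * ∑ i ∈ B, w i * inner ℝ (i - z) (z - u) := by
          rw [Finset.mul_sum]; exact Finset.sum_congr rfl fun i _ => by ring
      _ = 0 := by rw [this, mul_zero]
  have h5 : ∀ i ∈ B, w i * dist i u ^ 2 = w i * dist i z ^ 2 +
      w i * (2 * inner ℝ (i - z) (z - u)) + w i * dist z u ^ 2 := fun i _ => by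
    rw [dist_eq_norm i u, ← sub_add_sub_cancel i z u, norm_add_sq_real, dist_eq_norm, dist_eq_norm]
    ring
  rw [Finset.sum_congr rfl h5, Finset.sum_add_distrib, Finset.sum_add_distrib, h4,
    ← Finset.sum_mul, h1]
  ring

/-- A lower bound for the distance of a point `v` from a simplex with edges at most `√8` and
vertices at distance at least two from `v`. -/
lemma four_mul_sum_sq_le {B : Finset E3} {w : E3 → ℝ} {z v : E3} (h0 : ∀ i ∈ B, 0 ≤ w i)
    (h1 : ∑ i ∈ B, w i = 1) (h2 : ∑ i ∈ B, w i • i = z) (hv : ∀ i ∈ B, 4 ≤ dist i v ^ 2)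
    (hB : ∀ i ∈ B, ∀ j ∈ B, dist i j ^ 2 ≤ 8) : 4 * ∑ i ∈ B, w i ^ 2 ≤ dist z v ^ 2 := by
  have e1 := sum_weights_dist_sq h1 h2 v
  have e2 : 4 ≤ ∑ i ∈ B, w i * dist i v ^ 2 := by
    calc (4 : ℝ) = ∑ i ∈ B, w i * 4 := by rw [← Finset.sum_mul, h1, one_mul]
      _ ≤ _ := Finset.sum_le_sum fun i hi => mul_le_mul_of_nonneg_left (hv i hi) (h0 i hi)
  set V := ∑ i ∈ B, w i * dist i z ^ 2 with hV
  -- The mean square distance to a vertex `j` is at most `8 * (1 - w j)`, as `j` itself contributes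
  -- nothing. Averaging over `j` gives `2 * V ≤ 8 - 8 * ∑ w ^ 2`.
  have e3 : ∀ j ∈ B, dist z j ^ 2 + V ≤ 8 - 8 * w j := fun j hj => by
    rw [← sum_weights_dist_sq h1 h2 j]
    classical
    rw [← Finset.add_sum_erase _ _ hj] at h1 ⊢
    have : ∑ i ∈ B.erase j, w i * dist i j ^ 2 ≤ ∑ i ∈ B.erase j, w i * 8 :=
      Finset.sum_le_sum fun i hi => mul_le_mul_of_nonneg_left
        (hB i (Finset.mem_of_mem_erase hi) j hj) (h0 i (Finset.mem_of_mem_erase hi))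
    rw [← Finset.sum_mul] at this
    rw [dist_self]
    linarith
  have e4 : ∑ j ∈ B, w j * (dist z j ^ 2 + V) ≤ ∑ j ∈ B, w j * (8 - 8 * w j) :=
    Finset.sum_le_sum fun j hj => mul_le_mul_of_nonneg_left (e3 j hj) (h0 j hj)
  have e5 : ∑ j ∈ B, w j * (dist z j ^ 2 + V) = 2 * V := by
    simp only [mul_add, Finset.sum_add_distrib, ← Finset.sum_mul, h1]
    simp only [dist_comm z, ← hV]; ring
  have e6 : ∑ j ∈ B, w j * (8 - 8 * w j) = 8 - 8 * ∑ j ∈ B, w j ^ 2 := by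
    have : ∀ j ∈ B, w j * (8 - 8 * w j) = w j * 8 - 8 * w j ^ 2 := fun j _ => by ring
    rw [Finset.sum_congr rfl this, Finset.sum_sub_distrib, ← Finset.sum_mul, ← Finset.mul_sum, h1]
    ring
  linarith

/-- At distance zero, `four_mul_sum_sq_le` makes all weights vanish, although they sum to one. -/
lemma not_mem_convexHull {B : Finset E3} {v : E3} (hv : ∀ i ∈ B, 4 ≤ dist i v ^ 2)
    (hB : ∀ i ∈ B, ∀ j ∈ B, dist i j ^ 2 ≤ 8) : v ∉ convexHull ℝ (B : Set E3) := by
  intro h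
  obtain ⟨w, h0, h1, h2⟩ := Finset.mem_convexHull'.1 h
  have := four_mul_sum_sq_le h0 h1 h2 hv hB
  rw [dist_self] at this
  have h3 : ∑ i ∈ B, w i ^ 2 = 0 :=
    le_antisymm (by linarith) (Finset.sum_nonneg fun i _ => sq_nonneg _)
  rw [Finset.sum_eq_zero_iff_of_nonneg fun i _ => sq_nonneg _] at h3
  rw [Finset.sum_eq_zero fun i hi => pow_eq_zero_iff two_ne_zero |>.1 (h3 i hi)] at h1
  exact zero_ne_one h1

lemma IsPacking.four_le {P : Set E3} (hP : IsPacking P) {v w : E3} (hv : v ∈ P) (hw : w ∈ P)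
    (h : v ≠ w) : 4 ≤ dist v w ^ 2 := by
  have := hP v hv w hw h
  nlinarith

lemma dist_sq_le_of_le_t0 {v w : E3} (h : dist v w ≤ 2 * t0) : dist v w ^ 2 ≤ 6.3001 := by
  have : 0 ≤ dist v w := dist_nonneg
  norm_num [t0] at h
  nlinarith

lemma dist_le_t0_of_sq {v w : E3} (h : dist v w ^ 2 ≤ 6.3001) : dist v w ≤ 2 * t0 := by
  norm_num [t0]
  by_contra! h'
  nlinarith

lemma dist_sq_lt_of_lt_sqrt {v w : E3} (h : dist v w < √8) : dist v w ^ 2 < 8 := by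
  have h1 : 0 ≤ dist v w := dist_nonneg
  calc dist v w ^ 2 < √8 ^ 2 := by gcongr
    _ = 8 := Real.sq_sqrt (by norm_num)

lemma lt_sqrt_eight_of_le {v w : E3} (h : dist v w ≤ 2 * t0) : dist v w < √8 := by
  refine lt_of_le_of_lt h (Real.lt_sqrt_of_sq_lt ?_)
  norm_num [t0]

lemma Crosses.swap_edge {p q x y z : E3} (h : Crosses p q x y z) : Crosses q p x y z := by
  rw [crosses_iff] at *; rwa [Set.pair_comm]

lemma Crosses.swap_face {p q x y z : E3} (h : Crosses p q x y z) : Crosses p q y x z := by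
  rw [crosses_iff] at *; rwa [Set.insert_comm]

/-- Five distinct points of a packing, where the pair `x y z` is a face of a quarter or a
quasi-regular triangle. -/
structure EdgeFace (P : Set E3) (p q x y z : E3) : Prop where
  mem_p : p ∈ P
  mem_q : q ∈ P
  mem_x : x ∈ P
  mem_y : y ∈ P
  mem_z : z ∈ P
  pq : p ≠ q
  px : p ≠ x
  py : p ≠ y
  pz : p ≠ z
  qx : q ≠ x
  qy : q ≠ y
  qz : q ≠ z
  xy : x ≠ y
  xz : x ≠ z
  yz : y ≠ z
  xy_lt : dist x y < √8
  xz_le : dist x z ≤ 2 * t0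
  yz_le : dist y z ≤ 2 * t0
  pq_lt : dist p q < √8

variable {P : Set E3}

lemma EdgeFace.swap_edge {p q x y z : E3} (h : EdgeFace P p q x y z) : EdgeFace P q p x y z :=
  { h with
    mem_p := h.mem_q, mem_q := h.mem_p, pq := h.pq.symm, px := h.qx, py := h.qy, pz := h.qz,
    qx := h.px, qy := h.py, qz := h.pz, pq_lt := by rw [dist_comm]; exact h.pq_lt }

lemma EdgeFace.swap_face {p q x y z : E3} (h : EdgeFace P p q x y z) : EdgeFace P p q y x z :=
  { h with
    mem_x := h.mem_y, mem_y := h.mem_x, px := h.py, py := h.px, qx := h.qy, qy := h.qx,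
    xy := h.xy.symm, xz := h.yz, yz := h.xz, xy_lt := by rw [dist_comm]; exact h.xy_lt,
    xz_le := h.yz_le, yz_le := h.xz_le }

lemma EdgeFace.not_crosses (hP : IsPacking P) {p q x y z : E3} (h : EdgeFace P p q x y z)
    (hpq : dist p q ≤ 2 * t0) : ¬Crosses p q x y z := fun hc =>
  not_crosses_of_short hc (hP.four_le h.mem_p h.mem_x h.px) (hP.four_le h.mem_p h.mem_y h.py)
    (hP.four_le h.mem_p h.mem_z h.pz) (hP.four_le h.mem_q h.mem_x h.qx)
    (hP.four_le h.mem_q h.mem_y h.qy) (hP.four_le h.mem_q h.mem_z h.qz) (dist_sq_le_of_le_t0 hpq)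
    (dist_sq_lt_of_lt_sqrt h.xy_lt).le (dist_sq_le_of_le_t0 h.xz_le) (dist_sq_le_of_le_t0 h.yz_le)

lemma EdgeFace.dist_px_le (hP : IsPacking P) {p q x y z : E3} (h : EdgeFace P p q x y z)
    (hc : Crosses p q x y z) : dist p x ≤ 2 * t0 :=
  dist_le_t0_of_sq <| dist_sq_le_of_crosses hc (hP.four_le h.mem_p h.mem_y h.py)
    (hP.four_le h.mem_p h.mem_z h.pz) (hP.four_le h.mem_q h.mem_x h.qx)
    (hP.four_le h.mem_q h.mem_y h.qy) (hP.four_le h.mem_q h.mem_z h.qz)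
    (dist_sq_lt_of_lt_sqrt h.pq_lt).le
    (dist_sq_lt_of_lt_sqrt h.xy_lt).le (dist_sq_le_of_le_t0 h.xz_le) (dist_sq_le_of_le_t0 h.yz_le)

lemma EdgeFace.px_py_qx_qy (hP : IsPacking P) {p q x y z : E3} (h : EdgeFace P p q x y z)
    (hc : Crosses p q x y z) : dist p x ≤ 2 * t0 ∧ dist p y ≤ 2 * t0 ∧ dist q x ≤ 2 * t0 ∧
      dist q y ≤ 2 * t0 :=
  ⟨h.dist_px_le hP hc, h.swap_face.dist_px_le hP hc.swap_face,
    h.swap_edge.dist_px_le hP hc.swap_edge,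
    h.swap_edge.swap_face.dist_px_le hP hc.swap_edge.swap_face⟩

/-- One of the edges may have length exactly `√8`; such limits occur in the compactness argument for
the volumes of simplices. -/
lemma not_inter_segments_of_le (hP : IsPacking P) {p q x y : E3} (hp : p ∈ P) (hq : q ∈ P) (hx : x ∈ P)
    (hy : y ∈ P) (hpx : p ≠ x) (hpy : p ≠ y) (hqx : q ≠ x) (hqy : q ≠ y) (hpq : dist p q ^ 2 ≤ 8)
    (hxy : dist x y < √8) :
    ¬(convexHull ℝ ({p, q} : Set E3) ∩ convexHull ℝ ({x, y} : Set E3)).Nonempty := by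
  rintro ⟨u, h1, h2⟩
  obtain ⟨s, t, hs, ht, hst, rfl⟩ := mem_convexHull_pair.1 h1
  obtain ⟨a, b, ha, hb, hab, h⟩ := mem_convexHull_pair.1 h2
  exact not_cross_segments hs ht ha hb hst hab h.symm (hP.four_le hp hx hpx) (hP.four_le hp hy hpy)
    (hP.four_le hq hx hqx) (hP.four_le hq hy hqy) hpq
    (dist_sq_lt_of_lt_sqrt hxy)

lemma not_inter_segments (hP : IsPacking P) {p q x y : E3} (hp : p ∈ P) (hq : q ∈ P) (hx : x ∈ P)
    (hy : y ∈ P) (hpx : p ≠ x) (hpy : p ≠ y) (hqx : q ≠ x) (hqy : q ≠ y) (hpq : dist p q < √8)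
    (hxy : dist x y < √8) :
    ¬(convexHull ℝ ({p, q} : Set E3) ∩ convexHull ℝ ({x, y} : Set E3)).Nonempty :=
  not_inter_segments_of_le hP hp hq hx hy hpx hpy hqx hqy (dist_sq_lt_of_lt_sqrt hpq).le hxy

lemma not_inter_singleton (hP : IsPacking P) {p x y z : E3} (hp : p ∈ P) (hx : x ∈ P)
    (hy : y ∈ P) (hz : z ∈ P) (hpx : p ≠ x) (hpy : p ≠ y) (hpz : p ≠ z) (hxy : dist x y < √8)
    (hxz : dist x z ≤ 2 * t0) (hyz : dist y z ≤ 2 * t0) :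
    p ∉ convexHull ℝ ({x, y, z} : Set E3) := by
  classical
  have h1 := (dist_sq_lt_of_lt_sqrt hxy).le
  have h2 := (dist_sq_lt_of_lt_sqrt (lt_sqrt_eight_of_le hxz)).le
  have h3 := (dist_sq_lt_of_lt_sqrt (lt_sqrt_eight_of_le hyz)).le
  have := not_mem_convexHull (B := {x, y, z}) (v := p) (by
    simp only [Finset.mem_insert, Finset.mem_singleton, forall_eq_or_imp, forall_eq]
    exact ⟨hP.four_le hx hp hpx.symm, hP.four_le hy hp hpy.symm, hP.four_le hz hp hpz.symm⟩) (by
    simp only [Finset.mem_insert, Finset.mem_singleton, forall_eq_or_imp, forall_eq, dist_self]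
    rw [dist_comm y x, dist_comm z x, dist_comm z y]
    norm_num [h1, h2, h3])
  simpa using this

/-- If the diagonal `p q` crosses the triangle `x y z`, and `w` is an anchor of `p q`, then `x y`
crosses the triangle `p q w`. -/
lemma EdgeFace.crosses_of_anchor (hP : IsPacking P) {p q x y z w : E3} (h : EdgeFace P p q x y z)
    (hc : Crosses p q x y z) (hw : w ∈ P) (hwp : w ≠ p) (hwq : w ≠ q) (hwx : w ≠ x) (hwy : w ≠ y)
    (hwz : w ≠ z) (hp : dist w p ≤ 2 * t0) (hq : dist w q ≤ 2 * t0) : Crosses x y p q w := by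
  classical
  have hex := hull_inter_exchange (A := {p, q}) (B := {x, y, z}) (w := w)
    (by simp [h.px.symm, h.py.symm, h.pz.symm, h.qx.symm, h.qy.symm, h.qz.symm]) (by simp [hwp, hwq]) (by simp [hwx, hwy, hwz])
    (by rw [Finset.card_pair h.pq, Finset.card_eq_three.2 ⟨x, y, z, h.xy, h.xz, h.yz, rfl⟩])
    (by simpa using crosses_iff.1 hc)
    (by
      have e1 : ({p, q} : Finset E3).erase p = {q} := by
        ext; simp; grind [h.pq]
      have e2 : ({p, q} : Finset E3).erase q = {p} := by
        ext; simp; grind [h.pq]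
      simp only [Finset.mem_insert, Finset.mem_singleton, forall_eq_or_imp, forall_eq, e1, e2]
      have n1 := not_inter_singleton hP h.mem_q h.mem_x h.mem_y h.mem_z h.qx h.qy h.qz h.xy_lt
        h.xz_le h.yz_le
      have n2 := not_inter_singleton hP h.mem_p h.mem_x h.mem_y h.mem_z h.px h.py h.pz h.xy_lt
        h.xz_le h.yz_le
      simpa using ⟨n1, n2⟩)
    (by
      have e1 : ({x, y, z} : Finset E3).erase x = {y, z} := by
        ext; simp; grind [h.xy, h.xz]
      have e2 : ({x, y, z} : Finset E3).erase y = {x, z} := by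
        ext; simp; grind [h.xy, h.yz]
      have e3 : ({x, y, z} : Finset E3).erase z = {x, y} := by
        ext; simp; grind [h.xz, h.yz]
      simp only [Finset.mem_insert, Finset.mem_singleton, forall_eq_or_imp, forall_eq, e1, e2, e3]
      have n1 := not_inter_segments hP h.mem_p h.mem_q h.mem_y h.mem_z h.py h.pz h.qy h.qz h.pq_lt
        (lt_sqrt_eight_of_le h.yz_le)
      have n2 := not_inter_segments hP h.mem_p h.mem_q h.mem_x h.mem_z h.px h.pz h.qx h.qz h.pq_lt
        (lt_sqrt_eight_of_le h.xz_le)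
      have n3 := not_inter_segments hP h.mem_p h.mem_q h.mem_x h.mem_y h.px h.py h.qx h.qy h.pq_lt
        h.xy_lt
      rw [convexHull_pair, convexHull_pair] at n1 n2 n3
      simpa using ⟨n1, n2, n3⟩)
  have hpw := dist_comm w p ▸ hp
  have hqw := dist_comm w q ▸ hq
  -- In every outcome but the last an edge of length at most `2 * t0` crosses a triangle: `w q` or
  -- `w p` crosses `x y z`, or `y z` or `x z` crosses `p q w`.
  rcases hex with ⟨i, hi, hh⟩ | ⟨i, hi, hh⟩
  · exfalso
    rcases Finset.mem_insert.1 hi with rfl | hi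
    · have e1 : ({i, q} : Finset E3).erase i = {q} := by
        ext; simp; grind [h.pq]
      refine EdgeFace.not_crosses hP (p := w) (q := q) { h with
        mem_p := hw, pq := hwq, px := hwx, py := hwy, pz := hwz,
        pq_lt := lt_sqrt_eight_of_le hq } hq (crosses_iff.2 ?_)
      simpa [e1] using hh
    · obtain rfl := Finset.mem_singleton.1 hi
      have e1 : ({p, i} : Finset E3).erase i = {p} := by
        ext; simp; grind [h.pq]
      refine EdgeFace.not_crosses hP (p := w) (q := p) { h.swap_edge with
        mem_p := hw, pq := hwp, px := hwx, py := hwy, pz := hwz,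
        pq_lt := lt_sqrt_eight_of_le hp } hp (crosses_iff.2 ?_)
      simpa [e1] using hh
  · have hset : ({w, p, q} : Set E3) = {p, q, w} := by ext; simp; tauto
    simp only [Finset.mem_insert, Finset.mem_singleton] at hi
    rw [crosses_iff]
    rcases hi with rfl | rfl | rfl
    · exfalso
      have e1 : ({i, y, z} : Finset E3).erase i = {y, z} := by
        ext; simp; grind [h.xy, h.xz]
      refine EdgeFace.not_crosses hP (p := y) (q := z) (x := p) (y := q) (z := w)
        ⟨h.mem_y, h.mem_z, h.mem_p, h.mem_q, hw, h.yz, h.py.symm, h.qy.symm, hwy.symm, h.pz.symm,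
          h.qz.symm, hwz.symm, h.pq, hwp.symm, hwq.symm, h.pq_lt, hpw, hqw,
          lt_sqrt_eight_of_le h.yz_le⟩ h.yz_le (crosses_iff.2 ?_)
      rw [Set.inter_comm, ← hset]
      simpa [e1] using hh
    · exfalso
      have e1 : ({x, i, z} : Finset E3).erase i = {x, z} := by
        ext; simp; grind [h.xy, h.yz]
      refine EdgeFace.not_crosses hP (p := x) (q := z) (x := p) (y := q) (z := w)
        ⟨h.mem_x, h.mem_z, h.mem_p, h.mem_q, hw, h.xz, h.px.symm, h.qx.symm, hwx.symm, h.pz.symm,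
          h.qz.symm, hwz.symm, h.pq, hwp.symm, hwq.symm, h.pq_lt, hpw, hqw,
          lt_sqrt_eight_of_le h.xz_le⟩ h.xz_le (crosses_iff.2 ?_)
      rw [Set.inter_comm, ← hset]
      simpa [e1] using hh
    · have e1 : ({x, y, i} : Finset E3).erase i = {x, y} := by
        ext; simp; grind [h.xz, h.yz]
      rw [Set.inter_comm, ← hset]
      simpa [e1] using hh

end Kepler

/-! ### Overlapping simplices: a diagonal pierces a face -/

namespace Kepler

variable {P : Set E3}

/-- The point can be pushed slightly away from the centroid of `S` without leaving the hull; mixing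
the weights found there with the uniform ones of the centroid makes all of them positive. -/
lemma exists_pos_weights {S : Finset E3} {z : E3} (hz : z ∈ interior (convexHull ℝ (S : Set E3))) :
    ∃ w : E3 → ℝ, (∀ i ∈ S, 0 < w i) ∧ ∑ i ∈ S, w i = 1 ∧ ∑ i ∈ S, w i • i = z := by
  have hS : S.Nonempty := by
    by_contra h
    rw [Finset.not_nonempty_iff_eq_empty.1 h] at hz
    simp at hz
  have hn : (0 : ℝ) < S.card := by exact_mod_cast hS.card_pos
  set c : E3 := ∑ i ∈ S, (S.card : ℝ)⁻¹ • i with hc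
  have hev : ∀ᶠ e in nhdsWithin (0 : ℝ) (Set.Ioi 0), z + e • (z - c) ∈ convexHull ℝ (S : Set E3) := by
    have hcont : Filter.Tendsto (fun e : ℝ => z + e • (z - c)) (nhds 0) (nhds z) := by
      have : Continuous fun e : ℝ => z + e • (z - c) := by fun_prop
      simpa using this.tendsto 0
    exact (hcont.mono_left nhdsWithin_le_nhds).eventually (mem_interior_iff_mem_nhds.1 hz)
  obtain ⟨e, he, he0⟩ := (hev.and self_mem_nhdsWithin).exists
  have he0 : 0 < e := he0
  obtain ⟨w, h0, h1, h2⟩ := Finset.mem_convexHull'.1 he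
  refine ⟨fun i => (1 + e)⁻¹ * (w i + e * (S.card : ℝ)⁻¹), fun i hi => ?_, ?_, ?_⟩
  · have := h0 i hi
    positivity
  · rw [← Finset.mul_sum, Finset.sum_add_distrib, h1, Finset.sum_const, nsmul_eq_mul]
    field_simp
  · have : ∑ i ∈ S, ((1 + e)⁻¹ * (w i + e * (S.card : ℝ)⁻¹)) • i = (1 + e)⁻¹ • ((∑ i ∈ S, w i • i) + e • c) := by
      rw [hc, Finset.smul_sum, ← Finset.sum_add_distrib, Finset.smul_sum]
      refine Finset.sum_congr rfl fun i _ => ?_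
      rw [mul_smul, add_smul, mul_smul]
    rw [this, h2, show z + e • (z - c) + e • c = (1 + e) • z by module, smul_smul,
      inv_mul_cancel₀ (by positivity), one_smul]

/-- The difference of two positive convex representations of a common interior point is a dependency
that can be positive only on `S` and negative only on `S'`. It is nonzero at a vertex of `S` outside
`S'`, and `exists_small_hull_inter` reduces it to five points. -/
lemma Overlap.exists_hull_inter {S S' : Finset E3} (h : Overlap S S') (hcard : S.card = S'.card)
    (hne : S ≠ S') : ∃ A B : Finset E3, A ⊆ S ∧ B ⊆ S' ∧ Disjoint A B ∧ A.card + B.card ≤ 5 ∧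
      (convexHull ℝ (A : Set E3) ∩ convexHull ℝ (B : Set E3)).Nonempty := by
  classical
  obtain ⟨z, hz1, hz2⟩ := h
  obtain ⟨a, a0, a1, a2⟩ := exists_pos_weights hz1
  obtain ⟨b, b0, b1, b2⟩ := exists_pos_weights hz2
  set m : E3 → ℝ := fun i => (if i ∈ S then a i else 0) - (if i ∈ S' then b i else 0) with hm
  set A := S.filter fun i => 0 < m i with hA
  set B := S'.filter fun i => m i < 0 with hB
  have hAB : Disjoint A B := by
    rw [Finset.disjoint_left]
    intro i hi hi'
    have h1 := (Finset.mem_filter.1 hi).2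
    have h2 := (Finset.mem_filter.1 hi').2
    linarith
  have hsub : A ∪ B ⊆ S ∪ S' :=
    Finset.union_subset_union (Finset.filter_subset _ _) (Finset.filter_subset _ _)
  have hzero : ∀ i ∈ S ∪ S', i ∉ A ∪ B → m i = 0 := by
    intro i hi hi'
    simp only [hA, hB, Finset.mem_union, Finset.mem_filter, not_or, not_and, not_lt] at hi hi'
    by_cases h1 : i ∈ S <;> by_cases h2 : i ∈ S'
    · exact le_antisymm (hi'.1 h1) (hi'.2 h2)
    · have := hi'.1 h1
      simp only [hm, h1, h2, if_true, if_false] at this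
      linarith [a0 i h1]
    · have := hi'.2 h2
      simp only [hm, h1, h2, if_true, if_false] at this
      linarith [b0 i h2]
    · tauto
  have hi1 : (S ∪ S').filter (· ∈ S) = S := by ext; simp
  have hi2 : (S ∪ S').filter (· ∈ S') = S' := by ext; simp
  have s1 : ∑ i ∈ A ∪ B, m i = 0 := by
    rw [Finset.sum_subset hsub hzero]
    simp only [hm, Finset.sum_sub_distrib, ← Finset.sum_filter, hi1, hi2, a1, b1, sub_self]
  have s2 : ∑ i ∈ A ∪ B, m i • i = 0 := by
    rw [Finset.sum_subset hsub fun i hi hi' => by rw [hzero i hi hi', zero_smul]]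
    simp only [hm, sub_smul, ite_smul, zero_smul, Finset.sum_sub_distrib, ← Finset.sum_filter, hi1,
      hi2, a2, b2, sub_self]
  obtain ⟨i, hi, hi'⟩ : ∃ i ∈ S, i ∉ S' := by
    by_contra! hc
    exact hne (Finset.eq_of_subset_of_card_le hc hcard.ge)
  have hi0 : 0 < m i := by simpa [hm, hi, hi'] using a0 i hi
  have hh := hull_inter_of_dependency hAB s1 s2 (fun i hi => (Finset.mem_filter.1 hi).2.le)
    (fun i hi => (Finset.mem_filter.1 hi).2.le)
    ⟨i, Finset.mem_union_left _ (Finset.mem_filter.2 ⟨hi, hi0⟩), hi0.ne'⟩ (subset_refl A)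
    (subset_refl B) (fun j hj hj' => absurd hj hj') (fun j hj hj' => absurd hj hj')
  obtain ⟨A', B', hA', hB', h5, h6⟩ := exists_small_hull_inter _ le_rfl hAB hh
  exact ⟨A', B', hA'.trans (Finset.filter_subset _ _), hB'.trans (Finset.filter_subset _ _),
    Finset.disjoint_of_subset_left hA' (Finset.disjoint_of_subset_right hB' hAB), h5, h6⟩

lemma IsStrictQuarter.swap {p q : E3} {S : Finset E3} (h : IsStrictQuarter p q S) :
    IsStrictQuarter q p S :=
  ⟨h.1, h.2.2.1, h.2.1, by simpa only [IsStrictDiagonal, dist_comm] using h.2.2.2.1,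
    fun v hv w hw hvw h1 h2 => h.2.2.2.2 v hv w hw hvw h2 h1⟩

lemma IsCandidate.card {S : Finset E3} (h : IsCandidate P S) : S.card = 4 := by
  rcases h.2 with h | ⟨p, q, h⟩
  · exact h.1
  · exact h.1

lemma IsCandidate.short_or_quarter {S : Finset E3} (h : IsCandidate P S) {v w : E3} (hv : v ∈ S)
    (hw : w ∈ S) (hvw : v ≠ w) : dist v w ≤ 2 * t0 ∨ IsStrictQuarter v w S := by
  rcases h.2 with h | ⟨p, q, h⟩
  · exact Or.inl (h.2 v hv w hw hvw).2
  · by_cases h1 : v = p ∧ w = q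
    · rw [h1.1, h1.2]; exact Or.inr h
    by_cases h2 : v = q ∧ w = p
    · rw [h2.1, h2.2]; exact Or.inr h.swap
    exact Or.inl (h.2.2.2.2 v hv w hw hvw h1 h2).2

lemma IsCandidate.dist_lt {S : Finset E3} (h : IsCandidate P S) {v w : E3} (hv : v ∈ S)
    (hw : w ∈ S) : dist v w < √8 := by
  by_cases hvw : v = w
  · rw [hvw, dist_self]; positivity
  rcases h.short_or_quarter hv hw hvw with h | h
  · exact lt_sqrt_eight_of_le h
  · exact h.2.2.2.1.2

lemma IsStrictQuarter.eq_or_eq {p q v w : E3} {S : Finset E3} (h : IsStrictQuarter p q S)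
    (hv : v ∈ S) (hw : w ∈ S) (hvw : 2 * t0 < dist v w) : (v = p ∧ w = q) ∨ (v = q ∧ w = p) := by
  by_contra! hc
  have hne : v ≠ w := by
    rintro rfl
    rw [dist_self] at hvw
    norm_num [t0] at hvw
  have := (h.2.2.2.2 v hv w hw hne (fun h => hc.1 h.1 h.2) (fun h => hc.2 h.1 h.2)).2
  linarith

lemma IsStrictQuarter.ne {p q : E3} {S : Finset E3} (h : IsStrictQuarter p q S) : p ≠ q := by
  rintro rfl
  have := h.2.2.2.1.1
  rw [dist_self] at this
  norm_num [t0] at this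

lemma IsStrictQuarter.short {p q x y : E3} {S : Finset E3} (h : IsStrictQuarter p q S)
    (hx : x ∈ S) (hy : y ∈ S) (hyp : y ≠ p) (hyq : y ≠ q) : dist x y ≤ 2 * t0 := by
  by_contra! hc
  rcases h.eq_or_eq hx hy hc with h | h
  · exact hyq h.2
  · exact hyp h.2

/-- The diagonal of the quarter `S` crosses a face of the simplex `S'`. -/
def Pierces (P : Set E3) (S S' : Finset E3) : Prop :=
  ∃ p q x y z : E3, IsStrictQuarter p q S ∧ x ∈ S' ∧ y ∈ S' ∧ z ∈ S' ∧ EdgeFace P p q x y z ∧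
    Crosses p q x y z ∧ (dist x y ≤ 2 * t0 ∨ IsStrictQuarter x y S')

/-- A candidate has at most one long edge, so the face can be labelled with `x y` as its only
possibly long edge. Short edges do not cross such a face, hence `A` is the diagonal of a quarter. -/
lemma pierces_of_inter {S S' : Finset E3} (hP : IsPacking P)
    (hS : IsCandidate P S) (hS' : IsCandidate P S') {A B : Finset E3} (hA : A ⊆ S) (hB : B ⊆ S')
    (hAB : Disjoint A B) (hA2 : A.card = 2) (hB3 : B.card = 3)
    (h : (convexHull ℝ (A : Set E3) ∩ convexHull ℝ (B : Set E3)).Nonempty) : Pierces P S S' := by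
  classical
  obtain ⟨p, q, hpq, rfl⟩ := Finset.card_eq_two.1 hA2
  have hface : ∃ x y z, B = {x, y, z} ∧ x ≠ y ∧ x ≠ z ∧ y ≠ z ∧ dist x z ≤ 2 * t0 ∧
      dist y z ≤ 2 * t0 ∧ (dist x y ≤ 2 * t0 ∨ IsStrictQuarter x y S') := by
    obtain ⟨x, y, z, hxy, hxz, hyz, rfl⟩ := Finset.card_eq_three.1 hB3
    have hx : x ∈ S' := hB (by simp)
    have hy : y ∈ S' := hB (by simp)
    have hz : z ∈ S' := hB (by simp)
    rcases hS'.short_or_quarter hx hz hxz with h1 | h1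
    · rcases hS'.short_or_quarter hy hz hyz with h2 | h2
      · exact ⟨x, y, z, rfl, hxy, hxz, hyz, h1, h2, hS'.short_or_quarter hx hy hxy⟩
      · refine ⟨y, z, x, by ext; simp; tauto, hyz, hxy.symm, hxz.symm, h2.short hy hx hxy hxz,
          h2.short hz hx hxy hxz, Or.inr h2⟩
    · exact ⟨x, z, y, by ext; simp; tauto, hxz, hxy, hyz.symm, h1.short hx hy hxy.symm hyz,
        h1.short hz hy hxy.symm hyz, Or.inr h1⟩
  obtain ⟨x, y, z, rfl, hxy, hxz, hyz, h1, h2, h3⟩ := hface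
  have hp : p ∈ S := hA (by simp)
  have hq : q ∈ S := hA (by simp)
  have hx : x ∈ S' := hB (by simp)
  have hy : y ∈ S' := hB (by simp)
  have hz : z ∈ S' := hB (by simp)
  simp only [Finset.disjoint_insert_left, Finset.disjoint_singleton_left, Finset.mem_insert,
    Finset.mem_singleton, not_or] at hAB
  have hE : EdgeFace P p q x y z := ⟨hS.1 hp, hS.1 hq, hS'.1 hx, hS'.1 hy, hS'.1 hz, hpq, hAB.1.1,
    hAB.1.2.1, hAB.1.2.2, hAB.2.1, hAB.2.2.1, hAB.2.2.2, hxy, hxz, hyz, hS'.dist_lt hx hy, h1, h2,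
    hS.dist_lt hp hq⟩
  have hc : Crosses p q x y z := by rw [crosses_iff]; simpa using h
  rcases hS.short_or_quarter hp hq hpq with h4 | h4
  · exact absurd hc (hE.not_crosses hP h4)
  · exact ⟨p, q, x, y, z, h4, hx, hy, hz, hE, hc, h3⟩

lemma card_ne_one_of_inter {S S' : Finset E3} (hP : IsPacking P)
    (hS : (S : Set E3) ⊆ P) (hS' : IsCandidate P S') {A B : Finset E3} (hA : A ⊆ S) (hB : B ⊆ S')
    (hAB : Disjoint A B)
    (h : (convexHull ℝ (A : Set E3) ∩ convexHull ℝ (B : Set E3)).Nonempty) : A.card ≠ 1 := by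
  intro hA1
  obtain ⟨p, rfl⟩ := Finset.card_eq_one.1 hA1
  obtain ⟨u, hu, hu'⟩ := h
  rw [Finset.coe_singleton, convexHull_singleton, Set.mem_singleton_iff] at hu
  subst hu
  rw [Finset.disjoint_singleton_left] at hAB
  refine not_mem_convexHull (fun i hi => hP.four_le (hS'.1 (hB hi)) (hS (hA (by simp))) ?_)
    (fun i hi j hj => (dist_sq_lt_of_lt_sqrt (hS'.dist_lt (hB hi) (hB hj))).le) hu'
  rintro rfl
  exact hAB hi

/-- If two candidates overlap, then the diagonal of one of them crosses a face of the other. -/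
lemma pierces_of_overlap {S S' : Finset E3} (hP : IsPacking P) (hS : IsCandidate P S)
    (hS' : IsCandidate P S') (hne : S ≠ S') (h : Overlap S S') : Pierces P S S' ∨ Pierces P S' S := by
  obtain ⟨A, B, hA, hB, hAB, h5, hh⟩ := h.exists_hull_inter (hS.card.trans hS'.card.symm) hne
  have hh' := Set.inter_comm _ _ ▸ hh
  have a1 := card_ne_one_of_inter hP hS.1 hS' hA hB hAB hh
  have b1 := card_ne_one_of_inter hP hS'.1 hS hB hA hAB.symm hh'
  have a0 : A.card ≠ 0 := fun h0 => by
    rw [Finset.card_eq_zero.1 h0] at hh; simp at hh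
  have b0 : B.card ≠ 0 := fun h0 => by
    rw [Finset.card_eq_zero.1 h0] at hh; simp at hh
  have : (A.card = 2 ∧ B.card = 2) ∨ (A.card = 2 ∧ B.card = 3) ∨ (A.card = 3 ∧ B.card = 2) := by
    omega
  rcases this with ⟨h1, h2⟩ | ⟨h1, h2⟩ | ⟨h1, h2⟩
  · exfalso
    obtain ⟨p, q, hpq, rfl⟩ := Finset.card_eq_two.1 h1
    obtain ⟨x, y, hxy, rfl⟩ := Finset.card_eq_two.1 h2
    simp only [Finset.disjoint_insert_left, Finset.disjoint_singleton_left, Finset.mem_insert,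
      Finset.mem_singleton, not_or] at hAB
    refine not_inter_segments hP (hS.1 (hA (by simp))) (hS.1 (hA (by simp)))
      (hS'.1 (hB (by simp))) (hS'.1 (hB (by simp))) hAB.1.1 hAB.1.2 hAB.2.1 hAB.2.2
      (hS.dist_lt (hA (by simp)) (hA (by simp))) (hS'.dist_lt (hB (by simp)) (hB (by simp)))
      (by simpa using hh)
  · exact Or.inl (pierces_of_inter hP hS hS' hA hB hAB h1 h2 hh)
  · exact Or.inr (pierces_of_inter hP hS' hS hB hA hAB.symm h2 h1 hh')

/-- Quarters along the same diagonal do not overlap. -/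
lemma not_overlap_of_same_diagonal {p q : E3} {S S' : Finset E3} (hP : IsPacking P)
    (hSP : (S : Set E3) ⊆ P) (hSP' : (S' : Set E3) ⊆ P) (hS : IsStrictQuarter p q S)
    (hS' : IsStrictQuarter p q S') (hne : S ≠ S') : ¬Overlap S S' := by
  intro h
  -- The piercing edge is the common diagonal, so `S'` would contain its two ends and the three
  -- further vertices of the pierced face: five points.
  have key : ∀ {S S' : Finset E3}, (S' : Set E3) ⊆ P → IsStrictQuarter p q S →
      IsStrictQuarter p q S' → ¬Pierces P S S' := by
    rintro S S' hSP' hS hS' ⟨v, w, x, y, z, hvw, hx, hy, hz, hE, -, -⟩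
    have hset : ({v, w, x, y, z} : Finset E3).card = 5 := by
      rw [Finset.card_insert_of_notMem, Finset.card_insert_of_notMem, Finset.card_insert_of_notMem,
        Finset.card_insert_of_notMem, Finset.card_singleton] <;>
      simp [hE.pq, hE.px, hE.py, hE.pz, hE.qx, hE.qy, hE.qz, hE.xy, hE.xz, hE.yz]
    have hsub : ({v, w, x, y, z} : Finset E3) ⊆ S' := by
      have hv : v ∈ S' ∧ w ∈ S' := by
        rcases hS.eq_or_eq hvw.2.1 hvw.2.2.1 hvw.2.2.2.1.1 with h | h
        · rw [h.1, h.2]; exact ⟨hS'.2.1, hS'.2.2.1⟩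
        · rw [h.1, h.2]; exact ⟨hS'.2.2.1, hS'.2.1⟩
      intro u
      simp only [Finset.mem_insert, Finset.mem_singleton]
      rintro (rfl | rfl | rfl | rfl | rfl)
      exacts [hv.1, hv.2, hx, hy, hz]
    have := Finset.card_le_card hsub
    rw [hset, hS'.1] at this
    omega
  rcases pierces_of_overlap hP ⟨hSP, Or.inr ⟨p, q, hS⟩⟩ ⟨hSP', Or.inr ⟨p, q, hS'⟩⟩ hne h with h | h
  · exact key hSP' hS hS' h
  · exact key hSP hS' hS h

end Kepler

/-! ### At most one anchor behind a crossing diagonal -/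

namespace Kepler

/-- The numerical end of `anchor_offset_core`, where the left side bounds `2 * a * (u₁ + Z)` from
above, and `1.697 = 2 * 0.8485`. The deviations of `r` below and `a` above `√2` are bounded by
multiples of `k ^ 2`, and `Z₁` by a multiple of `k`, up to small errors; the term `-2.14 * k` pays
for them. -/
lemma anchor_offset_estimate {r a b k Z Z₁ D : ℝ} (hr0 : 1.254 ≤ r)
    (hk : 0 ≤ k) (hk1 : k ≤ 1.104) (hZ : 0 ≤ Z) (hZ₁ : 0 ≤ Z₁) (hZ' : Z ≤ 0.4583)
    (hZ₁' : Z₁ ≤ 0.4583) (ha0 : 0 ≤ a) (hb0 : 0 < b) (hab : a + b ≤ 2.8285)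
    (hD : D = 4 - r ^ 2 - k ^ 2) (hr2 : r ^ 2 ≤ 2)
    (hDa : D + Z₁ * (2 * r - Z₁) ≤ a ^ 2) (hDb : D ≤ b ^ 2) :
    a ^ 2 - 1.6999 + D - 2.14 * k + Z₁ ^ 2 + 2 * Z * (a - r + Z₁) ≤ 1.697 * a := by
  have hk2 : 0 ≤ k ^ 2 := sq_nonneg k
  have hkk : k ^ 2 ≤ 1.104 * k := by
    have := mul_le_mul_of_nonneg_left hk1 hk
    linarith
  have hkk' : k ^ 2 ≤ 1.2189 := by
    have : k ^ 2 ≤ 1.104 ^ 2 := by gcongr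
    linarith
  have hDk : 2 - k ^ 2 ≤ D := by linarith
  have hb88 : 0.883 ≤ b := by
    by_contra! h
    have := mul_self_lt_mul_self hb0.le h
    linarith
  have hZr : 0 ≤ Z₁ * (2 * r - Z₁) := mul_nonneg hZ₁ (by linarith)
  have hD2 : D ≤ 2.0003 := by
    by_contra! h3
    have : 1.41425 < b := by
      by_contra! h4
      have := mul_self_le_mul_self hb0.le h4
      linarith
    have h5 : a < 1.41425 := by linarith
    have := mul_self_lt_mul_self ha0 h5
    linarith
  have hrk : 1.4142 - r ≤ 0.375 * k ^ 2 + 0.0002 := by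
    by_contra! h
    have h1 : (1.4142 - r) * 2.668 ≤ (1.4142 - r) * (1.4142 + r) :=
      mul_le_mul_of_nonneg_left (by linarith) (by linarith)
    linarith
  have hak : a ≤ 1.4143 + 0.4354 * k ^ 2 := by
    by_contra! h
    have h1 : (1.4142 - b) * 2.297 ≤ (1.4142 - b) * (1.4142 + b) :=
      mul_le_mul_of_nonneg_left (by linarith) (by linarith)
    linarith
  have hZk : Z₁ ≤ 0.75 * k + 0.0002 := by
    rcases le_total k 0.62 with h | h
    · have h1 := mul_le_mul_of_nonneg_left (show (2.04 : ℝ) ≤ 2 * r - Z₁ by linarith) hZ₁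
      have h2 := mul_self_le_mul_self ha0 hak
      have h3 : k ^ 2 * k ^ 2 ≤ k ^ 2 * 1.2189 := mul_le_mul_of_nonneg_left hkk' hk2
      have h4 : k ^ 2 ≤ 0.62 * k := by
        have := mul_le_mul_of_nonneg_left h hk
        linarith
      linarith
    · linarith
  have hZar : ∀ c, a - r ≤ c → 2 * Z * (a - r) ≤ 0.9166 * max c 0 := fun c hc => by
    have h1 : 2 * Z * (a - r) ≤ 2 * Z * max c 0 :=
      mul_le_mul_of_nonneg_left (hc.trans (le_max_left _ _)) (by linarith)
    have h2 : 2 * Z * max c 0 ≤ 0.9166 * max c 0 :=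
      mul_le_mul_of_nonneg_right (by linarith) (le_max_right _ _)
    linarith
  have hZZ : 2 * Z * Z₁ ≤ 0.9166 * Z₁ := mul_le_mul_of_nonneg_right (by linarith) hZ₁
  have hZ₁Z₁ : Z₁ ^ 2 ≤ 0.4583 * Z₁ := by
    have := mul_le_mul_of_nonneg_right hZ₁' hZ₁
    linarith
  rcases le_total a 1.4142 with h | h
  · have h1 := hZar (0.375 * k ^ 2 + 0.0002) (by linarith)
    rw [max_eq_left (by linarith)] at h1
    have h2 : 0 ≤ Z₁ * (2 * r - 2 * Z₁ - 2 * Z) := mul_nonneg hZ₁ (by linarith)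
    have h3 : 0 ≤ a * (1.4142 - a) := mul_nonneg ha0 (by linarith)
    linarith
  · have h1 := hZar (0.8104 * k ^ 2 + 0.0003) (by linarith)
    rw [max_eq_left (by linarith)] at h1
    have h2 : b ^ 2 ≤ (2.8285 - a) ^ 2 := by
      have : b ≤ 2.8285 - a := by linarith
      gcongr
    have h3 : 0 ≤ (a - 1.4142) * (1.9455 - a) := mul_nonneg (by linarith) (by linarith)
    linarith

/-- Here `w = (u₁, u₂, ±Z)`, and the crossing diagonal joins `(a, k, ±Z₁)` to `(-b, k, ±Z₂)`. Its
first end lies on the side of `w` and at distance at least two from it; comparing this with the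
upper bound for the distance of `w` from the ends `(0, 0, ±r)` bounds `2 * a * (u₁ + Z)`. -/
lemma anchor_offset_core {r a b k u₁ u₂ Z Z₁ Z₂ t β : ℝ} (hr : 0 < r) (hr1 : 1.575 ≤ r ^ 2)
    (hr2 : r ^ 2 ≤ 2) (hZ : 0 ≤ Z) (hZ₁ : 0 ≤ Z₁) (hZ₂ : 0 ≤ Z₂) (hZ' : Z ≤ 0.4583)
    (hZ₁' : Z₁ ≤ 0.4583) (hZ₂' : Z₂ ≤ 0.4583)
    (hU : u₁ ^ 2 + u₂ ^ 2 + Z ^ 2 + 2 * r * Z + r ^ 2 ≤ 6.3001)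
    (hA : 4 ≤ a ^ 2 + k ^ 2 + Z₁ ^ 2 - 2 * r * Z₁ + r ^ 2)
    (hB : 4 ≤ b ^ 2 + k ^ 2 + Z₂ ^ 2 - 2 * r * Z₂ + r ^ 2)
    (hab : (a + b) ^ 2 ≤ 8) (hab0 : 0 ≤ a + b)
    (hWA : 4 ≤ (u₁ - a) ^ 2 + (u₂ - k) ^ 2 + (Z + Z₁) ^ 2)
    (hWB : 4 ≤ (u₁ + b) ^ 2 + (u₂ - k) ^ 2 + (Z + Z₂) ^ 2)
    (hk : 0 ≤ k) (ht : 0 < t) (ht1 : t ≤ 1) (hβ : 0 ≤ β) (hβ1 : β ≤ 1)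
    (h1 : t * u₁ = β * a - (1 - β) * b) (h2 : t * u₂ = k) (hu₁ : 0 ≤ u₁) : u₁ + Z ≤ 0.8485 := by
  have hr0 : 1.254 ≤ r := by
    by_contra! h
    have := mul_self_lt_mul_self hr.le h
    linarith
  have hu₂0 : 0 ≤ u₂ := by
    by_contra! h
    have := mul_neg_of_pos_of_neg ht h
    linarith
  have hu₂ : k ≤ u₂ := by
    have := mul_le_mul_of_nonneg_right ht1 hu₂0
    linarith
  have hkk : k * k ≤ k * u₂ := mul_le_mul_of_nonneg_left hu₂ hk
  have p1 : 0 ≤ (Z + Z₁) * (r - Z₁) := mul_nonneg (by linarith) (by linarith)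
  have p2 : 0 ≤ (Z + Z₂) * (r - Z₂) := mul_nonneg (by linarith) (by linarith)
  have p3 : 0 ≤ r * Z := mul_nonneg hr.le hZ
  have ha0 : 0 ≤ a := by
    by_contra! h
    have hb : 0 < b := by linarith
    have e1 := mul_nonneg hβ (neg_nonneg.2 h.le)
    have e2 := mul_nonneg (sub_nonneg.2 hβ1) hb.le
    have e3 := mul_nonneg ht.le hu₁
    have e4 : β * a = 0 := by linarith
    have e5 : (1 - β) * b = 0 := by linarith
    rcases mul_eq_zero.1 e4 with h | h
    · rw [h] at e5; linarith
    · linarith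
  have hau : u₁ < a := by
    by_contra! h
    have : a * a ≤ a * u₁ := mul_le_mul_of_nonneg_left h ha0
    linarith
  have hb0 : 0 < b := by
    by_contra! h
    have h3 : -b ≤ t * u₁ := by
      rw [h1]
      have := mul_nonneg hβ hab0
      linarith
    have h4 : -b ≤ u₁ := by
      have := mul_le_mul_of_nonneg_right ht1 hu₁
      linarith
    have : (-b) * (-b) ≤ (-b) * u₁ := mul_le_mul_of_nonneg_left h4 (by linarith)
    linarith
  have hab' : a + b ≤ 2.8285 := by
    by_contra! h
    have := mul_self_lt_mul_self (by norm_num) h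
    linarith
  -- With a smaller gap the first coordinate of `w` would differ by at least `1.4143` from those of
  -- both ends, and the ends would be more than `√8` apart.
  have hgap : 1.07 ≤ u₂ - k := by
    by_contra! h
    have e0 : (u₂ - k) ^ 2 < 1.07 ^ 2 := by
      have : 0 ≤ u₂ - k := by linarith
      gcongr
    have e1 : (Z + Z₁) ^ 2 ≤ 0.9166 ^ 2 := by gcongr; linarith
    have e2 : (Z + Z₂) ^ 2 ≤ 0.9166 ^ 2 := by gcongr; linarith
    have e5 : 1.4143 ≤ a - u₁ := by
      by_contra! h
      have := mul_self_lt_mul_self (by linarith) h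
      linarith
    have e6 : 1.4143 ≤ u₁ + b := by
      by_contra! h
      have := mul_self_lt_mul_self (by linarith) h
      linarith
    linarith
  have hu₂' : u₂ ≤ 2.174 := by
    by_contra! h
    have := mul_self_lt_mul_self (by norm_num) h
    have := sq_nonneg u₁
    have := sq_nonneg Z
    linarith
  by_contra! hcon
  have e1 : a * 0.8485 ≤ a * (u₁ + Z) := mul_le_mul_of_nonneg_left hcon.le ha0
  have e2 : k * 1.07 ≤ k * (u₂ - k) := mul_le_mul_of_nonneg_left hgap hk
  have ha1 : 0 < a := by linarith
  have e3 : a * 0.8485 < a * (u₁ + Z) := mul_lt_mul_of_pos_left hcon ha1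
  have := anchor_offset_estimate hr0 hk (by linarith) hZ hZ₁ hZ' hZ₁' ha0 hb0 hab' rfl hr2
    (by linarith) (by linarith [mul_nonneg hZ₂ (show 0 ≤ 2 * r - Z₂ by linarith)])
  linarith

/-- Coordinates in which the diagonal is `(0, 0, ±r)`: the distance of an anchor from the axis that
is orthogonal to both diagonals. -/
lemma anchor_offset {r a b k z₁ z₂ u₁ u₂ z t β : ℝ} (hr : 0 < r) (hr1 : 1.575 ≤ r ^ 2)
    (hr2 : r ^ 2 ≤ 2)
    (ha : 4 ≤ a ^ 2 + k ^ 2 + (z₁ - r) ^ 2 ∧ 4 ≤ a ^ 2 + k ^ 2 + (z₁ + r) ^ 2)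
    (hb : 4 ≤ b ^ 2 + k ^ 2 + (z₂ - r) ^ 2 ∧ 4 ≤ b ^ 2 + k ^ 2 + (z₂ + r) ^ 2)
    (ha' : a ^ 2 + k ^ 2 + (z₁ - r) ^ 2 ≤ 6.3001 ∧ a ^ 2 + k ^ 2 + (z₁ + r) ^ 2 ≤ 6.3001)
    (hb' : b ^ 2 + k ^ 2 + (z₂ - r) ^ 2 ≤ 6.3001 ∧ b ^ 2 + k ^ 2 + (z₂ + r) ^ 2 ≤ 6.3001)
    (hu : 4 ≤ u₁ ^ 2 + u₂ ^ 2 + (z - r) ^ 2 ∧ 4 ≤ u₁ ^ 2 + u₂ ^ 2 + (z + r) ^ 2)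
    (hu' : u₁ ^ 2 + u₂ ^ 2 + (z - r) ^ 2 ≤ 6.3001 ∧ u₁ ^ 2 + u₂ ^ 2 + (z + r) ^ 2 ≤ 6.3001)
    (hab : (a + b) ^ 2 ≤ 8) (hab0 : 0 ≤ a + b)
    (hWA : 4 ≤ (u₁ - a) ^ 2 + (u₂ - k) ^ 2 + (z - z₁) ^ 2)
    (hWB : 4 ≤ (u₁ + b) ^ 2 + (u₂ - k) ^ 2 + (z - z₂) ^ 2)
    (hk : 0 ≤ k) (ht : 0 < t) (ht1 : t ≤ 1) (hβ : 0 ≤ β) (hβ1 : β ≤ 1)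
    (h1 : t * u₁ = β * a - (1 - β) * b) (h2 : t * u₂ = k) :
    u₁ ^ 2 + z ^ 2 ≤ 0.72 ∧ 1.13 ≤ u₂ ∧ u₂ ≤ 2.174 := by
  have hr0 : 1.2549 ≤ r := by
    by_contra! h
    have := mul_self_lt_mul_self hr.le h
    linarith
  -- Subtracting the squared distances from the two ends of the diagonal gives `4 * r * |d| ≤
  -- 2.3001`, and `r` is at least `1.2549`.
  have habs : ∀ {c d : ℝ}, 4 ≤ c + (d - r) ^ 2 ∧ 4 ≤ c + (d + r) ^ 2 →
      c + (d - r) ^ 2 ≤ 6.3001 ∧ c + (d + r) ^ 2 ≤ 6.3001 → |d| ≤ 0.4583 := by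
    rintro c d ⟨h1, h2⟩ ⟨h3, h4⟩
    rw [abs_le]
    constructor
    · by_contra! h
      have := mul_lt_mul_of_pos_left h hr
      linarith
    · by_contra! h
      have := mul_lt_mul_of_pos_left h hr
      linarith
  have hsq : ∀ {c d : ℝ}, (4 ≤ c + (d - r) ^ 2 ∧ 4 ≤ c + (d + r) ^ 2) →
      4 ≤ c + |d| ^ 2 - 2 * r * |d| + r ^ 2 := by
    rintro c d ⟨h1, h2⟩
    rw [sq_abs]
    rcases abs_cases d with ⟨h, -⟩ | ⟨h, -⟩ <;> rw [h] <;> linarith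
  have hsq' : ∀ {c d : ℝ}, (c + (d - r) ^ 2 ≤ 6.3001 ∧ c + (d + r) ^ 2 ≤ 6.3001) →
      c + |d| ^ 2 + 2 * r * |d| + r ^ 2 ≤ 6.3001 := by
    rintro c d ⟨h1, h2⟩
    rw [sq_abs]
    rcases abs_cases d with ⟨h, -⟩ | ⟨h, -⟩ <;> rw [h] <;> linarith
  have hdiff : ∀ c d : ℝ, (c - d) ^ 2 ≤ (|c| + |d|) ^ 2 := fun c d => by
    rw [← sq_abs (c - d)]
    gcongr
    exact abs_sub c d
  -- Reflection in the first coordinate exchanges the ends of the crossing diagonal, so `u₁` may be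
  -- taken nonnegative. Note that `0.8485 ^ 2 < 0.72`.
  have hz : |u₁| + |z| ≤ 0.8485 := by
    rcases le_total 0 u₁ with h | h
    · rw [abs_of_nonneg h]
      exact anchor_offset_core hr hr1 hr2 (abs_nonneg z) (abs_nonneg z₁) (abs_nonneg z₂)
        (habs hu hu') (habs ha ha') (habs hb hb') (hsq' hu') (hsq ha) (hsq hb) hab hab0
        (by linarith [hdiff z z₁]) (by linarith [hdiff z z₂]) hk ht ht1 hβ hβ1 h1 h2 h
    · rw [abs_of_nonpos h]
      exact anchor_offset_core (a := b) (b := a) (u₁ := -u₁) (β := 1 - β) hr hr1 hr2 (abs_nonneg z)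
        (abs_nonneg z₂) (abs_nonneg z₁)
        (habs hu hu') (habs hb hb') (habs ha ha') (by rw [neg_sq]; exact hsq' hu') (hsq hb) (hsq ha)
        (by linarith) (by linarith)
        (by linarith [hdiff z z₂]) (by linarith [hdiff z z₁]) hk ht ht1 (by linarith) (by linarith)
        (by linarith) h2 (by linarith)
  have hρ : u₁ ^ 2 + z ^ 2 ≤ 0.72 := by
    have h3 := mul_nonneg (abs_nonneg u₁) (abs_nonneg z)
    have h4 : (|u₁| + |z|) ^ 2 ≤ 0.8485 ^ 2 := by gcongr
    rw [← sq_abs u₁, ← sq_abs z]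
    linarith
  have hu₂0 : 0 ≤ u₂ := by
    by_contra! h
    have := mul_neg_of_pos_of_neg ht h
    linarith
  -- The bounds come from `u₂ ^ 2 ≥ 4 - 2 - 0.72` and `u₂ ^ 2 ≤ 6.3001 - 1.575`.
  refine ⟨hρ, ?_, ?_⟩
  · by_contra! h
    have := mul_self_lt_mul_self hu₂0 h
    linarith [hu.1, hu.2]
  · by_contra! h
    have := mul_self_lt_mul_self (by norm_num) h
    linarith [hu'.1, hu'.2, sq_nonneg u₁, sq_nonneg z]

/-- An orthonormal basis adapted to two directions. -/
lemma exists_orthonormalBasis_adapted (e f : E3) (he : e ≠ 0) :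
    ∃ b : OrthonormalBasis (Fin 3) ℝ E3, e = ‖e‖ • b 2 ∧ inner ℝ (b 1) f = 0 := by
  obtain ⟨n, hn, hn0⟩ : ∃ n : E3, (inner ℝ e n = 0 ∧ inner ℝ f n = 0) ∧ n ≠ 0 := by
    let L : E3 →ₗ[ℝ] ℝ × ℝ := ((innerₛₗ ℝ e).prod (innerₛₗ ℝ f))
    have : LinearMap.ker L ≠ ⊥ := by
      apply LinearMap.ker_ne_bot_of_finrank_lt
      simp
    obtain ⟨n, hn, hn0⟩ := (Submodule.ne_bot_iff _).1 this
    have hn' : (inner ℝ e n, inner ℝ f n) = (0 : ℝ × ℝ) := hn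
    exact ⟨n, Prod.mk_eq_zero.1 hn', hn0⟩
  have hne : 0 < ‖e‖ := norm_pos_iff.2 he
  have hnn : 0 < ‖n‖ := norm_pos_iff.2 hn0
  let v : Fin 3 → E3 := ![0, ‖n‖⁻¹ • n, ‖e‖⁻¹ • e]
  have hv : Orthonormal ℝ (({1, 2} : Set (Fin 3)).domRestrict v) := by
    rw [orthonormal_iff_ite]
    rintro ⟨i, hi⟩ ⟨j, hj⟩
    simp only [Set.mem_insert_iff, Set.mem_singleton_iff] at hi hj
    rcases hi with rfl | rfl <;> rcases hj with rfl | rfl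
    · simp [v, Set.domRestrict_apply, norm_smul, hnn.ne']
    · simp [v, Set.domRestrict_apply, inner_smul_left, inner_smul_right, real_inner_comm e n, hn.1]
    · simp [v, Set.domRestrict_apply, inner_smul_left, inner_smul_right, hn.1]
    · simp [v, Set.domRestrict_apply, norm_smul, hne.ne']
  obtain ⟨b, hb⟩ := hv.exists_orthonormalBasis_extension_of_card_eq (by simp)
  refine ⟨b, ?_, ?_⟩
  · rw [hb 2 (by simp)]
    simp [v, smul_smul, hne.ne']
  · rw [hb 1 (by simp)]
    simp [v, inner_smul_left, real_inner_comm f n, hn.2]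

end Kepler

namespace Kepler

variable {P : Set E3}

/-- At most one anchor of the diagonal `p q` lies behind the diagonal `x y`. -/
lemma EdgeFace.anchor_unique (hP : IsPacking P) {p q x y w w' : E3} (h : EdgeFace P x y p q w)
    (h' : EdgeFace P x y p q w') (hc : Crosses x y p q w) (hc' : Crosses x y p q w')
    (hpq : 2 * t0 < dist p q) : w = w' := by
  by_contra hww
  have hpq0 : p - q ≠ 0 := sub_ne_zero.2 h.xy
  obtain ⟨b, hb2, hb1⟩ := exists_orthonormalBasis_adapted (p - q) (x - y) hpq0
  set m : E3 := (1 / 2 : ℝ) • (p + q) with hm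
  set c : E3 → E3 := fun u => b.repr (u - m) with hcdef
  have hdist : ∀ u v, dist u v ^ 2 = (c u 0 - c v 0) ^ 2 + (c u 1 - c v 1) ^ 2 +
      (c u 2 - c v 2) ^ 2 := fun u v => by
    rw [← dist_sq_eq, hcdef, b.repr.dist_map, dist_sub_right]
  set r := ‖p - q‖ / 2 with hr
  have hdr : dist p q = 2 * r := by rw [hr, dist_eq_norm]; ring
  have hcomp : ∀ u i, c u i = inner ℝ (b i) (u - m) := fun u i => b.repr_apply_apply _ _
  have hp : c p = !₂[0, 0, r] := by
    have e : p - m = r • b 2 := by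
      rw [hr, div_eq_inv_mul, mul_smul, ← hb2, hm]; module
    ext i
    rw [hcomp, e, inner_smul_right, b.inner_eq_ite]
    fin_cases i <;> simp
  have hq : c q = !₂[0, 0, -r] := by
    have e : q - m = (-r) • b 2 := by
      rw [hr, neg_smul, div_eq_inv_mul, mul_smul, ← hb2, hm]; module
    ext i
    rw [hcomp, e, inner_smul_right, b.inner_eq_ite]
    fin_cases i <;> simp
  have hk : c x 1 = c y 1 := by
    have : c x 1 - c y 1 = 0 := by
      rw [hcomp, hcomp, ← inner_sub_right, ← hb1]; congr 1; abel
    linarith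
  have hp0 : c p 0 = 0 := by rw [hp]; rfl
  have hp1 : c p 1 = 0 := by rw [hp]; rfl
  have hp2 : c p 2 = r := by rw [hp]; rfl
  have hq0 : c q 0 = 0 := by rw [hq]; rfl
  have hq1 : c q 1 = 0 := by rw [hq]; rfl
  have hq2 : c q 2 = -r := by rw [hq]; rfl
  have hcross : ∀ {s t a b' d : ℝ} {x y w : E3}, s + t = 1 → a + b' + d = 1 →
      s • x + t • y = a • p + b' • q + d • w → ∀ i, s * c x i + t * c y i =
        a * c p i + b' * c q i + d * c w i := fun {s t a b' d x y w} h1 h2 h3 i => by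
    have := congrArg (fun u => inner ℝ (b i) u) h3
    simp only [inner_add_right, inner_smul_right] at this
    simp only [hcomp, inner_sub_right]
    linear_combination this - inner ℝ (b i) m * (h1 - h2)
  clear_value c
  have hxy8 := dist_sq_lt_of_lt_sqrt h.pq_lt
  have hpq8 := dist_sq_lt_of_lt_sqrt h.xy_lt
  have hr1 : 1.575 ≤ r ^ 2 := by
    norm_num [t0, hdr] at hpq
    nlinarith
  rw [hdr] at hpq8
  have hr0 : 0 < r := by norm_num [t0, hdr] at hpq; linarith
  obtain ⟨sxp, sxq, syp, syq⟩ := h.px_py_qx_qy hP hc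
  -- The sign orients the common perpendicular of the diagonals so that `x y` lies on its
  -- nonnegative side; every anchor behind `x y` is then at height between `1.13` and `2.174` on
  -- that same side.
  obtain ⟨σ, hσ, hσk⟩ : ∃ σ : ℝ, (σ = 1 ∨ σ = -1) ∧ 0 ≤ σ * c x 1 := by
    rcases le_total 0 (c x 1) with h | h
    · exact ⟨1, Or.inl rfl, by linarith⟩
    · exact ⟨-1, Or.inr rfl, by linarith⟩
  have hσ2 : σ ^ 2 = 1 := by rcases hσ with h | h <;> rw [h] <;> norm_num
  have key : ∀ {x y w : E3}, EdgeFace P x y p q w → Crosses x y p q w → c x 1 = c y 1 →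
      0 ≤ σ * c x 1 → c y 0 ≤ c x 0 →
      c w 0 ^ 2 + c w 2 ^ 2 ≤ 0.72 ∧ 1.13 ≤ σ * c w 1 ∧ σ * c w 1 ≤ 2.174 := by
    intro x y w h hc hk hσk hle
    obtain ⟨sxp, sxq, syp, syq⟩ := h.px_py_qx_qy hP hc
    obtain ⟨s, t, a, b', d, hs, ht, ha, hb, hd, hst, habd, heq⟩ := hc
    -- With zero weight at `w` the segments `x y` and `p q` would cross.
    have hd0 : 0 < d := by
      refine lt_of_le_of_ne hd fun h0 => not_inter_segments hP h.mem_p h.mem_q h.mem_x h.mem_y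
        h.px h.py h.qx h.qy h.pq_lt h.xy_lt ⟨s • x + t • y, mem_convexHull_pair.2
          ⟨s, t, hs, ht, hst, rfl⟩, mem_convexHull_pair.2 ⟨a, b', ha, hb, by linarith, ?_⟩⟩
      rw [heq, ← h0, zero_smul, add_zero]
    have e0 := hcross hst habd heq 0
    have e1 := hcross hst habd heq 1
    rw [hp0, hq0] at e0
    rw [hp1, hq1, ← hk] at e1
    have dxp := dist_sq_le_of_le_t0 sxp
    have dxq := dist_sq_le_of_le_t0 sxq
    have dyp := dist_sq_le_of_le_t0 syp
    have dyq := dist_sq_le_of_le_t0 syq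
    have dpw := dist_sq_le_of_le_t0 h.xz_le
    have dqw := dist_sq_le_of_le_t0 h.yz_le
    have fxp := hP.four_le h.mem_p h.mem_x h.px
    have fxq := hP.four_le h.mem_p h.mem_y h.py
    have fyp := hP.four_le h.mem_q h.mem_x h.qx
    have fyq := hP.four_le h.mem_q h.mem_y h.qy
    have fpw := hP.four_le h.mem_x h.mem_z h.xz
    have fqw := hP.four_le h.mem_y h.mem_z h.yz
    have fxw := hP.four_le h.mem_p h.mem_z h.pz
    have fyw := hP.four_le h.mem_q h.mem_z h.qz
    have hxy8 := dist_sq_lt_of_lt_sqrt h.pq_lt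
    rw [hdist] at dxp dxq dyp dyq dpw dqw fxp fxq fyp fyq fpw fqw fxw fyw hxy8
    rw [hp0, hp1, hp2] at dxp dyp dpw fxp fyp fpw
    rw [hq0, hq1, hq2] at dxq dyq dqw fxq fyq fqw
    have m1 : ∀ u : ℝ, (σ * u) ^ 2 = u ^ 2 := fun u => by rw [mul_pow, hσ2, one_mul]
    have m2 : (σ * c w 1 - σ * c x 1) ^ 2 = (c w 1 - c x 1) ^ 2 := by rw [← mul_sub, m1]
    have m3 := congrArg (fun u : ℝ => u ^ 2) hk
    have hyx : (c w 1 - c x 1) ^ 2 = (c w 1 - c y 1) ^ 2 := by rw [hk]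
    have hyy : c x 1 ^ 2 = c y 1 ^ 2 := by rw [hk]
    have hxy1 : (c x 1 - c y 1) ^ 2 = 0 := by rw [hk, sub_self]; norm_num
    refine anchor_offset (r := r) (a := c x 0) (b := -c y 0) (k := σ * c x 1) (z₁ := c x 2)
      (z₂ := c y 2) (u₁ := c w 0) (u₂ := σ * c w 1) (z := c w 2) (t := d) (β := s) hr0 hr1 ?_
      ⟨?_, ?_⟩ ⟨?_, ?_⟩ ⟨?_, ?_⟩ ⟨?_, ?_⟩ ⟨?_, ?_⟩ ⟨?_, ?_⟩ ?_ ?_ ?_ ?_ hσk hd0 ?_ hs ?_ ?_ ?_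
    all_goals try simp only [m1, m2]
    · linarith
    · linarith
    · linarith
    · linarith
    · linarith
    · linarith
    · linarith
    · linarith
    · linarith
    · linarith
    · linarith
    · linarith
    · linarith
    · have := sq_nonneg (c x 2 - c y 2)
      linarith
    · linarith
    · linarith
    · linarith
    · linarith
    · linarith
    · obtain rfl : t = 1 - s := by linarith
      linarith
    · have : σ * (s * c x 1 + t * c x 1) = σ * c x 1 := by rw [← add_mul, hst, one_mul]
      rw [← this, e1]; ring
  have key2 : ∀ {w : E3}, EdgeFace P x y p q w → Crosses x y p q w →
      c w 0 ^ 2 + c w 2 ^ 2 ≤ 0.72 ∧ 1.13 ≤ σ * c w 1 ∧ σ * c w 1 ≤ 2.174 := by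
    intro w h hc
    rcases le_total (c y 0) (c x 0) with hle | hle
    · exact key h hc hk hσk hle
    · exact key h.swap_edge hc.swap_edge hk.symm (hk ▸ hσk) hle
  obtain ⟨k1, k2, k3⟩ := key2 h hc
  obtain ⟨l1, l2, l3⟩ := key2 h' hc'
  have hfin := hP.four_le h.mem_z h'.mem_z hww
  rw [hdist] at hfin
  -- The heights differ by at most `2.174 - 1.13`, and both points are within `√0.72` of the axis,
  -- so the squared distance is at most `1.044 ^ 2 + 4 * 0.72 < 4`.
  have e1 : (c w 1 - c w' 1) ^ 2 ≤ 1.044 ^ 2 := by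
    have : (c w 1 - c w' 1) ^ 2 = (σ * c w 1 - σ * c w' 1) ^ 2 := by
      rw [← mul_sub, mul_pow, hσ2, one_mul]
    rw [this]
    exact sq_le_sq' (by linarith) (by linarith)
  linarith [sq_nonneg (c w 0 + c w' 0), sq_nonneg (c w 2 + c w' 2)]
end Kepler

/-! ### Finiteness, anchors and the rules of the Q-system -/

namespace Kepler

variable {P : Set E3}

lemma IsPacking.disjoint_balls (hP : IsPacking P) {v w : E3} (hv : v ∈ P) (hw : w ∈ P)
    (hvw : v ≠ w) : Disjoint (Metric.ball v 1) (Metric.ball w 1) :=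
  Metric.ball_disjoint_ball (by linarith [hP v hv w hw hvw])

lemma IsPacking.card_mul_le (hP : IsPacking P) {F : Finset E3} (hF : (F : Set E3) ⊆ P)
    {A : Set E3} (hA : ∀ v ∈ F, Metric.ball v 1 ⊆ A) (hfin : volume A ≠ ⊤) :
    F.card * volume.real (Metric.ball (0 : E3) 1) ≤ volume.real A := by
  have h1 : volume.real (⋃ v ∈ F, Metric.ball v 1) = F.card * volume.real (Metric.ball (0 : E3) 1) := by
    rw [measureReal_biUnion_finset
      (fun v hv w hw hvw => hP.disjoint_balls (hF hv) (hF hw) hvw)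
      (fun v _ => measurableSet_ball), ← nsmul_eq_mul, ← Finset.sum_const]
    refine Finset.sum_congr rfl fun v _ => ?_
    simp only [measureReal_def, Measure.addHaar_ball_center]
  rw [← h1]
  exact measureReal_mono (Set.iUnion₂_subset hA) hfin

lemma volume_ball_pos : 0 < volume.real (Metric.ball (0 : E3) 1) :=
  ENNReal.toReal_pos (Metric.measure_ball_pos _ _ one_pos).ne' measure_ball_lt_top.ne

lemma volume_real_closedBall (x : E3) {r : ℝ} (hr : 0 ≤ r) :
    volume.real (Metric.closedBall x r) = r ^ 3 * volume.real (Metric.ball (0 : E3) 1) := by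
  simp only [measureReal_def]
  rw [Measure.addHaar_closedBall _ _ hr, ENNReal.toReal_mul, finrank_euclideanSpace_fin,
    ENNReal.toReal_ofReal (by positivity)]

lemma IsPacking.card_le (hP : IsPacking P) {F : Finset E3} {x : E3} {r : ℝ} (hr : 0 ≤ r)
    (hF : (F : Set E3) ⊆ P ∩ Metric.closedBall x r) : (F.card : ℝ) ≤ (r + 1) ^ 3 := by
  have h := hP.card_mul_le (F := F) (A := Metric.closedBall x (r + 1)) (fun v hv => (hF hv).1)
    (fun v hv => Metric.ball_subset_closedBall.trans
      (Metric.closedBall_subset_closedBall' (by linarith [Metric.mem_closedBall.1 (hF hv).2])))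
    measure_closedBall_lt_top.ne
  rw [volume_real_closedBall _ (by linarith)] at h
  exact le_of_mul_le_mul_right h volume_ball_pos

lemma IsPacking.finite_inter (hP : IsPacking P) (x : E3) (r : ℝ) :
    (P ∩ Metric.closedBall x r).Finite := by
  by_contra hinf
  have hinf : (P ∩ Metric.closedBall x r).Infinite := hinf
  have hr : 0 ≤ r := by
    obtain ⟨y, hy⟩ := hinf.nonempty
    exact dist_nonneg.trans hy.2
  obtain ⟨F, hF, hc⟩ := hinf.exists_subset_card_eq (⌊(r + 1) ^ 3⌋₊ + 1)
  have := hP.card_le hr hF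
  rw [hc] at this
  push_cast at this
  linarith [Nat.lt_floor_add_one ((r + 1) ^ 3)]

lemma anchors_finite (hP : IsPacking P) (p q : E3) : (anchors P p q).Finite :=
  (hP.finite_inter p (2 * t0)).subset fun _ hu => ⟨hu.1, hu.2.1⟩

lemma anchors_swap (P : Set E3) (p q : E3) : anchors P p q = anchors P q p := by
  ext u; simp only [anchors, Set.mem_ofPred_eq]; tauto

lemma ne_of_mem_anchors {p q u : E3} (h : 2 * t0 < dist p q) (hu : u ∈ anchors P p q) :
    u ≠ p ∧ u ≠ q := by
  constructor
  · rintro rfl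
    linarith [hu.2.2]
  · rintro rfl
    have := hu.2.1
    rw [dist_comm] at this
    linarith

lemma IsStrictQuarter.mem_anchors {p q u : E3} {S : Finset E3} (h : IsStrictQuarter p q S)
    (hS : (S : Set E3) ⊆ P) (hu : u ∈ S) (hup : u ≠ p) (huq : u ≠ q) : u ∈ anchors P p q :=
  ⟨hS hu, by rw [dist_comm]; exact h.short h.2.1 hu hup huq,
    by rw [dist_comm]; exact h.short h.2.2.1 hu hup huq⟩

lemma IsQuarteredOctahedron.mem_anchors {p q u : E3} {O : Finset E3} (h : IsQuarteredOctahedron p q O)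
    (hO : (O : Set E3) ⊆ P) (hu : u ∈ O) (hup : u ≠ p) (huq : u ≠ q) : u ∈ anchors P p q := by
  obtain ⟨-, -, S, h1, -, h3⟩ := h
  obtain ⟨i, hi⟩ := (h3 u).1 hu
  exact (h1 i).mem_anchors (fun x hx => hO ((h3 x).2 ⟨i, hx⟩)) hi hup huq

lemma IsQuarteredOctahedron.four_le (hP : IsPacking P) {p q : E3} {O : Finset E3}
    (h : IsQuarteredOctahedron p q O) (hO : (O : Set E3) ⊆ P) : 4 ≤ (anchors P p q).ncard := by
  classical
  have hsub : (((O.erase p).erase q : Finset E3) : Set E3) ⊆ anchors P p q := by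
    intro u hu
    rw [Finset.mem_coe, Finset.mem_erase, Finset.mem_erase] at hu
    exact h.mem_anchors hO hu.2.2 hu.2.1 hu.1
  have hc := Set.ncard_le_ncard hsub (anchors_finite hP p q)
  rw [Set.ncard_coe_finset] at hc
  have h1 := Finset.pred_card_le_card_erase (s := O) (a := p)
  have h2 := Finset.pred_card_le_card_erase (s := O.erase p) (a := q)
  have := h.1
  omega

lemma IsQuarteredOctahedron.swap {p q : E3} {O : Finset E3} (h : IsQuarteredOctahedron p q O) :
    IsQuarteredOctahedron q p O := by
  obtain ⟨h1, h2, S, h3, h4⟩ := h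
  exact ⟨h1, h2, S, fun i => (h3 i).swap, h4⟩

/-- A diagonal with at least four anchors along which the Q-system may contain quarters. -/
def ManyAnchors (c : Finset E3 → E3 × E3) (P : Set E3) (p q : E3) : Prop :=
  4 ≤ (anchors P p q).ncard ∧ ((anchors P p q).ncard = 4 →
    (∃ O : Finset E3, (O : Set E3) ⊆ P ∧ IsQuarteredOctahedron p q O) →
    ∃ O : Finset E3, (O : Set E3) ⊆ P ∧ IsQuarteredOctahedron p q O ∧ (c O = (p, q) ∨ c O = (q, p)))

/-- The three anchors `v₂, v₄, v₅` of the diagonal `{v₁, v₃}` are in the position required of the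
anchors of an interior quarter. -/
def InteriorPosition (P : Set E3) (v₁ v₃ v₂ v₄ v₅ : E3) : Prop :=
  (anchors P v₁ v₃).ncard = 3 ∧ anchors P v₁ v₃ = {v₂, v₄, v₅} ∧
    IsStrictDiagonal v₄ v₅ ∧
    (anchors P v₄ v₅).ncard = 3 ∧ anchors P v₄ v₅ = {v₁, v₃, v₂} ∧
    Real.pi < dihedralAngle v₁ v₃ v₂ v₄ + dihedralAngle v₁ v₃ v₂ v₅

lemma dihedralAngle_swap (p q x y : E3) : dihedralAngle p q x y = dihedralAngle q p x y := by
  have h : ∀ u : E3, (Submodule.span ℝ {q - p})ᗮ.starProjection (u - p) =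
      (Submodule.span ℝ {p - q})ᗮ.starProjection (u - q) := by
    intro u
    have hs : Submodule.span ℝ {q - p} = Submodule.span ℝ {p - q} := by
      rw [← neg_sub p q, ← Set.neg_singleton, Submodule.span_neg]
    have h0 : (Submodule.span ℝ {p - q})ᗮ.starProjection (q - p) = 0 := by
      rw [Submodule.starProjection_apply_eq_zero_iff, ← hs]
      exact Submodule.le_orthogonal_orthogonal _ (Submodule.mem_span_singleton_self _)
    simp only [hs]
    rw [show u - p = (u - q) + (q - p) by abel, map_add, h0, add_zero]
  simp only [dihedralAngle, h]

lemma InteriorPosition.swap {v₁ v₃ v₂ v₄ v₅ : E3} (h : InteriorPosition P v₁ v₃ v₂ v₄ v₅) :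
    InteriorPosition P v₃ v₁ v₂ v₄ v₅ := by
  obtain ⟨h1, h2, h3, h4, h5, h6⟩ := h
  refine ⟨by rwa [anchors_swap], by rwa [anchors_swap], h3, h4, ?_, ?_⟩
  · rw [h5]; ext; simp; tauto
  · rwa [dihedralAngle_swap v₃ v₁, dihedralAngle_swap v₃ v₁]

/-- A quasi-regular tetrahedron has no strict diagonal, and a free quarter overlaps no other
candidate; the other rules remain. A quartered octahedron provides four anchors by itself and `c`
selects its diagonal, so its quarters and those with many anchors share the condition `ManyAnchors`.
-/
lemma rules_of_overlap {c : Finset E3 → E3 × E3} (hc : IsDiagonalChoice c) (hP : IsPacking P)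
    {S S' : Finset E3} {p q : E3} (hS : S ∈ qSystem c P) (hq : IsStrictQuarter p q S)
    (hS' : IsCandidate P S') (hne : S' ≠ S) (ho : Overlap S S') :
    ManyAnchors c P p q ∨ ∃ v₂ v₄ v₅, InteriorPosition P p q v₂ v₄ v₅ := by
  obtain ⟨hSP, h | h | h | h | h⟩ := hS
  · exfalso
    have := (h.2 p hq.2.1 q hq.2.2.1 hq.ne).2
    linarith [hq.2.2.2.1.1]
  · exfalso
    obtain ⟨p', q', h1, h2⟩ := h
    exact h2 S hSP h1 S' hS' hne ho
  · left
    obtain ⟨p', q', h1, h2, h3⟩ := h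
    rcases hq.eq_or_eq h1.2.1 h1.2.2.1 h1.2.2.2.1.1 with h | h
    · rw [h.1, h.2] at h2 h3
      exact ⟨h2, fun h4 h5 => absurd ⟨h4, h5⟩ h3⟩
    · rw [h.1, h.2] at h2 h3
      rw [anchors_swap] at h2 h3
      exact ⟨h2, fun h4 ⟨O, h5, h6⟩ => absurd ⟨h4, O, h5, h6.swap⟩ h3⟩
  · left
    obtain ⟨O, hO, ⟨p', q', hO'⟩, -, h1⟩ := h
    have h2 := hc O p' q' hO'
    rcases hq.eq_or_eq h1.2.1 h1.2.2.1 h1.2.2.2.1.1 with h | h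
    · rw [h.1, h.2] at h2
      exact ⟨h2.four_le hP hO, fun _ _ => ⟨O, hO, h2, Or.inl (Prod.ext h.1 h.2)⟩⟩
    · rw [h.1, h.2] at h2
      exact ⟨h2.swap.four_le hP hO, fun _ _ => ⟨O, hO, h2.swap, Or.inr (Prod.ext h.1 h.2)⟩⟩
  · right
    obtain ⟨v₁, v₂, v₃, v₄, v₅, h1, -, -, h4⟩ := h
    have h4 : InteriorPosition P v₁ v₃ v₂ v₄ v₅ := h4
    rcases hq.eq_or_eq h1.2.1 h1.2.2.1 h1.2.2.2.1.1 with h | h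
    · rw [h.1, h.2] at h4
      exact ⟨_, _, _, h4⟩
    · rw [h.1, h.2] at h4
      exact ⟨_, _, _, h4.swap⟩

/-- The vectors `s • u` and `t • v` complete `c • x` to a triangle in which the two angles are
interior angles. Vanishing coefficients and vectors are treated separately, since the angle with
zero is `π / 2`. -/
lemma angle_add_le_pi {E : Type*} [NormedAddCommGroup E] [InnerProductSpace ℝ E] {x u v : E}
    {s t c : ℝ} (hs : 0 ≤ s) (ht : 0 ≤ t) (hc : 0 < c) (h : s • u + t • v = c • x) :
    InnerProductGeometry.angle x u + InnerProductGeometry.angle x v ≤ Real.pi := by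
  have hpi := Real.pi_pos
  rcases hs.eq_or_lt with rfl | hs
  · have hv : InnerProductGeometry.angle x v ≤ Real.pi / 2 ∧
        (InnerProductGeometry.angle x v = 0 ∨ x = 0) := by
      rw [zero_smul, zero_add] at h
      rcases ht.eq_or_lt with rfl | ht
      · have hx : x = 0 := by
          rw [zero_smul] at h
          exact (smul_eq_zero.1 h.symm).resolve_left hc.ne'
        simp [hx]
      · by_cases hx : x = 0
        · simp [hx]
        rw [← InnerProductGeometry.angle_smul_right_of_pos x v ht, h,
          InnerProductGeometry.angle_smul_right_of_pos x x hc, InnerProductGeometry.angle_self hx]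
        exact ⟨by positivity, Or.inl rfl⟩
    rcases hv.2 with h1 | h1
    · rw [h1, add_zero]
      exact InnerProductGeometry.angle_le_pi _ _
    · simp [h1]
  rcases ht.eq_or_lt with rfl | ht
  · by_cases hx : x = 0
    · simp [hx]
    rw [zero_smul, add_zero] at h
    rw [← InnerProductGeometry.angle_smul_right_of_pos x u hs, h,
      InnerProductGeometry.angle_smul_right_of_pos x x hc, InnerProductGeometry.angle_self hx,
      zero_add]
    exact InnerProductGeometry.angle_le_pi _ _
  by_cases hu : u = 0
  · rw [hu, smul_zero, zero_add] at h
    by_cases hx : x = 0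
    · simp [hx]
    rw [← InnerProductGeometry.angle_smul_right_of_pos x v ht, h,
      InnerProductGeometry.angle_smul_right_of_pos x x hc, InnerProductGeometry.angle_self hx,
      add_zero]
    exact InnerProductGeometry.angle_le_pi _ _
  have h1 := InnerProductGeometry.angle_add_angle_sub_add_angle_sub_eq_pi (c • x)
    (smul_ne_zero hs.ne' hu)
  rw [← h, add_sub_cancel_left, h, InnerProductGeometry.angle_smul_left_of_pos _ _ hc,
    InnerProductGeometry.angle_smul_left_of_pos _ _ hc,
    InnerProductGeometry.angle_smul_right_of_pos _ _ hs,
    InnerProductGeometry.angle_smul_right_of_pos _ _ ht] at h1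
  linarith [InnerProductGeometry.angle_nonneg (s • u) (s • u - c • x)]

/-- Projection along `x y` turns the crossing into a relation `s p' + t q' = c z'`, and `c` is
positive because `p q` does not meet `x y`. -/
lemma dihedralAngle_add_le {p q x y z : E3} (h : Crosses p q x y z)
    (hn : ¬(convexHull ℝ ({p, q} : Set E3) ∩ convexHull ℝ ({x, y} : Set E3)).Nonempty) :
    dihedralAngle x y z p + dihedralAngle x y z q ≤ Real.pi := by
  obtain ⟨s, t, a, b, c, hs, ht, ha, hb, hc, hst, habc, he⟩ := h
  have hc0 : 0 < c := by
    refine lt_of_le_of_ne hc ?_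
    rintro rfl
    refine hn ⟨s • p + t • q, mem_convexHull_pair.2 ⟨s, t, hs, ht, hst, rfl⟩,
      mem_convexHull_pair.2 ⟨a, b, ha, hb, by linarith, ?_⟩⟩
    rw [he, zero_smul, add_zero]
  refine angle_add_le_pi hs ht hc0 ?_
  have h0 : (Submodule.span ℝ {y - x})ᗮ.starProjection (y - x) = 0 := by
    rw [Submodule.starProjection_apply_eq_zero_iff]
    exact Submodule.le_orthogonal_orthogonal _ (Submodule.mem_span_singleton_self _)
  have h1 : s • (p - x) + t • (q - x) = c • (z - x) + b • (y - x) := by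
    have : s • p + t • q - (s + t) • x = a • x + b • y + c • z - (a + b + c) • x := by
      rw [he, hst, habc]
    rw [← sub_eq_zero] at this ⊢
    rw [← this]
    module
  rw [← map_smul, ← map_smul, ← map_smul, ← map_add, h1, map_add, map_smul _ b, h0, smul_zero,
    add_zero]

end Kepler

/-! ### Simplices of the Q-system do not overlap -/

namespace Kepler

variable {P : Set E3}

/-- The three anchors of `x y` would be `p, q, z`. As `v₂` is within `2 * t0` of `v₄` and `v₅` while
`p q` is longer, `z` is `v₂`. But `p q` crosses the triangle `x y z`, so the dihedral angles from
`z` to `p` and `q` sum to at most `π`. -/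
lemma not_interiorPosition_of_crosses (hP : IsPacking P) {p q x y z : E3}
    (h : EdgeFace P p q x y z) (hc : Crosses p q x y z) (hpq : 2 * t0 < dist p q)
    {v₂ v₄ v₅ : E3} (hi : InteriorPosition P x y v₂ v₄ v₅) : False := by
  obtain ⟨h1, h2, h3, h4, h5, h6⟩ := hi
  obtain ⟨a1, a2, a3, a4⟩ := h.px_py_qx_qy hP hc
  have hn := not_inter_segments hP h.mem_p h.mem_q h.mem_x h.mem_y h.px h.py h.qx h.qy h.pq_lt
    h.xy_lt
  have hsub : ({p, q, z} : Set E3) ⊆ anchors P x y := by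
    rintro u (rfl | rfl | rfl)
    · exact ⟨h.mem_p, a1, a2⟩
    · exact ⟨h.mem_q, a3, a4⟩
    · exact ⟨h.mem_z, by rw [dist_comm]; exact h.xz_le, by rw [dist_comm]; exact h.yz_le⟩
  have hcard : ({p, q, z} : Set E3).ncard = 3 := by
    rw [Set.ncard_eq_three]; exact ⟨p, q, z, h.pq, h.pz, h.qz, rfl⟩
  have heq : ({p, q, z} : Set E3) = {v₂, v₄, v₅} := by
    rw [← h2]
    exact Set.eq_of_subset_of_ncard_le hsub (by rw [h1, hcard]) (anchors_finite hP x y)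
  have hp : p ∈ ({v₂, v₄, v₅} : Set E3) := heq ▸ by simp
  have hq : q ∈ ({v₂, v₄, v₅} : Set E3) := heq ▸ by simp
  have hz : z ∈ ({v₂, v₄, v₅} : Set E3) := heq ▸ by simp
  have hv2 : v₂ ∈ anchors P v₄ v₅ := by rw [h5]; simp
  have ha := dihedralAngle_add_le hc hn
  simp only [Set.mem_insert_iff, Set.mem_singleton_iff] at hp hq hz
  have d1 := h.pq
  have d2 := h.pz
  have d3 := h.qz
  have e1 := hv2.2.1
  have e2 := hv2.2.2
  rw [dist_comm] at e1 e2
  rcases hp with hp | hp | hp <;> rcases hq with hq | hq | hq <;>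
    rcases hz with hz | hz | hz <;> rw [hp, hq] at hpq <;> rw [hp, hq, hz] at ha <;>
    first
    | exact absurd (hp.trans hq.symm) d1
    | exact absurd (hp.trans hz.symm) d2
    | exact absurd (hq.trans hz.symm) d3
    | linarith
    | (rw [dist_comm] at hpq; linarith)

/-- By `EdgeFace.crosses_of_anchor`, any other anchor would make the short edge `x y` cross the
triangle it spans with `p q`. -/
lemma anchors_subset_of_short (hP : IsPacking P) {p q x y z : E3}
    (h : EdgeFace P p q x y z) (hc : Crosses p q x y z) (hpq : 2 * t0 < dist p q)
    (hxy : dist x y ≤ 2 * t0) : anchors P p q ⊆ {x, y, z} := by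
  intro w hw
  by_contra hn
  simp only [Set.mem_insert_iff, Set.mem_singleton_iff, not_or] at hn
  obtain ⟨n1, n2⟩ := ne_of_mem_anchors hpq hw
  have hc' := h.crosses_of_anchor hP hc hw.1 n1 n2 hn.1 hn.2.1 hn.2.2 hw.2.1 hw.2.2
  refine EdgeFace.not_crosses hP (p := x) (q := y) (x := p) (y := q) (z := w)
    ⟨h.mem_x, h.mem_y, h.mem_p, h.mem_q, hw.1, h.xy, h.px.symm, h.qx.symm, Ne.symm hn.1, h.py.symm,
      h.qy.symm, Ne.symm hn.2.1, h.pq, n1.symm, n2.symm, h.pq_lt, by rw [dist_comm]; exact hw.2.1,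
      by rw [dist_comm]; exact hw.2.2, h.xy_lt⟩ hxy hc'

lemma ncard_triple_le (x y z : E3) : ({x, y, z} : Set E3).ncard ≤ 3 := by
  classical
  have := Finset.card_le_three (a := x) (b := y) (c := z)
  rw [← Set.ncard_coe_finset] at this
  simpa using this

/-- If a diagonal with at least four anchors crosses a triangle `x y z`, then there is one anchor
other than the vertices of the triangle, and it lies behind the edge `x y`. -/
lemma exists_fourth_anchor (hP : IsPacking P) {p q x y z : E3}
    (h : EdgeFace P p q x y z) (hc : Crosses p q x y z) (hpq : 2 * t0 < dist p q)
    (h4 : 4 ≤ (anchors P p q).ncard) :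
    ∃ w, EdgeFace P x y p q w ∧ Crosses x y p q w ∧ w ≠ z ∧ anchors P p q = {x, y, z, w} ∧
      (anchors P p q).ncard = 4 := by
  have key : ∀ w ∈ anchors P p q \ {x, y, z}, EdgeFace P x y p q w ∧ Crosses x y p q w := by
    rintro w ⟨hw, hn⟩
    simp only [Set.mem_insert_iff, Set.mem_singleton_iff, not_or] at hn
    obtain ⟨n1, n2⟩ := ne_of_mem_anchors hpq hw
    exact ⟨⟨h.mem_x, h.mem_y, h.mem_p, h.mem_q, hw.1, h.xy, h.px.symm, h.qx.symm, Ne.symm hn.1,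
      h.py.symm, h.qy.symm, Ne.symm hn.2.1, h.pq, n1.symm, n2.symm, h.pq_lt,
      by rw [dist_comm]; exact hw.2.1, by rw [dist_comm]; exact hw.2.2, h.xy_lt⟩,
      h.crosses_of_anchor hP hc hw.1 n1 n2 hn.1 hn.2.1 hn.2.2 hw.2.1 hw.2.2⟩
  have hex : (anchors P p q \ {x, y, z}).Nonempty := by
    by_contra hne
    rw [Set.not_nonempty_iff_eq_empty, Set.sdiff_eq_empty] at hne
    have := Set.ncard_le_ncard hne (Set.toFinite _)
    have := ncard_triple_le x y z
    omega
  obtain ⟨w, hw⟩ := hex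
  obtain ⟨k1, k2⟩ := key w hw
  have hsub : anchors P p q ⊆ {x, y, z, w} := by
    intro w' hw'
    by_contra hn
    simp only [Set.mem_insert_iff, Set.mem_singleton_iff, not_or] at hn
    obtain ⟨k1', k2'⟩ := key w' ⟨hw', by simp; tauto⟩
    exact hn.2.2.2 (EdgeFace.anchor_unique hP k1' k1 k2' k2 hpq)
  have hle : ({x, y, z, w} : Set E3).ncard ≤ 4 := by
    have h1 := Set.ncard_insert_le w {x, y, z}
    have h2 := ncard_triple_le x y z
    have h3 : ({x, y, z, w} : Set E3) = insert w {x, y, z} := by ext; simp; tauto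
    rw [h3]; omega
  have heq := Set.eq_of_subset_of_ncard_le hsub (hle.trans h4) (Set.toFinite _)
  refine ⟨w, k1, k2, ?_, heq, ?_⟩
  · rintro rfl
    exact hw.2 (by simp)
  · rw [heq] at h4 ⊢
    omega

lemma isStrictQuarter_insert (hP : IsPacking P) {p q u v : E3} (hp : p ∈ P) (hq : q ∈ P)
    (hu : u ∈ anchors P p q) (hv : v ∈ anchors P p q) (huv : u ≠ v) (h : dist u v ≤ 2 * t0)
    (hpq : IsStrictDiagonal p q) : IsStrictQuarter p q ({p, q, u, v} : Finset E3) := by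
  classical
  obtain ⟨u1, u2⟩ := ne_of_mem_anchors hpq.1 hu
  obtain ⟨v1, v2⟩ := ne_of_mem_anchors hpq.1 hv
  have hne : p ≠ q := by
    rintro rfl
    have := hpq.1
    rw [dist_self] at this
    norm_num [t0] at this
  refine ⟨?_, by simp, by simp, hpq, ?_⟩
  · rw [Finset.card_eq_succ]
    refine ⟨p, {q, u, v}, by simp [hne, u1.symm, v1.symm], rfl, ?_⟩
    exact Finset.card_eq_three.2 ⟨q, u, v, u2.symm, v2.symm, huv, rfl⟩
  · have c1 := hu.2.1
    have c2 := hu.2.2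
    have c3 := hv.2.1
    have c4 := hv.2.2
    have c1' := dist_comm u p ▸ c1
    have c2' := dist_comm u q ▸ c2
    have c3' := dist_comm v p ▸ c3
    have c4' := dist_comm v q ▸ c4
    have h' := dist_comm u v ▸ h
    intro a ha b hb hab h1 h2
    simp only [Finset.mem_insert, Finset.mem_singleton] at ha hb
    refine ⟨hP a ?_ b ?_ hab, ?_⟩
    · rcases ha with rfl | rfl | rfl | rfl
      exacts [hp, hq, hu.1, hv.1]
    · rcases hb with rfl | rfl | rfl | rfl
      exacts [hp, hq, hu.1, hv.1]
    · rcases ha with rfl | rfl | rfl | rfl <;> rcases hb with rfl | rfl | rfl | rfl <;>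
        first | assumption | (exfalso; tauto)

lemma injective_four {α : Type*} {a b c d : α} (hab : a ≠ b) (hac : a ≠ c) (had : a ≠ d)
    (hbc : b ≠ c) (hbd : b ≠ d) (hcd : c ≠ d) : Function.Injective ![a, b, c, d] := by
  intro i j hij
  fin_cases i <;> fin_cases j <;> first | rfl | (exfalso; simp at hij; tauto)

lemma forall_fin_four {p : Fin 4 → Prop} (h0 : p 0) (h1 : p 1) (h2 : p 2) (h3 : p 3) :
    ∀ i, p i := by
  intro i
  fin_cases i
  exacts [h0, h1, h2, h3]

lemma exists_fin_four {p : Fin 4 → Prop} : (∃ i, p i) ↔ p 0 ∨ p 1 ∨ p 2 ∨ p 3 := by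
  constructor
  · rintro ⟨i, hi⟩
    fin_cases i <;> tauto
  · rintro (h | h | h | h)
    exacts [⟨_, h⟩, ⟨_, h⟩, ⟨_, h⟩, ⟨_, h⟩]

open Classical in
-- The tuple lists the anchors in their cyclic order around the diagonal `p q`; `mem_six_right` does
-- the same around `x y`.
lemma mem_six_left {p q x y z w v : E3} : v ∈ ({p, q, x, y, z, w} : Finset E3) ↔
    v = p ∨ v = q ∨ ∃ i, v = ![x, z, y, w] i := by
  rw [exists_fin_four]
  simp only [Finset.mem_insert, Finset.mem_singleton]
  change _ ↔ _ ∨ _ ∨ v = x ∨ v = z ∨ v = y ∨ v = w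
  tauto

open Classical in
lemma mem_six_right {p q x y z w v : E3} : v ∈ ({p, q, x, y, z, w} : Finset E3) ↔
    v = x ∨ v = y ∨ ∃ i, v = ![p, z, q, w] i := by
  rw [exists_fin_four]
  simp only [Finset.mem_insert, Finset.mem_singleton]
  change _ ↔ _ ∨ _ ∨ v = p ∨ v = z ∨ v = q ∨ v = w
  tauto

/-- Four anchors of a strict diagonal, in cyclic position, form a quartered octahedron with it. -/
lemma isQuarteredOctahedron_of_cycle (hP : IsPacking P) {p q : E3} (hp : p ∈ P) (hq : q ∈ P)
    (hpq : IsStrictDiagonal p q) {u : Fin 4 → E3} (hu : ∀ i, u i ∈ anchors P p q)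
    (hinj : Function.Injective u) (hd : ∀ i, dist (u i) (u (i + 1)) ≤ 2 * t0) {O : Finset E3}
    (hO : ∀ v, v ∈ O ↔ v = p ∨ v = q ∨ ∃ i, v = u i) : IsQuarteredOctahedron p q O := by
  classical
  have hne : ∀ i, u i ≠ p ∧ u i ≠ q := fun i => ne_of_mem_anchors hpq.1 (hu i)
  have hpq' : p ≠ q := by
    rintro rfl
    have := hpq.1
    rw [dist_self] at this
    norm_num [t0] at this
  have hO' : O = insert p (insert q (Finset.univ.image u)) := by
    ext v
    rw [hO]
    simp [eq_comm]
  have hsub : (O : Set E3) ⊆ P := by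
    intro v hv
    rcases (hO v).1 hv with rfl | rfl | ⟨i, rfl⟩
    exacts [hp, hq, (hu i).1]
  have hquart : ∀ i, IsStrictQuarter p q ({p, q, u i, u (i + 1)} : Finset E3) := fun i =>
    isStrictQuarter_insert hP hp hq (hu i) (hu _) (fun h => by
      have := hinj h
      revert this; fin_cases i <;> decide) (hd i) hpq
  have hsubq : ∀ i, (({p, q, u i, u (i + 1)} : Finset E3) : Set E3) ⊆ P := by
    intro i v hv
    simp only [Finset.coe_insert, Finset.coe_singleton, Set.mem_insert_iff,
      Set.mem_singleton_iff] at hv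
    rcases hv with rfl | rfl | rfl | rfl
    exacts [hp, hq, (hu i).1, (hu _).1]
  refine ⟨?_, fun v hv w hw => hP v (hsub hv) w (hsub hw), fun i => {p, q, u i, u (i + 1)}, hquart,
    ?_, ?_⟩
  · rw [hO', Finset.card_insert_of_notMem, Finset.card_insert_of_notMem,
      Finset.card_image_of_injective _ hinj]
    · simp
    · simp [fun i => (hne i).2]
    · simp [fun i => (hne i).1, hpq']
  · intro i j hij
    refine not_overlap_of_same_diagonal hP (hsubq i) (hsubq j) (hquart i) (hquart j) ?_
    intro he
    dsimp only at he
    have h1 : u i ∈ ({p, q, u j, u (j + 1)} : Finset E3) := he ▸ by simp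
    have h2 : u (i + 1) ∈ ({p, q, u j, u (j + 1)} : Finset E3) := he ▸ by simp
    simp only [Finset.mem_insert, Finset.mem_singleton, (hne _).1, (hne _).2, false_or,
      hinj.eq_iff] at h1 h2
    clear he
    revert hij h1 h2
    revert i j
    decide
  · intro v
    rw [hO]
    simp only [Finset.mem_insert, Finset.mem_singleton]
    constructor
    · rintro (h | h | ⟨i, h⟩)
      exacts [⟨0, Or.inl h⟩, ⟨0, Or.inr (Or.inl h)⟩, ⟨i, Or.inr (Or.inr (Or.inl h))⟩]
    · rintro ⟨i, h | h | h | h⟩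
      exacts [Or.inl h, Or.inr (Or.inl h), Or.inr (Or.inr ⟨i, h⟩), Or.inr (Or.inr ⟨_, h⟩)]

/-- With exactly four anchors, an octahedron quartered along `p q` has to consist of `p`, `q` and
these anchors, so the octahedron in `ManyAnchors` is `O` itself. -/
lemma ManyAnchors.choice {c : Finset E3 → E3 × E3} (hP : IsPacking P) {p q : E3}
    (h : ManyAnchors c P p q) (h4 : (anchors P p q).ncard = 4) {O : Finset E3}
    (hO : (O : Set E3) ⊆ P) (hq : IsQuarteredOctahedron p q O) :
    c O = (p, q) ∨ c O = (q, p) := by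
  classical
  obtain ⟨O', hO', hq', hc⟩ := h.2 h4 ⟨O, hO, hq⟩
  suffices O = O' by rwa [this]
  have key : ∀ O : Finset E3, (O : Set E3) ⊆ P → IsQuarteredOctahedron p q O →
      O = insert p (insert q (anchors_finite hP p q).toFinset) := by
    intro O hO hq
    refine Finset.eq_of_subset_of_card_le ?_ ?_
    · intro u hu
      simp only [Finset.mem_insert, Set.Finite.mem_toFinset]
      by_cases h1 : u = p
      · exact Or.inl h1
      by_cases h2 : u = q
      · exact Or.inr (Or.inl h2)
      exact Or.inr (Or.inr (hq.mem_anchors hO hu h1 h2))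
    · rw [Set.ncard_eq_toFinset_card _ (anchors_finite hP p q)] at h4
      have h1 := Finset.card_insert_le p (insert q (anchors_finite hP p q).toFinset)
      have h2 := Finset.card_insert_le q (anchors_finite hP p q).toFinset
      have := hq.1
      omega
  rw [key O hO hq, key O' hO' hq']

/-- The simplices of the Q-system do not overlap. -/
theorem not_overlap_qSystem {c : Finset E3 → E3 × E3} (hc : IsDiagonalChoice c) (hP : IsPacking P)
    {S S' : Finset E3} (hS : S ∈ qSystem c P) (hS' : S' ∈ qSystem c P) (hne : S ≠ S') :
    ¬Overlap S S' := by
  classical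
  have hcand : ∀ S ∈ qSystem c P, IsCandidate P S := by
    rintro S ⟨h1, h | ⟨p, q, h, -⟩ | ⟨p, q, h, -⟩ | ⟨O, -, -, -, h⟩ | ⟨p, -, q, -, -, h, -⟩⟩
    exacts [⟨h1, Or.inl h⟩, ⟨h1, Or.inr ⟨p, q, h⟩⟩, ⟨h1, Or.inr ⟨p, q, h⟩⟩,
      ⟨h1, Or.inr ⟨_, _, h⟩⟩, ⟨h1, Or.inr ⟨p, q, h⟩⟩]
  have key : ∀ {S S' : Finset E3}, S ∈ qSystem c P → S' ∈ qSystem c P → S ≠ S' →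
      Overlap S S' → ¬Pierces P S S' := by
    rintro S S' hS hS' hne ho ⟨p, q, x, y, z, hpq, hx, hy, hz, h, hcr, hxy⟩
    have ho' : Overlap S' S := by rwa [Overlap, Set.inter_comm]
    have hlong := hpq.2.2.2.1.1
    have hr := rules_of_overlap hc hP hS hpq (hcand S' hS') hne.symm ho
    obtain ⟨a1, a2, a3, a4⟩ := h.px_py_qx_qy hP hcr
    have hxa : x ∈ anchors P p q := ⟨h.mem_x, by rwa [dist_comm], by rwa [dist_comm]⟩
    have hya : y ∈ anchors P p q := ⟨h.mem_y, by rwa [dist_comm], by rwa [dist_comm]⟩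
    rcases hxy with hxy | hxy
    -- If `x y` is short, all anchors of `p q` are among `x, y, z`. That is too few for
    -- `ManyAnchors`, and an interior position would need a strict diagonal between two of these
    -- points.
    · have hsub := anchors_subset_of_short hP h hcr hlong hxy
      rcases hr with hr | ⟨v₂, v₄, v₅, hi⟩
      · have h1 := Set.ncard_le_ncard hsub (Set.toFinite _)
        have h2 := ncard_triple_le x y z
        have := hr.1
        omega
      · obtain ⟨-, h2, h3, -, -, -⟩ := hi
        have m4 : v₄ ∈ ({x, y, z} : Set E3) := hsub (h2 ▸ by simp)
        have m5 : v₅ ∈ ({x, y, z} : Set E3) := hsub (h2 ▸ by simp)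
        have l := h3.1
        have t : 0 < t0 := by norm_num [t0]
        have b1 := h.xz_le
        have b2 := h.yz_le
        rcases m4 with rfl | rfl | rfl <;> rcases m5 with rfl | rfl | rfl <;>
          first
          | linarith
          | (rw [dist_comm] at l; linarith)
          | (rw [dist_self] at l; linarith)
    · have hlong' := hxy.2.2.2.1.1
      have hr' := rules_of_overlap hc hP hS' hxy (hcand S hS) hne ho'
      have hr' : ManyAnchors c P x y := hr'.resolve_right fun ⟨v₂, v₄, v₅, hi⟩ =>
        not_interiorPosition_of_crosses hP h hcr hlong hi
      -- In an interior position of `p q` the anchors `x` and `y`, being more than `2 * t0` apart,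
      -- would be `v₄` and `v₅`, and their diagonal would have three anchors instead of at least
      -- four.
      have hr : ManyAnchors c P p q := by
        refine hr.resolve_right fun ⟨v₂, v₄, v₅, hi⟩ => ?_
        obtain ⟨-, h2, h3, h4, h5, -⟩ := hi
        have hv2 : v₂ ∈ anchors P v₄ v₅ := by rw [h5]; simp
        have e1 := hv2.2.1
        have e2 := hv2.2.2
        have e1' := dist_comm v₂ v₄ ▸ e1
        have e2' := dist_comm v₂ v₅ ▸ e2
        have t : 0 < t0 := by norm_num [t0]
        have hfour := hr'.1
        rw [h2] at hxa hya
        rcases hxa with rfl | rfl | rfl <;> rcases hya with rfl | rfl | rfl <;>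
          first
          | linarith
          | (rw [dist_self] at hlong'; linarith)
          | omega
          | (rw [anchors_swap] at hfour; omega)
      -- Each diagonal has exactly four anchors: those of `p q` are `x, y, z, w`, those of `x y` are
      -- `p, q, z, w`. The six points are an octahedron quartered along both diagonals, of which `c`
      -- selects only one.
      obtain ⟨w, k1, k2, hwz, heq, h4⟩ := exists_fourth_anchor hP h hcr hlong hr.1
      have hw : w ∈ anchors P p q := heq ▸ by simp
      have hza : z ∈ anchors P p q := heq ▸ by simp
      obtain ⟨w', l1, l2, hwz', heq', h4'⟩ := exists_fourth_anchor hP k1 k2 hlong' hr'.1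
      have hz' : z ∈ anchors P x y :=
        ⟨h.mem_z, by rw [dist_comm]; exact h.xz_le, by rw [dist_comm]; exact h.yz_le⟩
      have hzw : z = w' := by
        rw [heq'] at hz'
        rcases hz' with hh | hh | hh | hh
        exacts [absurd hh h.pz.symm, absurd hh h.qz.symm, absurd hh hwz.symm, hh]
      subst hzw
      have hw' : w ∈ anchors P x y := heq' ▸ by simp
      have hz'' : z ∈ anchors P x y := heq' ▸ by simp
      have hpa : p ∈ anchors P x y := ⟨h.mem_p, a1, a2⟩
      have hqa : q ∈ anchors P x y := ⟨h.mem_q, a3, a4⟩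
      have hO1 : IsQuarteredOctahedron p q {p, q, x, y, z, w} := by
        refine isQuarteredOctahedron_of_cycle hP h.mem_p h.mem_q hpq.2.2.2.1
          (u := ![x, z, y, w]) ?_ ?_ ?_ ?_
        · exact forall_fin_four hxa hza hya hw
        · exact injective_four h.xz h.xy k1.pz h.yz.symm hwz.symm k1.qz
        · exact forall_fin_four h.xz_le ((dist_comm z y).trans_le h.yz_le)
            ((dist_comm y w).trans_le hw'.2.2) hw'.2.1
        · exact fun v => mem_six_left
      have hO2 : IsQuarteredOctahedron x y {p, q, x, y, z, w} := by
        refine isQuarteredOctahedron_of_cycle hP h.mem_x h.mem_y hxy.2.2.2.1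
          (u := ![p, z, q, w]) ?_ ?_ ?_ ?_
        · exact forall_fin_four hpa hz'' hqa hw'
        · exact injective_four h.pz h.pq (ne_of_mem_anchors hlong hw).1.symm h.qz.symm hwz.symm
            (ne_of_mem_anchors hlong hw).2.symm
        · exact forall_fin_four ((dist_comm p z).trans_le hza.2.1) hza.2.2
            ((dist_comm q w).trans_le hw.2.2) hw.2.1
        · exact fun v => mem_six_right
      have hOP : (({p, q, x, y, z, w} : Finset E3) : Set E3) ⊆ P := by
        intro v hv
        simp only [Finset.coe_insert, Finset.coe_singleton, Set.mem_insert_iff,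
          Set.mem_singleton_iff] at hv
        rcases hv with rfl | rfl | rfl | rfl | rfl | rfl
        exacts [h.mem_p, h.mem_q, h.mem_x, h.mem_y, h.mem_z, hw.1]
      have c1 := hr.choice hP h4 hOP hO1
      have c2 := hr'.choice hP h4' hOP hO2
      have d1 := h.px
      have d2 := h.py
      have d3 := h.qx
      rcases c1 with c1 | c1 <;> rw [c1] at c2 <;> simp only [Prod.mk.injEq] at c2
      · exact c2.elim (fun hh => d1 hh.1) fun hh => d2 hh.1
      · exact c2.elim (fun hh => d3 hh.1) fun hh => h.qy hh.1
  intro ho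
  rcases pierces_of_overlap hP (hcand S hS) (hcand S' hS') hne ho with h | h
  · exact key hS hS' hne ho h
  · exact key hS' hS hne.symm (by rwa [Overlap, Set.inter_comm]) h

end Kepler

/-! ### Volumes of the cross-polytope and of a simplex -/

namespace Kepler

lemma det3_eq (x y z : E3) : det3 x y z = x 0 * (y 1 * z 2 - y 2 * z 1) -
    x 1 * (y 0 * z 2 - y 2 * z 0) + x 2 * (y 0 * z 1 - y 1 * z 0) := by
  simp [det3, Matrix.det_fin_three]; ring

/-- The linear map that sends the standard basis to `u, v, w`. -/
def frameMap (u v w : E3) : E3 →ₗ[ℝ] E3 where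
  toFun x := x 0 • u + x 1 • v + x 2 • w
  map_add' x y := by simp only [PiLp.add_apply]; module
  map_smul' c x := by simp only [PiLp.smul_apply, smul_eq_mul, RingHom.id_apply]; module

lemma frameMap_apply (u v w x : E3) : frameMap u v w x = x 0 • u + x 1 • v + x 2 • w := rfl

lemma det_frameMap (u v w : E3) : LinearMap.det (frameMap u v w) = det3 u v w := by
  rw [← LinearMap.det_toMatrix (EuclideanSpace.basisFun (Fin 3) ℝ).toBasis, det3,
    ← Matrix.det_transpose]
  congr 1
  ext i j
  rw [Matrix.transpose_apply, LinearMap.toMatrix_apply]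
  fin_cases i <;> simp [frameMap_apply]

/-- This set is the ball of radius `r` of the `ℓ¹` norm, with volume `(2 * Γ(2) * r) ^ 3 / Γ(4)`. -/
lemma volume_crossPolytope {r : ℝ} (hr : 0 ≤ r) :
    volume.real {x : E3 | |x 0| + |x 1| + |x 2| ≤ r} = 4 / 3 * r ^ 3 := by
  have h := volume_sum_rpow_le (ι := Fin 3) (p := 1) le_rfl r
  have hm : MeasurableSet {x : Fin 3 → ℝ | (∑ i, |x i| ^ (1 : ℝ)) ^ (1 / (1 : ℝ)) ≤ r} := by
    simp only [Real.rpow_one, div_one]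
    exact measurableSet_le (by fun_prop) (by fun_prop)
  rw [← (PiLp.volume_preserving_ofLp (Fin 3)).measure_preimage hm.nullMeasurableSet] at h
  have he : {x : E3 | |x 0| + |x 1| + |x 2| ≤ r} =
      @WithLp.ofLp 2 (Fin 3 → ℝ) ⁻¹' {x | (∑ i, |x i| ^ (1 : ℝ)) ^ (1 / (1 : ℝ)) ≤ r} := by
    ext x
    simp [Fin.sum_univ_three]
  rw [he, measureReal_def, h]
  have h2 : Real.Gamma (1 / 1 + 1) = 1 := by norm_num [Real.Gamma_two]
  have h4 : Real.Gamma ((Fintype.card (Fin 3) : ℝ) / 1 + 1) = 6 := by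
    rw [Fintype.card_fin, div_one, Real.Gamma_nat_eq_factorial]
    norm_num [Nat.factorial]
  rw [h2, h4, ENNReal.toReal_mul, ENNReal.toReal_pow, ENNReal.toReal_ofReal hr,
    ENNReal.toReal_ofReal (by positivity), Fintype.card_fin]
  ring

lemma volume_linear_zero (f : E3 →ₗ[ℝ] ℝ) (h : ∃ x, f x ≠ 0) : volume {x | f x = 0} = 0 := by
  obtain ⟨x, hx⟩ := h
  have h1 : {x | f x = 0} = (LinearMap.ker f : Set E3) := by ext; simp
  rw [h1]
  refine Measure.addHaar_submodule _ _ fun ht => hx ?_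
  rw [← LinearMap.mem_ker, ht]
  trivial

lemma volume_zero_coord (i : Fin 3) : volume {x : E3 | x i = 0} = 0 :=
  volume_linear_zero (EuclideanSpace.proj i : E3 →L[ℝ] ℝ).toLinearMap
    ⟨EuclideanSpace.single i 1, by simp⟩

/-- The reflection in the `i`-th coordinate exchanges the two halves, which share only a null set.
-/
lemma volume_half {A : Set E3} (hA : MeasurableSet A) (hfin : volume A ≠ ⊤) (i : Fin 3)
    (hs : ∀ x y : E3, y i = -x i → (∀ j, j ≠ i → y j = x j) → x ∈ A → y ∈ A) :
    volume.real (A ∩ {x | 0 ≤ x i}) = volume.real A / 2 := by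
  have hmi : Measurable fun x : E3 => x i := by fun_prop
  have hm : MeasurableSet {x : E3 | 0 ≤ x i} := measurableSet_le (by fun_prop) (by fun_prop)
  set ρ : E3 ≃ₗᵢ[ℝ] E3 := LinearIsometryEquiv.piLpCongrRight 2 fun j : Fin 3 =>
    if j = i then LinearIsometryEquiv.neg ℝ else LinearIsometryEquiv.refl ℝ ℝ with hρ
  have h1 : ∀ x, ρ x i = -x i := fun x => by simp [hρ]
  have h2 : ∀ x j, j ≠ i → ρ x j = x j := fun x j hj => by simp [hρ, hj]
  have hpre : ρ ⁻¹' (A ∩ {x | 0 ≤ x i}) = A ∩ {x | x i ≤ 0} := by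
    ext x
    simp only [Set.mem_preimage, Set.mem_inter_iff, Set.mem_ofPred_eq, h1]
    refine and_congr ⟨fun h => hs (ρ x) x (by rw [h1, neg_neg]) (fun j hj => (h2 x j hj).symm) h,
      fun h => hs x (ρ x) (h1 x) (h2 x) h⟩ ?_
    constructor <;> intro h <;> linarith
  have h3 : volume (A ∩ {x | x i ≤ 0}) = volume (A ∩ {x | 0 ≤ x i}) := by
    rw [← hpre]
    exact ρ.measurePreserving.measure_preimage (hA.inter hm).nullMeasurableSet
  have h4 : volume (A ∩ {x | x i ≤ 0}) = volume (A \ {x | 0 ≤ x i}) := by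
    refine measure_congr ?_
    have : ∀ᵐ x : E3, x i ≠ 0 := by
      rw [ae_iff]; simpa using volume_zero_coord i
    filter_upwards [this] with x hx
    refine propext (and_congr Iff.rfl ?_)
    change x i ≤ 0 ↔ ¬ 0 ≤ x i
    rw [not_le]
    exact ⟨fun h => lt_of_le_of_ne h hx, le_of_lt⟩
  have h5 := measure_inter_add_sdiff (μ := volume) A hm
  rw [← h4, h3] at h5
  have h6 := congrArg ENNReal.toReal h5
  rw [ENNReal.toReal_add (measure_ne_top_of_subset Set.inter_subset_left hfin)
    (measure_ne_top_of_subset Set.inter_subset_left hfin)] at h6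
  rw [measureReal_def, measureReal_def, ← h6]
  ring

/-- Halving the unit cross-polytope, of volume `4 / 3`, along the three coordinate planes leaves
this simplex. -/
lemma volume_cornerSimplex :
    volume.real {x : E3 | 0 ≤ x 0 ∧ 0 ≤ x 1 ∧ 0 ≤ x 2 ∧ x 0 + x 1 + x 2 ≤ 1} = 1 / 6 := by
  set A : Set E3 := {x | |x 0| + |x 1| + |x 2| ≤ 1} with hA
  have hm : MeasurableSet A := measurableSet_le (by fun_prop) (by fun_prop)
  have hfin : volume A ≠ ⊤ := by
    intro h
    have := volume_crossPolytope zero_le_one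
    rw [measureReal_def, h] at this
    norm_num at this
  have hc : ∀ i : Fin 3, MeasurableSet {x : E3 | 0 ≤ x i} := fun i =>
    measurableSet_le (by fun_prop) (by fun_prop)
  have e0 := volume_half hm hfin 0 (fun x y h1 h2 hx => by
    simp only [hA, Set.mem_ofPred_eq] at hx ⊢
    rw [h1, h2 1 (by decide), h2 2 (by decide), abs_neg]; exact hx)
  have f0 := measure_ne_top_of_subset (Set.inter_subset_left (s := A) (t := {x | 0 ≤ x 0})) hfin
  have e1 := volume_half (hm.inter (hc 0)) f0 1 (fun x y h1 h2 hx => by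
    simp only [hA, Set.mem_inter_iff, Set.mem_ofPred_eq] at hx ⊢
    rw [h1, h2 0 (by decide), h2 2 (by decide), abs_neg]; exact hx)
  have e2 := volume_half ((hm.inter (hc 0)).inter (hc 1))
    (measure_ne_top_of_subset Set.inter_subset_left f0) 2 (fun x y h1 h2 hx => by
    simp only [hA, Set.mem_inter_iff, Set.mem_ofPred_eq] at hx ⊢
    rw [h1, h2 0 (by decide), h2 1 (by decide), abs_neg]; exact hx)
  have he : {x : E3 | 0 ≤ x 0 ∧ 0 ≤ x 1 ∧ 0 ≤ x 2 ∧ x 0 + x 1 + x 2 ≤ 1} =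
      A ∩ {x | 0 ≤ x 0} ∩ {x | 0 ≤ x 1} ∩ {x | 0 ≤ x 2} := by
    ext x
    simp only [hA, Set.mem_inter_iff, Set.mem_ofPred_eq]
    constructor
    · rintro ⟨h0, h1, h2, h3⟩
      exact ⟨⟨⟨by rwa [abs_of_nonneg h0, abs_of_nonneg h1, abs_of_nonneg h2], h0⟩, h1⟩, h2⟩
    · rintro ⟨⟨⟨h3, h0⟩, h1⟩, h2⟩
      rw [abs_of_nonneg h0, abs_of_nonneg h1, abs_of_nonneg h2] at h3
      exact ⟨h0, h1, h2, h3⟩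
  rw [he, e2, e1, e0, hA, volume_crossPolytope zero_le_one]
  norm_num

lemma mem_convexHull_four {a b c d u : E3} : u ∈ convexHull ℝ ({a, b, c, d} : Set E3) ↔
    ∃ α β γ δ : ℝ, 0 ≤ α ∧ 0 ≤ β ∧ 0 ≤ γ ∧ 0 ≤ δ ∧ α + β + γ + δ = 1 ∧
      α • a + β • b + γ • c + δ • d = u := by
  rw [convexHull_insert (by simp)]
  simp only [convexJoin_singleton_left, Set.mem_iUnion, exists_prop]
  constructor
  · rintro ⟨y, hy, s, t, hs, ht, hst, rfl⟩
    obtain ⟨β, γ, δ, h1, h2, h3, h4, rfl⟩ := mem_convexHull_triple.1 hy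
    refine ⟨s, t * β, t * γ, t * δ, hs, by positivity, by positivity, by positivity, ?_, by module⟩
    linear_combination hst + t * h4
  · rintro ⟨α, β, γ, δ, h0, h1, h2, h3, h4, rfl⟩
    rcases eq_or_ne α 1 with rfl | hα
    · refine ⟨b, subset_convexHull ℝ _ (by simp), 1, 0, by simp, by simp, by simp, ?_⟩
      have e1 : β = 0 := by linarith
      have e2 : γ = 0 := by linarith
      have e3 : δ = 0 := by linarith
      rw [e1, e2, e3]; simp
    have hpos : 0 < 1 - α := by
      have : α ≤ 1 := by linarith
      rcases this.lt_or_eq with h | h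
      · linarith
      · exact absurd h hα
    refine ⟨(β / (1 - α)) • b + (γ / (1 - α)) • c + (δ / (1 - α)) • d,
      mem_convexHull_triple.2 ⟨_, _, _, by positivity, by positivity, by positivity, ?_, rfl⟩,
      α, 1 - α, h0, hpos.le, by ring, ?_⟩
    · field_simp; linarith
    · rw [smul_add, smul_add, smul_smul, smul_smul, smul_smul, mul_div_cancel₀ _ hpos.ne',
        mul_div_cancel₀ _ hpos.ne', mul_div_cancel₀ _ hpos.ne']
      abel

lemma convexHull_four_eq_image (a b c d : E3) : convexHull ℝ ({a, b, c, d} : Set E3) =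
    (fun x => a + frameMap (b - a) (c - a) (d - a) x) ''
      {x : E3 | 0 ≤ x 0 ∧ 0 ≤ x 1 ∧ 0 ≤ x 2 ∧ x 0 + x 1 + x 2 ≤ 1} := by
  ext u
  rw [mem_convexHull_four]
  constructor
  · rintro ⟨α, β, γ, δ, h0, h1, h2, h3, h4, rfl⟩
    refine ⟨!₂[β, γ, δ], ⟨by simpa, by simpa, by simpa, by simp; linarith⟩, ?_⟩
    simp only [frameMap_apply]
    have : α = 1 - β - γ - δ := by linarith
    rw [this]
    simp
    module
  · rintro ⟨x, ⟨h1, h2, h3, h4⟩, rfl⟩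
    refine ⟨1 - x 0 - x 1 - x 2, x 0, x 1, x 2, by linarith, h1, h2, h3, by ring, ?_⟩
    simp only [frameMap_apply]
    module

lemma volume_convexHull_four (a b c d : E3) :
    volume.real (convexHull ℝ ({a, b, c, d} : Set E3)) = |det3 (b - a) (c - a) (d - a)| / 6 := by
  rw [convexHull_four_eq_image, ← Set.image_image (fun x => a + x) (frameMap _ _ _), Set.image_add_left,
    measureReal_def, measure_preimage_add, Measure.addHaar_image_linearMap, det_frameMap,
    ENNReal.toReal_mul, ENNReal.toReal_ofReal (abs_nonneg _), ← measureReal_def,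
    volume_cornerSimplex]
  ring

end Kepler

/-! ### The relation between the two densities -/

namespace Kepler

/-- Open unit balls at mutual distance at least two between centers are disjoint, and the spheres
are null sets. -/
lemma volume_hull_inter_eq_sum {ι : Type*} [Fintype ι] {v : ι → E3}
    (hv : ∀ i j, i ≠ j → 2 ≤ dist (v i) (v j)) :
    volume.real (convexHull ℝ (Set.range v) ∩ {x | ∃ u ∈ Set.range v, dist x u ≤ 1}) =
      ∑ i, volume.real (convexHull ℝ (Set.range v) ∩ Metric.ball (v i) 1) := by
  classical
  have hm : MeasurableSet (convexHull ℝ (Set.range v)) :=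
    ((Set.finite_range v).isCompact_convexHull (𝕜 := ℝ)).measurableSet
  have h1 : volume.real (convexHull ℝ (Set.range v) ∩ {x | ∃ u ∈ Set.range v, dist x u ≤ 1}) =
      volume.real (⋃ i ∈ Finset.univ, convexHull ℝ (Set.range v) ∩ Metric.ball (v i) 1) := by
    refine measureReal_congr ?_
    have : ∀ᵐ x, ∀ i, dist x (v i) ≠ 1 := by
      rw [ae_all_iff]
      intro i
      rw [ae_iff]
      simpa [Metric.sphere] using Measure.addHaar_sphere (volume : Measure E3) (v i) 1
    filter_upwards [this] with x hx
    refine propext ?_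
    change (x ∈ (convexHull ℝ (Set.range v) ∩ {x | ∃ u ∈ Set.range v, dist x u ≤ 1} : Set E3)) ↔
      (x ∈ (⋃ i ∈ Finset.univ, convexHull ℝ (Set.range v) ∩ Metric.ball (v i) 1 : Set E3))
    simp only [Set.mem_inter_iff, Set.mem_ofPred_eq, Set.mem_iUnion, Metric.mem_ball, exists_prop,
      Finset.mem_univ, true_and, Set.exists_range_iff]
    constructor
    · rintro ⟨h, i, hd⟩
      exact ⟨i, h, lt_of_le_of_ne hd (hx i)⟩
    · rintro ⟨i, h, hd⟩
      exact ⟨h, i, hd.le⟩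
  rw [h1]
  refine measureReal_biUnion_finset (fun i _ j _ hij => ?_)
    (fun i _ => hm.inter measurableSet_ball) (fun i _ => ?_)
  · exact (Metric.ball_disjoint_ball (by linarith [hv i j hij])).mono Set.inter_subset_right
      Set.inter_subset_right
  · exact measure_ne_top_of_subset Set.inter_subset_right measure_ball_lt_top.ne

/-- The four linear forms that define the faces of a regular tetrahedron. -/
def faceForm (i : Fin 4) (x : E3) : ℝ :=
  ![x 0 + x 1 + x 2, x 0 - x 1 - x 2, -x 0 + x 1 - x 2, -x 0 - x 1 + x 2] i

lemma faceForm_neg (i : Fin 4) (x : E3) : faceForm i (-x) = -faceForm i x := by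
  fin_cases i <;> simp [faceForm] <;> ring

lemma faceForm_sum (x : E3) : faceForm 0 x + faceForm 1 x + faceForm 2 x + faceForm 3 x = 0 := by
  simp [faceForm]; ring

lemma volume_faceForm_zero (i : Fin 4) : volume {x : E3 | faceForm i x = 0} = 0 := by
  let f : E3 →ₗ[ℝ] ℝ :=
    { toFun := faceForm i
      map_add' := fun x y => by fin_cases i <;> simp [faceForm] <;> ring
      map_smul' := fun r x => by fin_cases i <;> simp [faceForm] <;> ring }
  refine volume_linear_zero f ⟨!₂[1, 3, 5], ?_⟩
  change faceForm i _ ≠ 0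
  fin_cases i
  · change (1 + 3 + 5 : ℝ) ≠ 0; norm_num
  · change (1 - 3 - 5 : ℝ) ≠ 0; norm_num
  · change (-1 + 3 - 5 : ℝ) ≠ 0; norm_num
  · change (-1 - 3 + 5 : ℝ) ≠ 0; norm_num

/-- The part of the unit ball where the forms with index in `s` are nonnegative and the other ones
are nonpositive. -/
def signCell (s : Finset (Fin 4)) : Set E3 :=
  {x | x ∈ Metric.ball 0 1 ∧ (∀ i ∈ s, 0 ≤ faceForm i x) ∧ ∀ i ∉ s, faceForm i x ≤ 0}

lemma measurable_faceForm (i : Fin 4) : Measurable (faceForm i) := by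
  fin_cases i
  · exact (by fun_prop : Measurable fun x : E3 => x 0 + x 1 + x 2)
  · exact (by fun_prop : Measurable fun x : E3 => x 0 - x 1 - x 2)
  · exact (by fun_prop : Measurable fun x : E3 => -x 0 + x 1 - x 2)
  · exact (by fun_prop : Measurable fun x : E3 => -x 0 - x 1 + x 2)

lemma ae_faceForm_ne : ∀ᵐ x : E3, ∀ i, faceForm i x ≠ 0 := by
  rw [ae_all_iff]
  intro i
  rw [ae_iff]
  simpa using volume_faceForm_zero i

open Classical in
-- Off the four planes each point of the unit ball has exactly one pattern of signs, so the cells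
-- partition the ball up to a null set.
lemma sum_volume_signCell : ∑ s, volume.real (signCell s) = 4 / 3 * Real.pi := by
  set D : Finset (Fin 4) → Set E3 := fun s =>
    {x | x ∈ Metric.ball 0 1 ∧ ∀ i, i ∈ s ↔ 0 < faceForm i x} with hD
  have h1 : ∀ s, volume.real (signCell s) = volume.real (D s) := fun s => by
    refine measureReal_congr ?_
    filter_upwards [ae_faceForm_ne] with x hx
    refine propext ?_
    change (_ ∧ _ ∧ _) ↔ (_ ∧ _)
    refine and_congr_right fun _ => ⟨fun h i => ⟨fun hi => lt_of_le_of_ne (h.1 i hi) (hx i).symm,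
      fun hi => ?_⟩, fun h => ⟨fun i hi => ((h i).1 hi).le, fun i hi => ?_⟩⟩
    · by_contra hc
      linarith [h.2 i hc]
    · by_contra! hc
      exact hi ((h i).2 hc)
  simp only [h1]
  have hm : ∀ s, MeasurableSet (D s) := fun s => by
    have : D s = Metric.ball 0 1 ∩ ⋂ i, {x | i ∈ s ↔ 0 < faceForm i x} := by
      ext x; simp [hD]
    rw [this]
    refine measurableSet_ball.inter (MeasurableSet.iInter fun i => ?_)
    have hi : MeasurableSet {x | 0 < faceForm i x} :=
      measurableSet_lt measurable_const (measurable_faceForm i)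
    by_cases h : i ∈ s
    · simpa [h] using hi
    · simp only [h, false_iff]
      exact hi.compl
  rw [← measureReal_biUnion_finset (s := Finset.univ) (fun s _ s' _ hne => ?_) (fun s _ => hm s)
    (fun s _ => measure_ne_top_of_subset (fun x hx => hx.1) measure_ball_lt_top.ne)]
  · have : (⋃ s ∈ (Finset.univ : Finset (Finset (Fin 4))), D s) = Metric.ball 0 1 := by
      ext x
      simp only [Set.mem_iUnion, Finset.mem_univ, exists_prop, true_and]
      exact ⟨fun ⟨s, hs⟩ => hs.1, fun hx => ⟨Finset.univ.filter fun i => 0 < faceForm i x, hx,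
        fun i => by simp⟩⟩
    rw [this, measureReal_def, EuclideanSpace.volume_ball_fin_three]
    rw [ENNReal.ofReal_one, one_pow, one_mul, ENNReal.toReal_ofReal (by positivity)]
    ring
  · rw [Function.onFun, Set.disjoint_left]
    intro x hx hx'
    refine hne ?_
    ext i
    rw [hx.2 i, hx'.2 i]

lemma volume_signCell_compl (s : Finset (Fin 4)) :
    volume.real (signCell sᶜ) = volume.real (signCell s) := by
  have : signCell sᶜ = Neg.neg ⁻¹' signCell s := by
    ext x
    simp only [signCell, Set.mem_preimage, Set.mem_ofPred_eq, faceForm_neg, Finset.mem_compl,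
      not_not, mem_ball_zero_iff, norm_neg, Left.nonneg_neg_iff, Left.neg_nonpos_iff]
    tauto
  rw [this, measureReal_def, measureReal_def]
  congr 1
  exact Measure.measure_preimage_neg _ _

/-- The four forms sum to zero, so they are all nonnegative only where they all vanish. -/
lemma volume_signCell_univ : volume.real (signCell Finset.univ) = 0 := by
  have : volume (signCell Finset.univ) = 0 := by
    refine measure_mono_null ?_ (volume_faceForm_zero 0)
    rintro x ⟨-, h, -⟩
    have := faceForm_sum x
    have h0 := h 0 (by simp)
    have h1 := h 1 (by simp)
    have h2 := h 2 (by simp)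
    have h3 := h 3 (by simp)
    change faceForm 0 x = 0
    linarith
  rw [measureReal_def, this, ENNReal.toReal_zero]

/-- For a polytope `A` with vertex `v`, the set `K` is the part of its tangent cone in the unit
ball. -/
lemma volume_translate {A K : Set E3} (v : E3) (h : ∀ y ∈ Metric.ball (0 : E3) 1, v + y ∈ A ↔ y ∈ K)
    (hK : K ⊆ Metric.ball 0 1) : volume.real (A ∩ Metric.ball v 1) = volume.real K := by
  have : K = (fun y => v + y) ⁻¹' (A ∩ Metric.ball v 1) := by
    ext y
    simp only [Set.mem_preimage, Set.mem_inter_iff, Metric.mem_ball, dist_self_add_left]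
    constructor
    · intro hy
      have := hK hy
      exact ⟨(h y this).2 hy, by simpa using this⟩
    · rintro ⟨h1, h2⟩
      exact (h y (by simpa using h2)).1 h1
  rw [this, measureReal_def, measureReal_def, measure_preimage_add]

/-- The barycentric coordinates of `x` are `(√2 * faceForm i x + 1) / 4`. -/
lemma mem_regularTetrahedron_hull {x : E3} : x ∈ convexHull ℝ regularTetrahedron ↔
    ∀ i, -1 ≤ √2 * faceForm i x := by
  have h2 : √2 * √2 = 2 := Real.mul_self_sqrt (by norm_num)
  have h0 : (√2)⁻¹ = √2 / 2 := by field_simp; linarith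
  rw [regularTetrahedron, Set.image_insert_eq, Set.image_insert_eq, Set.image_insert_eq,
    Set.image_singleton, mem_convexHull_four, h0]
  constructor
  · rintro ⟨α, β, γ, δ, a0, b0, c0, d0, hs, rfl⟩
    refine forall_fin_four ?_ ?_ ?_ ?_
    · have : √2 * faceForm 0 (α • (√2 / 2) • !₂[1, 1, 1] + β • (√2 / 2) • !₂[1, -1, -1] +
        γ • (√2 / 2) • !₂[-1, 1, -1] + δ • (√2 / 2) • !₂[-1, -1, 1]) = 4 * α - 1 := by
        simp [faceForm]
        linear_combination (3 * α - β - γ - δ) / 2 * h2 - hs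
      linarith
    · have : √2 * faceForm 1 (α • (√2 / 2) • !₂[1, 1, 1] + β • (√2 / 2) • !₂[1, -1, -1] +
        γ • (√2 / 2) • !₂[-1, 1, -1] + δ • (√2 / 2) • !₂[-1, -1, 1]) = 4 * β - 1 := by
        simp [faceForm]
        linear_combination (-α + 3 * β - γ - δ) / 2 * h2 - hs
      linarith
    · have : √2 * faceForm 2 (α • (√2 / 2) • !₂[1, 1, 1] + β • (√2 / 2) • !₂[1, -1, -1] +
        γ • (√2 / 2) • !₂[-1, 1, -1] + δ • (√2 / 2) • !₂[-1, -1, 1]) = 4 * γ - 1 := by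
        simp [faceForm]
        linear_combination (-α - β + 3 * γ - δ) / 2 * h2 - hs
      linarith
    · have : √2 * faceForm 3 (α • (√2 / 2) • !₂[1, 1, 1] + β • (√2 / 2) • !₂[1, -1, -1] +
        γ • (√2 / 2) • !₂[-1, 1, -1] + δ • (√2 / 2) • !₂[-1, -1, 1]) = 4 * δ - 1 := by
        simp [faceForm]
        linear_combination (-α - β - γ + 3 * δ) / 2 * h2 - hs
      linarith
  · intro h
    have hsum := faceForm_sum x
    refine ⟨(√2 * faceForm 0 x + 1) / 4, (√2 * faceForm 1 x + 1) / 4, (√2 * faceForm 2 x + 1) / 4,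
      (√2 * faceForm 3 x + 1) / 4, by linarith [h 0], by linarith [h 1], by linarith [h 2],
      by linarith [h 3], by linear_combination √2 / 4 * hsum, ?_⟩
    ext i
    fin_cases i
    · simp [faceForm]; linear_combination x 0 / 2 * h2
    · simp [faceForm]; linear_combination x 1 / 2 * h2
    · simp [faceForm]; linear_combination x 2 / 2 * h2

/-- The vertices satisfy the convex condition on the right. Conversely, `x` is a convex combination
of the origin and the three vertices `±√2 e_i` with the signs of its coordinates. -/
lemma mem_regularOctahedron_hull {x : E3} : x ∈ convexHull ℝ regularOctahedron ↔
    |x 0| + |x 1| + |x 2| ≤ √2 := by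
  have h2 : 0 < √2 := by positivity
  constructor
  · intro h
    refine convexHull_min (s := regularOctahedron) (t := {x : E3 | |x 0| + |x 1| + |x 2| ≤ √2})
      ?_ ?_ h
    · rintro _ ⟨u, hu, rfl⟩
      simp only [Set.mem_insert_iff, Set.mem_singleton_iff] at hu
      rcases hu with rfl | rfl | rfl | rfl | rfl | rfl <;> simp [abs_of_pos h2]
    · intro u hu v hv a b ha hb hab
      simp only [Set.mem_ofPred_eq, PiLp.add_apply, PiLp.smul_apply, smul_eq_mul] at hu hv ⊢
      have key : ∀ i : Fin 3, |a * u i + b * v i| ≤ a * |u i| + b * |v i| := fun i => by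
        refine (abs_add_le _ _).trans ?_
        rw [abs_mul, abs_mul, abs_of_nonneg ha, abs_of_nonneg hb]
      have k0 := key 0
      have k1 := key 1
      have k2 := key 2
      have : a * (|u 0| + |u 1| + |u 2|) + b * (|v 0| + |v 1| + |v 2|) ≤ a * √2 + b * √2 := by gcongr
      have e : a * √2 + b * √2 = √2 := by rw [← add_mul, hab, one_mul]
      linarith
  · intro h
    have hv : ∀ i : Fin 3, ∃ u ∈ regularOctahedron, (|x i| / √2) • u = x i • EuclideanSpace.single i (1 : ℝ) := by
      intro i
      rcases le_total 0 (x i) with hi | hi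
      · refine ⟨√2 • EuclideanSpace.single i 1, ⟨EuclideanSpace.single i 1, ?_, rfl⟩, ?_⟩
        · fin_cases i
          · left; ext j; fin_cases j <;> simp
          · right; right; left; ext j; fin_cases j <;> simp
          · right; right; right; right; left; ext j; fin_cases j <;> simp
        · rw [smul_smul, abs_of_nonneg hi, div_mul_cancel₀ _ h2.ne']
      · refine ⟨√2 • (-EuclideanSpace.single i 1), ⟨-EuclideanSpace.single i 1, ?_, rfl⟩, ?_⟩
        · fin_cases i
          · right; left; ext j; fin_cases j <;> simp
          · right; right; right; left; ext j; fin_cases j <;> simp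
          · right; right; right; right; right; ext j; fin_cases j <;> simp
        · rw [smul_smul, abs_of_nonpos hi, div_mul_cancel₀ _ h2.ne', smul_neg, neg_smul, neg_neg]
    obtain ⟨u, hu, hu'⟩ := hv 0
    obtain ⟨v, hv', hv''⟩ := hv 1
    obtain ⟨w, hw, hw'⟩ := hv 2
    have hconv := convex_convexHull ℝ regularOctahedron
    have hzero : (0 : E3) ∈ convexHull ℝ regularOctahedron := by
      have := hconv (subset_convexHull ℝ _ ⟨!₂[1, 0, 0], by simp, rfl⟩)
        (subset_convexHull ℝ _ ⟨!₂[-1, 0, 0], by simp, rfl⟩) (a := 1 / 2) (b := 1 / 2)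
        (by norm_num) (by norm_num) (by norm_num)
      convert this using 1
      ext j; fin_cases j <;> simp
    have hsub : convexHull ℝ ({u, v, w, 0} : Set E3) ⊆ convexHull ℝ regularOctahedron := by
      refine convexHull_min ?_ hconv
      rintro y (rfl | rfl | rfl | rfl)
      exacts [subset_convexHull ℝ _ hu, subset_convexHull ℝ _ hv', subset_convexHull ℝ _ hw, hzero]
    refine hsub (mem_convexHull_four.2 ⟨|x 0| / √2, |x 1| / √2, |x 2| / √2,
      1 - (|x 0| + |x 1| + |x 2|) / √2, by positivity, by positivity, by positivity, ?_, by ring, ?_⟩)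
    · rw [sub_nonneg, div_le_one h2]; exact h
    · rw [hu', hv'', hw', smul_zero, add_zero]
      ext j; fin_cases j <;> simp

end Kepler

namespace Kepler

lemma faceForm_add (i : Fin 4) (x y : E3) : faceForm i (x + y) = faceForm i x + faceForm i y := by
  fin_cases i <;> simp [faceForm] <;> ring

lemma coord_sq_lt_one {y : E3} (hy : y ∈ Metric.ball (0 : E3) 1) :
    y 0 ^ 2 + y 1 ^ 2 + y 2 ^ 2 < 1 := by
  have h := dist_sq_eq y 0
  rw [Metric.mem_ball] at hy
  simp only [PiLp.zero_apply, sub_zero] at h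
  rw [← h]
  exact pow_lt_one₀ dist_nonneg hy two_ne_zero

lemma faceForm_sq_le {y : E3} (hy : y ∈ Metric.ball (0 : E3) 1) (i : Fin 4) :
    faceForm i y ^ 2 ≤ 3 := by
  have := coord_sq_lt_one hy
  fin_cases i <;> simp [faceForm] <;>
    nlinarith [sq_nonneg (y 0 - y 1), sq_nonneg (y 0 - y 2), sq_nonneg (y 1 - y 2),
      sq_nonneg (y 0 + y 1), sq_nonneg (y 0 + y 2), sq_nonneg (y 1 + y 2)]

/-- The vertices of the regular tetrahedron. -/
noncomputable def tetVertex : Fin 4 → E3 :=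
  ![(√2)⁻¹ • !₂[1, 1, 1], (√2)⁻¹ • !₂[1, -1, -1], (√2)⁻¹ • !₂[-1, 1, -1], (√2)⁻¹ • !₂[-1, -1, 1]]

/-- The vertices of the regular octahedron. -/
noncomputable def octVertex : Fin 6 → E3 :=
  ![√2 • !₂[1, 0, 0], √2 • !₂[-1, 0, 0], √2 • !₂[0, 1, 0], √2 • !₂[0, -1, 0], √2 • !₂[0, 0, 1],
    √2 • !₂[0, 0, -1]]

lemma range_tetVertex : Set.range tetVertex = regularTetrahedron := by
  simp only [tetVertex, regularTetrahedron, Set.image_insert_eq, Set.image_singleton,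
    Matrix.range_cons, Matrix.range_empty, Set.union_empty, Set.singleton_union]

lemma range_octVertex : Set.range octVertex = regularOctahedron := by
  simp only [octVertex, regularOctahedron, Set.image_insert_eq, Set.image_singleton,
    Matrix.range_cons, Matrix.range_empty, Set.union_empty, Set.singleton_union]

lemma two_le_dist_of_sq {x y : E3} (h : 4 ≤ (x 0 - y 0) ^ 2 + (x 1 - y 1) ^ 2 + (x 2 - y 2) ^ 2) :
    2 ≤ dist x y := by
  rw [← dist_sq_eq] at h
  exact le_of_sq_le_sq (by norm_num; exact h) dist_nonneg

lemma two_le_dist_tetVertex (i j : Fin 4) (hij : i ≠ j) : 2 ≤ dist (tetVertex i) (tetVertex j) := by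
  have h2 : (√2)⁻¹ ^ 2 = 1 / 2 := by rw [inv_pow, Real.sq_sqrt (by norm_num)]; norm_num
  refine two_le_dist_of_sq ?_
  fin_cases i <;> fin_cases j <;> first | exact absurd rfl hij | skip
  all_goals simp [tetVertex]
  all_goals nlinarith

lemma two_le_dist_octVertex (i j : Fin 6) (hij : i ≠ j) : 2 ≤ dist (octVertex i) (octVertex j) := by
  have h2 : √2 ^ 2 = 2 := Real.sq_sqrt (by norm_num)
  refine two_le_dist_of_sq ?_
  fin_cases i <;> fin_cases j <;> first | exact absurd rfl hij | skip
  all_goals simp [octVertex]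
  all_goals nlinarith

lemma faceForm_tetVertex (i j : Fin 4) :
    √2 * faceForm j (tetVertex i) = if j = i then 3 else -1 := by
  have h2 : √2 * (√2)⁻¹ = 1 := mul_inv_cancel₀ (by positivity)
  fin_cases i <;> fin_cases j <;> simp [tetVertex, faceForm] <;> linarith

/-- The three faces through the vertex bound a cone where the other three forms are nonnegative;
form `i` is then nonpositive, as the sum vanishes. The opposite face is out of reach, since a form
is at most `√3` on the unit ball. -/
lemma volume_tet_inter_ball (i : Fin 4) :
    volume.real (convexHull ℝ regularTetrahedron ∩ Metric.ball (tetVertex i) 1) =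
      volume.real (signCell {i}ᶜ) := by
  have hs : 0 < √2 := by positivity
  have h2 : √2 ^ 2 = 2 := Real.sq_sqrt (by norm_num)
  refine volume_translate _ (fun y hy => ?_) fun y hy => hy.1
  rw [mem_regularTetrahedron_hull]
  simp only [faceForm_add, mul_add, faceForm_tetVertex]
  have hsum := faceForm_sum y
  constructor
  · intro h
    have h1 : ∀ j, j ≠ i → 0 ≤ faceForm j y := fun j hj => by
      have := h j
      rw [if_neg hj] at this
      by_contra! hc
      nlinarith
    refine ⟨hy, fun j hj => h1 j (by simpa using hj), fun j hj => ?_⟩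
    obtain rfl : j = i := by simpa using hj
    revert h1
    clear h hj
    revert j
    refine forall_fin_four ?_ ?_ ?_ ?_ <;> intro h
    · linarith [h 1 (by decide), h 2 (by decide), h 3 (by decide)]
    · linarith [h 0 (by decide), h 2 (by decide), h 3 (by decide)]
    · linarith [h 0 (by decide), h 1 (by decide), h 3 (by decide)]
    · linarith [h 0 (by decide), h 1 (by decide), h 2 (by decide)]
  · rintro ⟨-, h, -⟩ j
    by_cases hj : j = i
    · rw [if_pos hj]
      have h3 := faceForm_sq_le hy j
      have : (√2 * faceForm j y) ^ 2 ≤ 4 ^ 2 := by rw [mul_pow, h2]; linarith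
      linarith [abs_le_of_sq_le_sq' this (by norm_num)]
    · rw [if_neg hj]
      have := mul_nonneg hs.le (h j (by simpa using hj))
      linarith

lemma add_abs_add_abs_nonpos {a b c : ℝ} : a + |b| + |c| ≤ 0 ↔
    a + b + c ≤ 0 ∧ a + b - c ≤ 0 ∧ a - b + c ≤ 0 ∧ a - b - c ≤ 0 := by
  constructor
  · intro h
    refine ⟨?_, ?_, ?_, ?_⟩ <;> linarith [le_abs_self b, le_abs_self c, neg_abs_le b, neg_abs_le c]
  · rintro ⟨h1, h2, h3, h4⟩
    rcases abs_cases b with ⟨hb, -⟩ | ⟨hb, -⟩ <;> rcases abs_cases c with ⟨hc, -⟩ | ⟨hc, -⟩ <;>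
      linarith

/-- The forms that are nonnegative on the cone of the octahedron at a vertex. -/
def octPattern : Fin 6 → Finset (Fin 4) := ![{2, 3}, {0, 1}, {1, 3}, {0, 2}, {1, 2}, {0, 3}]

/-- Since `√2 > 1`, the unit ball at a vertex stays on one side of the plane where the vertex's
nonzero coordinate vanishes. There the `ℓ¹` condition unfolds, at `√2 e_0` to `y 0 + |y 1| + |y 2| ≤
0`, into one sign condition for each of the four forms. -/
lemma volume_oct_inter_ball (i : Fin 6) :
    volume.real (convexHull ℝ regularOctahedron ∩ Metric.ball (octVertex i) 1) =
      volume.real (signCell (octPattern i)) := by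
  have hs : 1 < √2 := Real.lt_sqrt_of_sq_lt (by norm_num)
  refine volume_translate _ (fun y hy => ?_) fun y hy => hy.1
  rw [mem_regularOctahedron_hull]
  have h1 := coord_sq_lt_one hy
  have hlt : ∀ j : Fin 3, |y j| < 1 := by
    intro j
    rw [← sq_lt_one_iff_abs_lt_one]
    fin_cases j <;> simp only [Fin.zero_eta, Fin.mk_one, Fin.reduceFinMk] <;> nlinarith [sq_nonneg (y 0), sq_nonneg (y 1), sq_nonneg (y 2)]
  have hp : ∀ j : Fin 3, |√2 + y j| = √2 + y j := fun j =>
    abs_of_pos (by linarith [(abs_lt.1 (hlt j)).1])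
  have hn : ∀ j : Fin 3, |-√2 + y j| = √2 - y j := fun j => by
    rw [abs_of_neg (by linarith [(abs_lt.1 (hlt j)).2])]; ring
  have hcell : ∀ s, y ∈ signCell s ↔ (∀ i ∈ s, 0 ≤ faceForm i y) ∧ ∀ i ∉ s, faceForm i y ≤ 0 :=
    fun s => ⟨fun h => h.2, fun h => ⟨hy, h⟩⟩
  rw [hcell]
  have e0 : faceForm 0 y = y 0 + y 1 + y 2 := rfl
  have e1 : faceForm 1 y = y 0 - y 1 - y 2 := rfl
  have e2 : faceForm 2 y = -y 0 + y 1 - y 2 := rfl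
  have e3 : faceForm 3 y = -y 0 - y 1 + y 2 := rfl
  have key : ∀ (s : Finset (Fin 4)), ((∀ i ∈ s, 0 ≤ faceForm i y) ∧ ∀ i ∉ s, faceForm i y ≤ 0) ↔
      ∀ i, (i ∈ s → 0 ≤ faceForm i y) ∧ (i ∉ s → faceForm i y ≤ 0) := fun s =>
    ⟨fun h i => ⟨h.1 i, h.2 i⟩, fun h => ⟨fun i => (h i).1, fun i => (h i).2⟩⟩
  have four : ∀ p : Fin 4 → Prop, (∀ i, p i) ↔ p 0 ∧ p 1 ∧ p 2 ∧ p 3 := fun p =>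
    ⟨fun h => ⟨h 0, h 1, h 2, h 3⟩, fun h => forall_fin_four h.1 h.2.1 h.2.2.1 h.2.2.2⟩
  rw [key, four, e0, e1, e2, e3]
  fin_cases i
  · have := @add_abs_add_abs_nonpos (y 0) (y 1) (y 2)
    simp [octVertex, octPattern, hp]
    grind
  · have := @add_abs_add_abs_nonpos (-y 0) (y 1) (y 2)
    simp [octVertex, octPattern, hn]
    grind
  · have := @add_abs_add_abs_nonpos (y 1) (y 0) (y 2)
    simp [octVertex, octPattern, hp]
    grind
  · have := @add_abs_add_abs_nonpos (-y 1) (y 0) (y 2)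
    simp [octVertex, octPattern, hn]
    grind
  · have := @add_abs_add_abs_nonpos (y 2) (y 0) (y 1)
    simp [octVertex, octPattern, hp]
    grind
  · have := @add_abs_add_abs_nonpos (-y 2) (y 0) (y 1)
    simp [octVertex, octPattern, hn]
    grind

lemma volume_regularTetrahedron :
    volume.real (convexHull ℝ regularTetrahedron) = 2 * √2 / 3 := by
  have h2 : √2 * √2 = 2 := Real.mul_self_sqrt (by norm_num)
  have h0 : (√2)⁻¹ = √2 / 2 := by field_simp; linarith
  rw [regularTetrahedron, Set.image_insert_eq, Set.image_insert_eq, Set.image_insert_eq,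
    Set.image_singleton, volume_convexHull_four, det3_eq, h0]
  have : ∀ a : ℝ, a = -(4 * √2) → |a| / 6 = 2 * √2 / 3 := by
    rintro a rfl
    rw [abs_neg, abs_of_pos (by positivity)]
    ring
  apply this
  simp
  have h3 : √2 ^ 3 = 2 * √2 := by rw [pow_succ, sq, h2]
  ring_nf
  rw [h3]
  ring

lemma volume_regularOctahedron :
    volume.real (convexHull ℝ regularOctahedron) = 8 * √2 / 3 := by
  have : convexHull ℝ regularOctahedron = {x : E3 | |x 0| + |x 1| + |x 2| ≤ √2} := by
    ext x; exact mem_regularOctahedron_hull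
  have h3 : √2 ^ 3 = 2 * √2 := by rw [pow_succ, Real.sq_sqrt (by norm_num)]
  rw [this, volume_crossPolytope (by positivity), h3]
  ring

lemma deltaTet_eq : deltaTet = (∑ i, volume.real (signCell {i})) / (2 * √2 / 3) := by
  have h := volume_hull_inter_eq_sum two_le_dist_tetVertex
  rw [range_tetVertex] at h
  rw [deltaTet, polytopeDensity, h, volume_regularTetrahedron]
  simp only [volume_tet_inter_ball, volume_signCell_compl]

lemma deltaOct_eq : deltaOct = (∑ i, volume.real (signCell (octPattern i))) / (8 * √2 / 3) := by
  have h := volume_hull_inter_eq_sum two_le_dist_octVertex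
  rw [range_octVertex] at h
  rw [deltaOct, polytopeDensity, h, volume_regularOctahedron]
  simp only [volume_oct_inter_ball]

/-- The relation between the densities of the regular tetrahedron and the regular octahedron. -/
lemma pi_eq_densities : Real.pi = √2 * deltaTet + 2 * √2 * deltaOct := by
  classical
  have h := sum_volume_signCell
  -- Of the sixteen sign patterns, the two extreme ones give null sets. One or three nonnegative
  -- forms give a vertex cone of the tetrahedron or its antipode; two give a vertex cone of the
  -- octahedron.
  have hu : (Finset.univ : Finset (Finset (Fin 4))) = {∅, {0}, {1}, {2}, {3}, {0}ᶜ, {1}ᶜ, {2}ᶜ, {3}ᶜ,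
    {2, 3}, {0, 1}, {1, 3}, {0, 2}, {1, 2}, {0, 3}, Finset.univ} := by decide
  have he : volume.real (signCell ∅) = 0 := by
    rw [← volume_signCell_compl, Finset.compl_empty, volume_signCell_univ]
  rw [hu] at h
  repeat rw [Finset.sum_insert (by decide)] at h
  rw [Finset.sum_singleton, he, volume_signCell_univ] at h
  simp only [volume_signCell_compl] at h
  have hs : √2 ≠ 0 := by positivity
  rw [deltaTet_eq, deltaOct_eq, Fin.sum_univ_four, Fin.sum_univ_six]
  simp only [octPattern, Matrix.cons_val]
  field_simp
  linarith

end Kepler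

/-! ### Compatibility; barriers and V-cells near a vertex -/

namespace Kepler

lemma deltaOct_pos : 0 < deltaOct := by
  have hopen : IsOpen {x : E3 | x ∈ Metric.ball 0 1 ∧ x 0 + x 1 + x 2 < 0 ∧ x 0 - x 1 - x 2 < 0 ∧
      0 < -x 0 + x 1 - x 2 ∧ 0 < -x 0 - x 1 + x 2} :=
    Metric.isOpen_ball.and ((isOpen_lt (by fun_prop) (by fun_prop)).and
      ((isOpen_lt (by fun_prop) (by fun_prop)).and ((isOpen_lt (by fun_prop) (by fun_prop)).and
        (isOpen_lt (by fun_prop) (by fun_prop)))))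
  have hpos := hopen.measure_pos volume ⟨(-1 / 2 : ℝ) • EuclideanSpace.single 0 1, by
    simp [norm_smul]; norm_num⟩
  have hle : 0 < volume.real (signCell (octPattern 0)) := by
    refine ENNReal.toReal_pos (hpos.trans_le (measure_mono ?_)).ne'
      (measure_ne_top_of_subset (fun x hx => hx.1) (measure_ball_lt_top (x := (0 : E3)) (r := 1)).ne)
    rintro x ⟨h, h0, h1, h2, h3⟩
    refine ⟨h, ?_, ?_⟩
    · intro i hi
      simp [octPattern] at hi
      rcases hi with rfl | rfl
      exacts [h2.le, h3.le]
    · refine forall_fin_four (fun _ => h0.le) (fun _ => h1.le) ?_ ?_ <;> simp [octPattern]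
  rw [deltaOct_eq]
  refine div_pos (hle.trans_le ?_) (by positivity)
  exact Finset.single_le_sum (f := fun i => volume.real (signCell (octPattern i)))
    (fun i _ => measureReal_nonneg) (Finset.mem_univ 0)

/-- At `s = 8 * pt` the right side equals `(2 * π - 2 * √2 * deltaTet) / deltaOct`, which is exactly
`4 * √2` by `pi_eq_densities`. -/
lemma sqrt_thirtyTwo_le {s : ℝ} (hs : s ≤ 8 * pt) :
    √32 ≤ -s / (4 * deltaOct) + 4 * Real.pi / (3 * deltaOct) := by
  have hd := deltaOct_pos
  have h32 : √32 = 4 * √2 := by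
    rw [show (32 : ℝ) = 4 ^ 2 * 2 by norm_num, Real.sqrt_mul (by positivity), Real.sqrt_sq (by norm_num)]
  have h2 : √2 * √2 = 2 := Real.mul_self_sqrt (by norm_num)
  rw [h32]
  have e : -s / (4 * deltaOct) + 4 * Real.pi / (3 * deltaOct) =
      (-s / 4 + 4 * Real.pi / 3) / deltaOct := by field_simp
  rw [e, le_div_iff₀ hd]
  have := pi_eq_densities
  rw [pt] at hs
  linarith

lemma isFccCompatible_of_le {P : Set E3} {s : P → ℝ} (hs : ∀ v, s v ≤ 8 * pt) :
    IsFccCompatible P fun v => -s v / (4 * deltaOct) + 4 * Real.pi / (3 * deltaOct) -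
      volume.real (voronoiCell P v) := fun v => by
  have := sqrt_thirtyTwo_le (hs v)
  linarith

variable {P : Set E3} {c : Finset E3 → E3 × E3}

lemma IsPacking.countable (hP : IsPacking P) : P.Countable := by
  have : P = ⋃ n : ℕ, P ∩ Metric.closedBall 0 n := by
    ext x
    simp only [Set.mem_iUnion, Set.mem_inter_iff, Metric.mem_closedBall, exists_and_left]
    exact ⟨fun h => ⟨h, exists_nat_ge _⟩, fun h => h.1⟩
  rw [this]
  exact Set.countable_iUnion fun n => (hP.finite_inter 0 n).countable

lemma countable_finsets (hP : IsPacking P) : {S : Finset E3 | (S : Set E3) ⊆ P}.Countable := by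
  refine (Set.countable_ofPred_finite_subset hP.countable).preimage_of_injOn
    (f := fun S : Finset E3 => (S : Set E3)) (Finset.coe_injective.injOn) |>.mono ?_
  intro S hS
  exact ⟨S.finite_toSet, hS⟩

lemma isCandidate_of_mem {S : Finset E3} (h : S ∈ qSystem c P) : IsCandidate P S := by
  obtain ⟨h1, h | ⟨p, q, h, -⟩ | ⟨p, q, h, -⟩ | ⟨O, -, -, -, h⟩ | ⟨p, -, q, -, -, h, -⟩⟩ := h
  exacts [⟨h1, Or.inl h⟩, ⟨h1, Or.inr ⟨p, q, h⟩⟩, ⟨h1, Or.inr ⟨p, q, h⟩⟩,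
    ⟨h1, Or.inr ⟨_, _, h⟩⟩, ⟨h1, Or.inr ⟨p, q, h⟩⟩]

lemma card_of_mem_barriers {T : Finset E3} (hT : T ∈ barriers c P) : T.card = 3 := by
  rcases hT.2 with h | h
  exacts [h.1, h.1]

lemma dist_sq_le_of_mem_barriers {T : Finset E3} (hT : T ∈ barriers c P) {x y : E3} (hx : x ∈ T)
    (hy : y ∈ T) : dist x y ^ 2 ≤ 8 := by
  rcases hT.2 with h | ⟨-, S, hS, hTS⟩
  · by_cases hxy : x = y
    · simp [hxy]
    · linarith [dist_sq_le_of_le_t0 (h.2 x hx y hy hxy).2]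
  · exact (dist_sq_lt_of_lt_sqrt ((isCandidate_of_mem hS).dist_lt (hTS hx) (hTS hy))).le

lemma volume_affineSpan {T : Finset E3} (hT : T.card ≤ 3) :
    volume (affineSpan ℝ (T : Set E3) : Set E3) = 0 := by
  refine Measure.addHaar_affineSubspace _ _ fun h => ?_
  rcases T.eq_empty_or_nonempty with rfl | hne
  · simp at h
  have h1 : vectorSpan ℝ (T : Set E3) = ⊤ := by
    rw [← direction_affineSpan, h, AffineSubspace.direction_top]
  obtain ⟨n, hn⟩ : ∃ n, T.card = n + 1 := ⟨T.card - 1, by have := hne.card_pos; omega⟩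
  have h2 := finrank_vectorSpan_range_le ℝ (fun x : T => (x : E3)) (n := n) (by simpa using hn)
  rw [show Set.range (fun x : T => (x : E3)) = (T : Set E3) by simp, h1, finrank_top,
    finrank_euclideanSpace_fin] at h2
  omega

/-- Almost no point lies in the plane of a triangle with vertices in a packing. -/
lemma ae_notMem_affineSpan (hP : IsPacking P) :
    ∀ᵐ x : E3, ∀ T : Finset E3, (T : Set E3) ⊆ P → T.card ≤ 3 →
      x ∉ affineSpan ℝ (T : Set E3) := by
  have h := (ae_ball_iff (countable_finsets hP) (μ := (volume : Measure E3))
    (p := fun x T _ => T.card ≤ 3 → x ∉ affineSpan ℝ (T : Set E3))).2 fun T hT => by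
      by_cases h3 : T.card ≤ 3
      · rw [ae_iff]
        simpa [h3] using volume_affineSpan h3
      · simp [h3]
  filter_upwards [h] with x hx T hT h3 using hx T hT h3

lemma mem_affineSpan_of_mem_segment {A : AffineSubspace ℝ E3} {x w z : E3} (hw : w ∈ A)
    (hz : z ∈ A) (hzw : z ≠ w) (h : z ∈ segment ℝ x w) : x ∈ A := by
  obtain ⟨a, b, ha, hb, hab, rfl⟩ := h
  have ha0 : a ≠ 0 := by
    rintro rfl
    rw [zero_add] at hab
    exact hzw (by simp [hab])
  have : x = AffineMap.lineMap w (a • x + b • w) a⁻¹ := by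
    rw [AffineMap.lineMap_apply_module]
    obtain rfl : b = 1 - a := by linarith
    rw [smul_add, smul_smul, smul_smul, inv_mul_cancel₀ ha0, mul_sub, inv_mul_cancel₀ ha0]
    module
  rw [this]
  exact AffineMap.lineMap_mem _ hw hz

lemma openHull_subset_affineSpan (T : Finset E3) : openHull T ⊆ affineSpan ℝ (T : Set E3) := by
  rintro x ⟨w, hw, h1, rfl⟩
  exact convexHull_subset_affineSpan _ (Finset.mem_convexHull'.2 ⟨w, fun y hy => (hw y hy).le, h1, rfl⟩)

lemma openHull_subset_convexHull (T : Finset E3) : openHull T ⊆ convexHull ℝ (T : Set E3) := by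
  rintro x ⟨w, hw, h1, rfl⟩
  exact Finset.mem_convexHull'.2 ⟨w, fun y hy => (hw y hy).le, h1, rfl⟩

/-- A barrier that does not have the vertex `v` keeps a distance of more than one from `v`. -/
lemma one_lt_dist_of_mem_barrier (hP : IsPacking P) {T : Finset E3} (hT : T ∈ barriers c P) {v z : E3}
    (hv : v ∈ P) (hvT : v ∉ T) (hz : z ∈ convexHull ℝ (T : Set E3)) : 1 < dist z v := by
  obtain ⟨w, h0, h1, h2⟩ := Finset.mem_convexHull'.1 hz
  have h := four_mul_sum_sq_le h0 h1 h2
    (fun i hi => hP.four_le (hT.1 hi) hv fun h => hvT (h ▸ hi))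
    (fun i hi j hj => dist_sq_le_of_mem_barriers hT hi hj)
  -- By Cauchy–Schwarz three weights of sum one have squares summing to at least `1 / 3`, so the
  -- squared distance is at least `4 / 3`.
  have h3 := sq_sum_le_card_mul_sum_sq (s := T) (f := w)
  rw [h1, card_of_mem_barriers hT] at h3
  push_cast at h3
  by_contra! hc
  nlinarith [dist_nonneg (x := z) (y := v)]

/-- Removing its own weight and rescaling would put `v` into the hull of the other two vertices. -/
lemma notMem_openHull (hP : IsPacking P) {T : Finset E3} (hT : T ∈ barriers c P) {v : E3}
    (hv : v ∈ T) : v ∉ openHull T := by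
  classical
  rintro ⟨w, hw, h1, h2⟩
  rw [← Finset.add_sum_erase _ _ hv] at h1 h2
  have hne : (T.erase v).Nonempty := by
    rw [← Finset.card_pos, Finset.card_erase_of_mem hv, card_of_mem_barriers hT]; norm_num
  have hpos : 0 < ∑ i ∈ T.erase v, w i :=
    Finset.sum_pos (fun i hi => hw i (Finset.mem_of_mem_erase hi)) hne
  refine not_mem_convexHull (B := T.erase v) (v := v) (fun i hi => hP.four_le
    (hT.1 (Finset.mem_of_mem_erase hi)) (hT.1 hv) (Finset.ne_of_mem_erase hi))
    (fun i hi j hj => dist_sq_le_of_mem_barriers hT (Finset.mem_of_mem_erase hi)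
      (Finset.mem_of_mem_erase hj)) (Finset.mem_convexHull'.2
      ⟨fun i => (∑ i ∈ T.erase v, w i)⁻¹ * w i, fun i hi => ?_, ?_, ?_⟩)
  · exact mul_nonneg (inv_nonneg.2 hpos.le) (hw i (Finset.mem_of_mem_erase hi)).le
  · rw [← Finset.mul_sum, inv_mul_cancel₀ hpos.ne']
  · simp only [mul_smul]
    rw [← Finset.smul_sum, inv_smul_eq_iff₀ hpos.ne']
    have : ∑ i ∈ T.erase v, w i • i = v - w v • v := eq_sub_of_add_eq' h2
    rw [this]
    have : ∑ i ∈ T.erase v, w i = 1 - w v := by linarith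
    rw [this]
    module

/-- Almost all points at distance less than one from a vertex lie in its V-cell. -/
lemma ae_mem_vCell (hP : IsPacking P) {v : E3} (hv : v ∈ P) :
    ∀ᵐ x, x ∈ Metric.ball v 1 → x ∈ vCell c P v := by
  filter_upwards [ae_notMem_affineSpan hP] with x hx hxv
  rw [Metric.mem_ball] at hxv
  refine ⟨⟨hv, by linarith, ?_⟩, fun w hw hwv => ?_⟩
  · rintro ⟨T, hT, z, hz1, hz2⟩
    have hzd : dist z v ≤ dist x v := by
      obtain ⟨a, b, ha, hb, hab, rfl⟩ := hz1
      rw [dist_eq_norm, dist_eq_norm]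
      have : a • x + b • v - v = a • (x - v) := by
        obtain rfl : b = 1 - a := by linarith
        module
      rw [this, norm_smul, Real.norm_of_nonneg ha]
      exact mul_le_of_le_one_left (norm_nonneg _) (by linarith)
    -- If `v` is a vertex of the obstructing barrier, then `x` lies in its plane, which is excluded
    -- almost everywhere. Otherwise the barrier keeps a distance of more than one from `v`, while
    -- `z` is no farther from `v` than `x`.
    by_cases hvT : v ∈ T
    · refine hx T hT.1 (card_of_mem_barriers hT).le (mem_affineSpan_of_mem_segment
        (subset_affineSpan ℝ _ hvT) (openHull_subset_affineSpan T hz2) ?_ hz1)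
      rintro rfl
      exact notMem_openHull hP hT hvT hz2
    · linarith [one_lt_dist_of_mem_barrier hP hT hv hvT (openHull_subset_convexHull T hz2)]
  · have h1 := hP v hv w hw.1 hwv.symm
    have h2 := dist_triangle v x w
    rw [dist_comm v x] at h2
    linarith

lemma qSystem_finite_of_mem (hP : IsPacking P) (v : E3) : {S | S ∈ qSystem c P ∧ v ∈ S}.Finite := by
  classical
  refine ((hP.finite_inter v (√8)).toFinset.powerset.finite_toSet).subset ?_
  rintro S ⟨hS, hv⟩
  simp only [Finset.coe_powerset, Set.mem_preimage, Set.mem_powerset_iff, Set.Finite.coe_toFinset]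
  exact fun x hx => ⟨hS.1 hx, ((isCandidate_of_mem hS).dist_lt hx hv).le⟩

/-- The part of the V-cell that is not covered by simplices of the Q-system at its center. -/
def residue (c : Finset E3 → E3 × E3) (P : Set E3) (v : E3) : Set E3 :=
  vCell c P v \ ⋃ S ∈ {S | S ∈ qSystem c P ∧ v ∈ S}, convexHull ℝ (S : Set E3)

/-- The residue and the simplices at a vertex subtend at least the full solid angle. -/
lemma four_pi_le_solidAngle (hP : IsPacking P) {v : E3} (hv : v ∈ P) :
    4 * Real.pi ≤ solidAngle v (residue c P v) +
      ∑ S ∈ (qSystem_finite_of_mem (c := c) hP v).toFinset,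
        solidAngle v (convexHull ℝ (S : Set E3)) := by
  set F := (qSystem_finite_of_mem (c := c) hP v).toFinset with hF
  have hfin : ∀ A : Set E3, volume (A ∩ Metric.ball v 1) ≠ ⊤ := fun A =>
    measure_ne_top_of_subset Set.inter_subset_right measure_ball_lt_top.ne
  have hsub : ∀ C : Set E3, C ⊆ coneAt v C := fun C x hx => ⟨1, one_pos, by simpa using hx⟩
  -- Almost every point of the ball is in the V-cell, hence in the residue or in a simplex at `v`,
  -- and so in its cone; subadditivity suffices.
  have h1 : volume (Metric.ball v 1) ≤ volume (coneAt v (residue c P v) ∩ Metric.ball v 1) +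
      ∑ S ∈ F, volume (coneAt v (convexHull ℝ (S : Set E3)) ∩ Metric.ball v 1) := by
    refine le_trans ?_ ((measure_union_le _ _).trans
      (add_le_add_right (measure_biUnion_finset_le F
        fun S => coneAt v (convexHull ℝ (S : Set E3)) ∩ Metric.ball v 1) _))
    refine measure_mono_ae ?_
    filter_upwards [ae_mem_vCell (c := c) hP hv] with x hx hxv
    have hx := hx hxv
    by_cases h : x ∈ ⋃ S ∈ {S | S ∈ qSystem c P ∧ v ∈ S}, convexHull ℝ (S : Set E3)
    · right
      obtain ⟨S, hS, hxS⟩ := Set.mem_iUnion₂.1 h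
      exact Set.mem_iUnion₂.2 ⟨S, by simpa [hF] using hS, hsub _ hxS, hxv⟩
    · left
      exact ⟨hsub _ ⟨hx, h⟩, hxv⟩
  have h2 := ENNReal.toReal_mono (ENNReal.add_ne_top.2 ⟨hfin _,
    ENNReal.sum_ne_top.2 fun S _ => hfin _⟩) h1
  rw [ENNReal.toReal_add (hfin _) (ENNReal.sum_ne_top.2 fun S _ => hfin _),
    ENNReal.toReal_sum fun S _ => hfin _, EuclideanSpace.volume_ball_fin_three, ENNReal.ofReal_one,
    one_pow, one_mul, ENNReal.toReal_ofReal (by positivity)] at h2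
  simp only [solidAngle, ← Finset.mul_sum, measureReal_def]
  linarith

end Kepler

/-! ### Visibility inside simplices, measurability and disjointness -/

namespace Kepler

variable {P : Set E3} {c : Finset E3 → E3 × E3}

/-- A dependency yields a Radon partition: either a point in the hull of the others or two crossing
edges, and the lengths exclude both. One edge of each disjoint pair has to be shorter than `√8`, for
the square of side two is flat. -/
lemma affineIndependent_of_edges {S : Finset E3} (hS : IsPacking (S : Set E3)) (hcard : S.card = 4)
    (h8 : ∀ v ∈ S, ∀ w ∈ S, dist v w ^ 2 ≤ 8) (hshort : ∀ v ∈ S, ∀ w ∈ S, ∀ x ∈ S, ∀ y ∈ S, v ≠ x →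
      v ≠ y → w ≠ x → w ≠ y → dist v w < √8 ∨ dist x y < √8) :
    AffineIndependent ℝ (fun x : S => (x : E3)) := by
  classical
  by_contra h
  obtain ⟨I, hI⟩ := Convex.radon_partition h
  set A : Finset E3 := S.filter fun x => ∃ h : x ∈ S, (⟨x, h⟩ : S) ∈ I with hA
  set B : Finset E3 := S.filter fun x => ∃ h : x ∈ S, (⟨x, h⟩ : S) ∉ I with hB
  have eA : (fun x : S => (x : E3)) '' I = (A : Set E3) := by
    ext x; simp [hA]
  have eB : (fun x : S => (x : E3)) '' Iᶜ = (B : Set E3) := by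
    ext x; simp [hB]
  rw [eA, eB] at hI
  have hAB : Disjoint A B := by
    rw [Finset.disjoint_left]
    intro x hx hx'
    obtain ⟨h1, h2⟩ := (Finset.mem_filter.1 hx).2
    obtain ⟨h3, h4⟩ := (Finset.mem_filter.1 hx').2
    exact h4 h2
  have hsA : A ⊆ S := Finset.filter_subset _ _
  have hsB : B ⊆ S := Finset.filter_subset _ _
  have hle : A.card + B.card ≤ 4 := by
    rw [← Finset.card_union_of_disjoint hAB, ← hcard]
    exact Finset.card_le_card (Finset.union_subset hsA hsB)
  have one : ∀ {A B : Finset E3}, A ⊆ S → B ⊆ S → Disjoint A B →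
      (convexHull ℝ (A : Set E3) ∩ convexHull ℝ (B : Set E3)).Nonempty → A.card ≠ 1 := by
    intro A B hA hB hAB hh h1
    obtain ⟨p, rfl⟩ := Finset.card_eq_one.1 h1
    obtain ⟨u, hu, hu'⟩ := hh
    rw [Finset.coe_singleton, convexHull_singleton, Set.mem_singleton_iff] at hu
    subst hu
    rw [Finset.disjoint_singleton_left] at hAB
    refine not_mem_convexHull (fun i hi => hS.four_le (hB hi) (hA (by simp)) ?_)
      (fun i hi j hj => h8 i (hB hi) j (hB hj)) hu'
    rintro rfl
    exact hAB hi
  have a1 := one hsA hsB hAB hI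
  have b1 := one hsB hsA hAB.symm (Set.inter_comm _ _ ▸ hI)
  have a0 : A.card ≠ 0 := fun h0 => by rw [Finset.card_eq_zero.1 h0] at hI; simp at hI
  have b0 : B.card ≠ 0 := fun h0 => by rw [Finset.card_eq_zero.1 h0] at hI; simp at hI
  obtain ⟨p, q, hpq, hA2⟩ := Finset.card_eq_two.1 (show A.card = 2 by omega)
  obtain ⟨x, y, hxy, hB2⟩ := Finset.card_eq_two.1 (show B.card = 2 by omega)
  rw [hA2] at hAB hsA hI
  rw [hB2] at hAB hsB hI
  simp only [Finset.disjoint_insert_left, Finset.disjoint_singleton_left, Finset.mem_insert,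
    Finset.mem_singleton, not_or] at hAB
  have hp := hsA (show p ∈ ({p, q} : Finset E3) by simp)
  have hq := hsA (show q ∈ ({p, q} : Finset E3) by simp)
  have hx := hsB (show x ∈ ({x, y} : Finset E3) by simp)
  have hy := hsB (show y ∈ ({x, y} : Finset E3) by simp)
  simp only [Finset.coe_pair] at hI
  rcases hshort p hp q hq x hx y hy hAB.1.1 hAB.1.2 hAB.2.1 hAB.2.2 with hl | hl
  · refine not_inter_segments_of_le hS hx hy hp hq (Ne.symm hAB.1.1) (Ne.symm hAB.2.1)
      (Ne.symm hAB.1.2) (Ne.symm hAB.2.2) (h8 x hx y hy) hl ?_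
    rwa [Set.inter_comm]
  · exact not_inter_segments_of_le hS hp hq hx hy hAB.1.1 hAB.1.2 hAB.2.1 hAB.2.2 (h8 p hp q hq) hl hI

lemma IsCandidate.affineIndependent (hP : IsPacking P) {S : Finset E3} (hS : IsCandidate P S) :
    AffineIndependent ℝ (fun x : S => (x : E3)) :=
  affineIndependent_of_edges (fun v hv w hw => hP v (hS.1 hv) w (hS.1 hw)) hS.card
    (fun _ hv _ hw => (dist_sq_lt_of_lt_sqrt (hS.dist_lt hv hw)).le)
    fun _ hv _ hw _ _ _ _ _ _ _ _ => Or.inl (hS.dist_lt hv hw)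

/-- The affine basis formed by the vertices of a simplex. -/
noncomputable def vertexBasis {S : Finset E3} (hcard : S.card = 4)
    (h : AffineIndependent ℝ (fun x : S => (x : E3))) : AffineBasis S ℝ E3 :=
  ⟨fun x => x, h, h.affineSpan_eq_top_iff_card_eq_finrank_add_one.2 (by simp [hcard])⟩

lemma range_vertexBasis {S : Finset E3} (hcard : S.card = 4)
    (h : AffineIndependent ℝ (fun x : S => (x : E3))) :
    Set.range (vertexBasis hcard h) = (S : Set E3) := by
  change Set.range (fun x : S => (x : E3)) = _
  simp

/-- A segment that leaves a simplex passes through a proper face. -/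
lemma exists_proper_face {S : Finset E3} (hcard : S.card = 4)
    (h : AffineIndependent ℝ (fun x : S => (x : E3))) {x w : E3}
    (hx : x ∈ convexHull ℝ (S : Set E3)) (hw : w ∉ convexHull ℝ (S : Set E3)) :
    ∃ z ∈ segment ℝ x w, ∃ A ⊂ S, z ∈ openHull A := by
  classical
  set b := vertexBasis hcard h with hb
  have hhull : convexHull ℝ (S : Set E3) = {x | ∀ i, 0 ≤ b.coord i x} := by
    rw [← range_vertexBasis hcard h, b.convexHull_eq_nonneg_coord]
  rw [hhull] at hx hw
  have hx : ∀ i, 0 ≤ b.coord i x := hx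
  have hw : ¬∀ i, 0 ≤ b.coord i w := hw
  push Not at hw
  obtain ⟨i₁, hi₁⟩ := hw
  set N : Finset S := Finset.univ.filter fun i => b.coord i w < 0 with hN
  -- The index whose barycentric coordinate is the first to vanish on the way from `x` to `w`. There
  -- all coordinates are still nonnegative, and the positive ones determine the proper face.
  obtain ⟨i, hi, hmin⟩ := N.exists_min_image
    (fun i => b.coord i x / (b.coord i x - b.coord i w)) ⟨i₁, by simp [hN, hi₁]⟩
  have hi0 : b.coord i w < 0 := (Finset.mem_filter.1 hi).2
  set t := b.coord i x / (b.coord i x - b.coord i w) with ht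
  have hden : 0 < b.coord i x - b.coord i w := by linarith [hx i]
  have ht0 : 0 ≤ t := div_nonneg (hx i) hden.le
  have ht1 : t ≤ 1 := by rw [ht, div_le_one hden]; linarith
  set z := AffineMap.lineMap x w t with hz
  have hcz : ∀ j, b.coord j z = (1 - t) * b.coord j x + t * b.coord j w := fun j => by
    rw [hz, AffineMap.apply_lineMap, AffineMap.lineMap_apply_module]; rfl
  have hzi : b.coord i z = 0 := by
    rw [hcz, ht]; field_simp; ring
  have hz0 : ∀ j, 0 ≤ b.coord j z := fun j => by
    rw [hcz]
    by_cases hj : b.coord j w < 0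
    · have h1 := hmin j (by simp [hN, hj])
      have hden' : 0 < b.coord j x - b.coord j w := by linarith [hx j]
      rw [le_div_iff₀ hden'] at h1
      linarith
    · push Not at hj
      exact add_nonneg (mul_nonneg (by linarith) (hx j)) (mul_nonneg ht0 hj)
  refine ⟨z, ⟨1 - t, t, by linarith, ht0, by ring, by
    rw [hz, AffineMap.lineMap_apply_module]⟩, S.filter fun y => ∃ hy : y ∈ S, 0 < b.coord ⟨y, hy⟩ z,
    ?_, fun y => if hy : y ∈ S then b.coord ⟨y, hy⟩ z else 0, ?_, ?_, ?_⟩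
  · refine Finset.filter_ssubset.2 ⟨i, i.2, ?_⟩
    rintro ⟨hy, hpos⟩
    exact hpos.ne' hzi
  · intro y hy
    obtain ⟨hyS, hy'⟩ := Finset.mem_filter.1 hy
    simp only [dif_pos hyS]
    exact hy'.2
  · rw [Finset.sum_filter_of_ne, ← Finset.sum_coe_sort S]
    · simpa using b.sum_coord_apply_eq_one z
    · intro y hy hne
      simp only [dif_pos hy] at hne
      exact ⟨hy, lt_of_le_of_ne (hz0 _) hne.symm⟩
  · rw [Finset.sum_filter_of_ne, ← Finset.sum_coe_sort S]
    · have := b.linear_combination_coord_eq_self z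
      rw [← this]
      refine Finset.sum_congr rfl fun y _ => ?_
      simp only [dif_pos y.2]
      rw [this]
      rfl
    · intro y hy hne
      simp only [dif_pos hy] at hne
      exact ⟨hy, lt_of_le_of_ne (hz0 _) fun h0 => hne (by rw [← h0, zero_smul])⟩

/-- Almost all points of a simplex of the Q-system see no other vertices than those of the
simplex. -/
lemma ae_visibleVertices_subset (hP : IsPacking P) :
    ∀ᵐ x, ∀ S ∈ qSystem c P, x ∈ convexHull ℝ (S : Set E3) → visibleVertices c P x ⊆ S := by
  classical
  filter_upwards [ae_notMem_affineSpan hP] with x hx S hS hxS w hw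
  by_contra hwS
  have hcand := isCandidate_of_mem hS
  have hwh : w ∉ convexHull ℝ (S : Set E3) :=
    not_mem_convexHull (fun i hi => hP.four_le (hS.1 hi) hw.1 fun h => hwS (by rw [← h]; exact hi))
      fun i hi j hj => (dist_sq_lt_of_lt_sqrt (hcand.dist_lt hi hj)).le
  obtain ⟨z, hz, A, hA, hzA⟩ := exists_proper_face hcand.card (hcand.affineIndependent hP) hxS hwh
  have hAP : (A : Set E3) ⊆ P := fun y hy => hS.1 (hA.1 hy)
  have hlt := Finset.card_lt_card hA
  rw [hcand.card] at hlt
  -- A face with three vertices is a barrier that obstructs `w`. A smaller one would put `x` into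
  -- the affine span of `w` and at most two vertices, a null set.
  by_cases h3 : A.card = 3
  · exact hw.2.2 ⟨A, ⟨hAP, Or.inr ⟨h3, S, hS, hA.1⟩⟩, z, hz, hzA⟩
  · refine hx (insert w A) ?_ ((Finset.card_insert_le _ _).trans (by omega)) ?_
    · rw [Finset.coe_insert]
      exact Set.insert_subset hw.1 hAP
    · refine mem_affineSpan_of_mem_segment (subset_affineSpan ℝ _ (by simp))
        (affineSpan_mono ℝ (by simp) (openHull_subset_affineSpan A hzA)) ?_ hz
      rintro rfl
      exact hwh (convexHull_mono hA.1 (openHull_subset_convexHull A hzA))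

/-- The open simplex of weights is exhausted by the compact sets where every weight is at least `1 /
(n + 1)`. -/
lemma exists_compacts_openHull (T : Finset E3) :
    ∃ K : ℕ → Set E3, (∀ n, IsCompact (K n)) ∧ openHull T = ⋃ n, K n := by
  classical
  let W : ℕ → Set (T → ℝ) := fun n => {w | (∀ y, w y ∈ Set.Icc ((n : ℝ) + 1)⁻¹ 1) ∧ ∑ y, w y = 1}
  have hW : ∀ n, IsCompact (W n) := fun n => by
    have h1 : IsCompact (Set.univ.pi fun _ : T => Set.Icc ((n : ℝ) + 1)⁻¹ 1) :=
      isCompact_univ_pi fun _ => isCompact_Icc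
    have h2 : IsClosed {w : T → ℝ | ∑ y, w y = 1} := isClosed_eq (by fun_prop) continuous_const
    convert h1.inter_right h2 using 1
    ext w
    simp only [W, Set.mem_ofPred_eq, Set.mem_inter_iff, Set.mem_pi, Set.mem_univ, forall_const]
  refine ⟨fun n => (fun w : T → ℝ => ∑ y : T, w y • (y : E3)) '' W n, fun n =>
    (hW n).image (by fun_prop), ?_⟩
  ext x
  simp only [Set.mem_iUnion]
  constructor
  · rintro ⟨w, h0, h1, rfl⟩
    obtain ⟨n, hn⟩ : ∃ n : ℕ, ∀ y ∈ T, ((n : ℝ) + 1)⁻¹ ≤ w y := by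
      rcases T.eq_empty_or_nonempty with rfl | hne
      · exact ⟨0, by simp⟩
      obtain ⟨y, hy, hmin⟩ := T.exists_min_image w hne
      obtain ⟨n, hn⟩ := exists_nat_one_div_lt (h0 y hy)
      refine ⟨n, fun u hu => ?_⟩
      rw [← one_div]
      exact hn.le.trans (hmin u hu)
    refine ⟨n, fun y => w y, ⟨fun y => ⟨hn y y.2, ?_⟩, ?_⟩, ?_⟩
    · rw [← h1]
      exact Finset.single_le_sum (f := w) (fun i hi => (h0 i hi).le) y.2
    · rw [Finset.sum_coe_sort T w, h1]
    · exact Finset.sum_coe_sort T fun y => w y • y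
  · rintro ⟨n, w, ⟨h1, h2⟩, rfl⟩
    refine ⟨fun y => if hy : y ∈ T then w ⟨y, hy⟩ else 0, fun y hy => ?_, ?_, ?_⟩
    · simp only [dif_pos hy]
      exact lt_of_lt_of_le (by positivity) (h1 ⟨y, hy⟩).1
    · rw [← Finset.sum_coe_sort T, ← h2]
      simp
    · rw [← Finset.sum_coe_sort T]
      simp

/-- The shadow of a compact set is the projection of a closed set along the compact interval of
parameters, hence closed; an open hull is a countable union of compact sets. -/
lemma measurableSet_shadow (w : E3) (T : Finset E3) :
    MeasurableSet {x | (segment ℝ x w ∩ openHull T).Nonempty} := by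
  obtain ⟨K, hK, hT⟩ := exists_compacts_openHull T
  have : {x | (segment ℝ x w ∩ openHull T).Nonempty} =
      ⋃ n, {x | ∃ t ∈ Set.Icc (0 : ℝ) 1, AffineMap.lineMap x w t ∈ K n} := by
    ext x
    simp only [Set.mem_ofPred_eq, Set.mem_iUnion, hT, segment_eq_image_lineMap, Set.Nonempty,
      Set.mem_inter_iff, Set.mem_image]
    constructor
    · rintro ⟨_, ⟨t, ht, rfl⟩, n, hn⟩
      exact ⟨n, t, ht, hn⟩
    · rintro ⟨n, t, ht, hn⟩
      exact ⟨_, ⟨t, ht, rfl⟩, n, hn⟩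
  rw [this]
  refine MeasurableSet.iUnion fun n => IsClosed.measurableSet ?_
  have hcl : IsClosed {p : E3 × ℝ | AffineMap.lineMap p.1 w p.2 ∈ K n} := by
    refine (hK n).isClosed.preimage ?_
    simp only [AffineMap.lineMap_apply_module]
    fun_prop
  have hproj := isClosedMap_snd_of_compactSpace (X := Set.Icc (0 : ℝ) 1) (Y := E3)
    {p | AffineMap.lineMap p.2 w (p.1 : ℝ) ∈ K n} (hcl.preimage
      (f := fun p : Set.Icc (0 : ℝ) 1 × E3 => (p.2, (p.1 : ℝ))) (by fun_prop))
  convert hproj using 1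
  ext x
  simp

lemma measurableSet_visible (hP : IsPacking P) (w : E3) :
    MeasurableSet {x | w ∈ visibleVertices c P x} := by
  by_cases hw : w ∈ P
  · have : {x | w ∈ visibleVertices c P x} = Metric.ball w 2 ∩
        ⋂ T ∈ barriers c P, {x | (segment ℝ x w ∩ openHull T).Nonempty}ᶜ := by
      ext x
      simp only [visibleVertices, Obstructed, Set.mem_ofPred_eq, hw, true_and, Set.mem_inter_iff,
        Metric.mem_ball, Set.mem_iInter, Set.mem_compl_iff, not_exists, not_and]
    rw [this]
    refine measurableSet_ball.inter (MeasurableSet.biInter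
      ((countable_finsets hP).mono fun T hT => hT.1) fun T _ => (measurableSet_shadow w T).compl)
  · simp [visibleVertices, hw]

lemma measurableSet_vCell (hP : IsPacking P) (v : E3) : MeasurableSet (vCell c P v) := by
  have : vCell c P v = {x | v ∈ visibleVertices c P x} ∩
      ⋂ w ∈ P, ({x | w ∈ visibleVertices c P x}ᶜ ∪ {x | w ≠ v → dist x v < dist x w}) := by
    ext x
    simp only [vCell, Set.mem_ofPred_eq, Set.mem_inter_iff, Set.mem_iInter, Set.mem_union,
      Set.mem_compl_iff]
    refine and_congr_right fun _ => ⟨fun h w _ => ?_, fun h w hw => (h w hw.1).resolve_left (by simpa)⟩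
    by_cases hw : w ∈ visibleVertices c P x
    · exact Or.inr (h w hw)
    · exact Or.inl hw
  rw [this]
  refine (measurableSet_visible hP v).inter (MeasurableSet.biInter hP.countable fun w _ =>
    (measurableSet_visible hP w).compl.union ?_)
  by_cases hwv : w = v
  · simp [hwv]
  · simp only [hwv, ne_eq, not_false_eq_true, forall_const]
    exact measurableSet_lt (by fun_prop) (by fun_prop)

lemma measurableSet_convexHull (S : Finset E3) : MeasurableSet (convexHull ℝ (S : Set E3)) :=
  (S.finite_toSet.isCompact_convexHull (𝕜 := ℝ)).measurableSet

lemma measurableSet_residue (hP : IsPacking P) (v : E3) : MeasurableSet (residue c P v) :=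
  (measurableSet_vCell hP v).diff (MeasurableSet.biUnion (qSystem_finite_of_mem hP v).countable
    fun S _ => measurableSet_convexHull S)

lemma disjoint_vCell {v w : E3} (hvw : v ≠ w) : Disjoint (vCell c P v) (vCell c P w) := by
  rw [Set.disjoint_left]
  intro x hx hx'
  have h1 := hx.2 w hx'.1 hvw.symm
  have h2 := hx'.2 v hx.1 hvw
  linarith

/-- Almost every point of `S` sees only vertices of `S`. If it lies in the V-cell of `v`, then `v`
is one of them, and `S` was removed from the residue. -/
lemma aedisjoint_residue_hull (hP : IsPacking P) {v : E3} {S : Finset E3} (hS : S ∈ qSystem c P) :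
    AEDisjoint volume (residue c P v) (convexHull ℝ (S : Set E3)) := by
  rw [AEDisjoint, measure_eq_zero_iff_ae_notMem]
  filter_upwards [ae_visibleVertices_subset (c := c) hP] with x hx hx'
  have hv : v ∈ S := hx S hS hx'.2 hx'.1.1.1
  exact hx'.1.2 (Set.mem_iUnion₂.2 ⟨S, ⟨hS, hv⟩, hx'.2⟩)

/-- Frontiers of convex sets are null, and a common point off both frontiers is an overlap. -/
lemma aedisjoint_hull (hc : IsDiagonalChoice c) (hP : IsPacking P) {S S' : Finset E3}
    (hS : S ∈ qSystem c P) (hS' : S' ∈ qSystem c P) (hne : S ≠ S') :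
    AEDisjoint volume (convexHull ℝ (S : Set E3)) (convexHull ℝ (S' : Set E3)) := by
  have h1 := (convex_convexHull ℝ (S : Set E3)).addHaar_frontier (volume : Measure E3)
  have h2 := (convex_convexHull ℝ (S' : Set E3)).addHaar_frontier (volume : Measure E3)
  refine measure_mono_null ?_ (measure_union_null h1 h2)
  rintro x ⟨hx, hx'⟩
  by_contra hn
  simp only [Set.mem_union, not_or, frontier] at hn
  refine not_overlap_qSystem hc hP hS hS' hne ⟨x, ?_, ?_⟩
  · by_contra hi
    exact hn.1 ⟨subset_closure hx, hi⟩
  · by_contra hi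
    exact hn.2 ⟨subset_closure hx', hi⟩

end Kepler

/-! ### Signed volumes of Rogers simplices -/

namespace Kepler

lemma circumcenter_comp_perm {n : ℕ} (f : Fin (n + 1) → E3) (e : Equiv.Perm (Fin (n + 1))) :
    circumcenter (f ∘ e) = circumcenter f := by
  by_cases h : AffineIndependent ℝ f
  · have h' : AffineIndependent ℝ (f ∘ e) := (affineIndependent_equiv e).2 h
    rw [circumcenter, circumcenter, dif_pos h, dif_pos h']
    exact (⟨f, h⟩ : Affine.Simplex ℝ E3 n).circumcenter_reindex e.symm
  · have h' : ¬AffineIndependent ℝ (f ∘ e) := fun h' => h ((affineIndependent_equiv e).1 h')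
    rw [circumcenter, circumcenter, dif_neg h, dif_neg h']

lemma circumcenter_three_swap (a b c : E3) : circumcenter ![b, a, c] = circumcenter ![a, b, c] := by
  rw [← circumcenter_comp_perm ![a, b, c] (Equiv.swap 0 1)]
  congr 1
  ext i
  fin_cases i <;> rfl

lemma circumcenter_three_swap' (a b c : E3) : circumcenter ![a, c, b] = circumcenter ![a, b, c] := by
  rw [← circumcenter_comp_perm ![a, b, c] (Equiv.swap 1 2)]
  congr 1
  ext i
  fin_cases i <;> rfl

lemma circumcenter_four_swap (a b c d : E3) :
    circumcenter ![b, a, c, d] = circumcenter ![a, b, c, d] := by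
  rw [← circumcenter_comp_perm ![a, b, c, d] (Equiv.swap 0 1)]
  congr 1
  ext i
  fin_cases i <;> rfl

lemma circumcenter_four_swap' (a b c d : E3) :
    circumcenter ![a, c, b, d] = circumcenter ![a, b, c, d] := by
  rw [← circumcenter_comp_perm ![a, b, c, d] (Equiv.swap 1 2)]
  congr 1
  ext i
  fin_cases i <;> rfl

lemma circumcenter_four_swap'' (a b c d : E3) :
    circumcenter ![a, b, d, c] = circumcenter ![a, b, c, d] := by
  rw [← circumcenter_comp_perm ![a, b, c, d] (Equiv.swap 2 3)]
  congr 1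
  ext i
  fin_cases i <;> rfl

/-- The oriented volume of `a, b, c, d`, times six. -/
def orient (a b c d : E3) : ℝ := det3 (b - a) (c - a) (d - a)

lemma orient_swap (a b c d : E3) : orient b a c d = -orient a b c d := by
  simp only [orient, det3_eq, PiLp.sub_apply]; ring

lemma orient_swap' (a b c d : E3) : orient a c b d = -orient a b c d := by
  simp only [orient, det3_eq, PiLp.sub_apply]; ring

lemma orient_swap'' (a b c d : E3) : orient a b d c = -orient a b c d := by
  simp only [orient, det3_eq, PiLp.sub_apply]; ring

/-- When `t` lies in the plane of `a b c`, the signed triangles from `t` over the three edges tile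
the face; the last term vanishes there. -/
lemma orient_five (a b c t x : E3) : orient a b t x + orient b c t x + orient c a t x =
    orient a b c x - orient a b c t := by
  simp only [orient, det3_eq, PiLp.sub_apply]; ring

lemma orient_five' (a b c d x : E3) :
    orient a b c x + orient a d b x + orient a c d x + orient b d c x = orient a b c d := by
  simp only [orient, det3_eq, PiLp.sub_apply]; ring

/-- The midpoint cuts the tetrahedron `a b t x` into the Rogers simplices at `a` and `b`, which have
opposite orientations. -/
lemma det3_midpoint (a b t x : E3) :
    det3 (midpoint ℝ a b - a) (t - a) (x - a) - det3 (midpoint ℝ b a - b) (t - b) (x - b) =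
      orient a b t x := by
  simp only [orient, det3_eq, PiLp.sub_apply, midpoint_eq_smul_add, PiLp.add_apply, PiLp.smul_apply,
    smul_eq_mul, invOf_eq_inv]
  ring

lemma rogersVolume_four (a b c d : E3) : rogersVolume ![a, b, c, d] =
    SignType.sign (orient a b c d) * det3 (midpoint ℝ a b - a) (circumcenter ![a, b, c] - a)
      (circumcenter ![a, b, c, d] - a) / 6 := rfl

lemma sign_neg_coe (x : ℝ) : ((SignType.sign (-x) : SignType) : ℝ) = -(SignType.sign x : ℝ) := by
  rw [Left.sign_neg, SignType.coe_neg]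

lemma rogersVolume_add_swap (a b c d : E3) :
    rogersVolume ![a, b, c, d] + rogersVolume ![b, a, c, d] = SignType.sign (orient a b c d) *
      orient a b (circumcenter ![a, b, c]) (circumcenter ![a, b, c, d]) / 6 := by
  rw [rogersVolume_four, rogersVolume_four b, circumcenter_three_swap a b c,
    circumcenter_four_swap a b c d, orient_swap a b c d, sign_neg_coe,
    ← det3_midpoint a b (circumcenter ![a, b, c]) (circumcenter ![a, b, c, d])]
  ring

lemma exists_circumcenter_sub_eq {a b c : E3} (h : AffineIndependent ℝ ![a, b, c]) :
    ∃ y z : ℝ, y • (b - a) + z • (c - a) = circumcenter ![a, b, c] - a := by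
  have hmem : circumcenter ![a, b, c] ∈ affineSpan ℝ (Set.range ![a, b, c]) := by
    rw [circumcenter, dif_pos h]
    exact (⟨_, h⟩ : Affine.Simplex ℝ E3 2).circumcenter_mem_affineSpan
  have hr : Set.range ![a, b, c] = {a, b, c} := by
    simp only [Matrix.range_cons, Matrix.range_empty, Set.union_empty, Set.singleton_union]
  have ha : a ∈ ({a, b, c} : Set E3) := by simp
  rw [hr] at hmem
  have h1 := AffineSubspace.vsub_mem_direction hmem (mem_affineSpan ℝ ha)
  rw [direction_affineSpan, vectorSpan_eq_span_vsub_set_right ℝ ha, Set.image_insert_eq,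
    Set.image_pair, Submodule.mem_span_triple] at h1
  obtain ⟨x, y, z, h1⟩ := h1
  simp only [vsub_eq_sub, sub_self, smul_zero, zero_add] at h1
  exact ⟨y, z, h1⟩

lemma orient_circumcenter {a b c : E3} (h : AffineIndependent ℝ ![a, b, c]) :
    orient a b c (circumcenter ![a, b, c]) = 0 := by
  obtain ⟨y, z, h1⟩ := exists_circumcenter_sub_eq h
  rw [orient, ← h1]
  simp only [det3_eq, PiLp.add_apply, PiLp.smul_apply, smul_eq_mul]
  ring

/-- Pairs of Rogers simplices join along the edges of the face, and the three edges then join around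
its circumcenter, leaving the signed cone over the face from the circumcenter of the simplex. -/
lemma sum_rogersVolume_face {a b c : E3} (d : E3) (h : AffineIndependent ℝ ![a, b, c]) :
    rogersVolume ![a, b, c, d] + rogersVolume ![b, a, c, d] + (rogersVolume ![b, c, a, d] +
      rogersVolume ![c, b, a, d]) + (rogersVolume ![c, a, b, d] + rogersVolume ![a, c, b, d]) =
      SignType.sign (orient a b c d) * orient a b c (circumcenter ![a, b, c, d]) / 6 := by
  have e1 : orient b c a d = orient a b c d := by rw [orient_swap', orient_swap, neg_neg]
  have e2 : orient c a b d = orient a b c d := by rw [orient_swap, orient_swap', neg_neg]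
  have e3 : circumcenter ![b, c, a] = circumcenter ![a, b, c] := by
    rw [circumcenter_three_swap', circumcenter_three_swap]
  have e4 : circumcenter ![c, a, b] = circumcenter ![a, b, c] := by
    rw [circumcenter_three_swap, circumcenter_three_swap']
  have e5 : circumcenter ![b, c, a, d] = circumcenter ![a, b, c, d] := by
    rw [circumcenter_four_swap', circumcenter_four_swap]
  have e6 : circumcenter ![c, a, b, d] = circumcenter ![a, b, c, d] := by
    rw [circumcenter_four_swap, circumcenter_four_swap']
  rw [rogersVolume_add_swap, rogersVolume_add_swap, rogersVolume_add_swap, e1, e2, e3, e4, e5, e6]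
  have := orient_five a b c (circumcenter ![a, b, c]) (circumcenter ![a, b, c, d])
  rw [orient_circumcenter h, sub_zero] at this
  rw [← this]
  ring

lemma voronoiVolume_eq [DecidableEq E3] {a b c d : E3} (hab : a ≠ b) (hac : a ≠ c) (had : a ≠ d) (hbc : b ≠ c)
    (hbd : b ≠ d) (hcd : c ≠ d) : voronoiVolume {a, b, c, d} a =
      rogersVolume ![a, b, c, d] + rogersVolume ![a, b, d, c] + rogersVolume ![a, c, b, d] +
        rogersVolume ![a, c, d, b] + rogersVolume ![a, d, b, c] + rogersVolume ![a, d, c, b] := by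
  classical
  have hinj : ∀ {x y z w x' y' z' w' : E3}, (![x, y, z, w] : Fin 4 → E3) = ![x', y', z', w'] ↔
      x = x' ∧ y = y' ∧ z = z' ∧ w = w' := by
    intros
    constructor
    · intro h
      exact ⟨congrFun h 0, congrFun h 1, congrFun h 2, congrFun h 3⟩
    · rintro ⟨rfl, rfl, rfl, rfl⟩; rfl
  have hset : {f : Fin 4 → E3 | f 0 = a ∧ Set.range f = (({a, b, c, d} : Finset E3) : Set E3)} =
      (({![a, b, c, d], ![a, b, d, c], ![a, c, b, d], ![a, c, d, b], ![a, d, b, c], ![a, d, c, b]} :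
        Finset (Fin 4 → E3)) : Set (Fin 4 → E3)) := by
    ext f
    have hf : f = ![f 0, f 1, f 2, f 3] := by ext i; fin_cases i <;> rfl
    rw [Finset.mem_coe, hf]
    simp only [Finset.mem_insert, Finset.mem_singleton, hinj]
    constructor
    · rintro ⟨h0, hr⟩
      rw [← hf] at hr
      change f 0 = a at h0
      have key : ∀ x ∈ ({a, b, c, d} : Finset E3), ∃ i, f i = x := fun x hx => by
        have : x ∈ Set.range f := by rw [hr]; exact hx
        exact this
      have hb := exists_fin_four.1 (key b (by simp))
      have hc := exists_fin_four.1 (key c (by simp))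
      have hd := exists_fin_four.1 (key d (by simp))
      grind
    · have hr : Set.range ![f 0, f 1, f 2, f 3] = {f 0, f 1, f 2, f 3} := by
        simp only [Matrix.range_cons, Matrix.range_empty, Set.union_empty, Set.singleton_union]
      rw [Set.mem_ofPred_eq, hr]
      rintro (⟨h0, h1, h2, h3⟩ | ⟨h0, h1, h2, h3⟩ | ⟨h0, h1, h2, h3⟩ | ⟨h0, h1, h2, h3⟩ |
        ⟨h0, h1, h2, h3⟩ | ⟨h0, h1, h2, h3⟩) <;> rw [h0, h1, h2, h3] <;> refine ⟨rfl, ?_⟩ <;>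
        ext x <;> simp <;> tauto
  rw [voronoiVolume, hset, finsum_mem_coe_finset]
  have n1 := hab.symm
  have n2 := hac.symm
  have n3 := had.symm
  have n4 := hbc.symm
  have n5 := hbd.symm
  have n6 := hcd.symm
  repeat rw [Finset.sum_insert (by simp only [Finset.mem_insert, Finset.mem_singleton, hinj]; tauto)]
  rw [Finset.sum_singleton]
  ring

end Kepler

/-! ### Total Voronoi volume and a lower bound for volumes of simplices -/

namespace Kepler

variable {P : Set E3} {c : Finset E3 → E3 × E3}

lemma affineIndependent_of_mem {S : Finset E3} (h : AffineIndependent ℝ (fun x : S => (x : E3)))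
    {n : ℕ} {g : Fin n → E3} (hg : ∀ i, g i ∈ S) (hinj : Function.Injective g) :
    AffineIndependent ℝ g :=
  h.comp_embedding ⟨fun i => (⟨g i, hg i⟩ : S), fun _ _ hij => hinj (congrArg Subtype.val hij)⟩

lemma injective_three {α : Type*} {a b c : α} (hab : a ≠ b) (hac : a ≠ c) (hbc : b ≠ c) :
    Function.Injective ![a, b, c] := by
  intro i j hij
  fin_cases i <;> fin_cases j <;> first | rfl | (exfalso; simp at hij; tauto)

lemma exists_four_of_card [DecidableEq E3] {S : Finset E3} (h : S.card = 4) : ∃ a b c d, a ≠ b ∧ a ≠ c ∧ a ≠ d ∧ b ≠ c ∧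
    b ≠ d ∧ c ≠ d ∧ S = {a, b, c, d} := by
  obtain ⟨a, T, ha, rfl, hT⟩ := Finset.card_eq_succ.1 h
  obtain ⟨b, c, d, hbc, hbd, hcd, rfl⟩ := Finset.card_eq_three.1 hT
  simp only [Finset.mem_insert, Finset.mem_singleton, not_or] at ha
  exact ⟨a, b, c, d, ha.1, ha.2.1, ha.2.2, hbc, hbd, hcd, by congr⟩

/-- The Voronoi volumes of a simplex at its vertices add up to its volume. -/
lemma sum_voronoiVolume {S : Finset E3} (hcard : S.card = 4)
    (h : AffineIndependent ℝ (fun x : S => (x : E3))) :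
    ∑ v ∈ S, voronoiVolume S v = volume.real (convexHull ℝ (S : Set E3)) := by
  classical
  obtain ⟨a, b, c, d, hab, hac, had, hbc, hbd, hcd, rfl⟩ := exists_four_of_card hcard
  have hind : ∀ {x y z : E3}, x ∈ ({a, b, c, d} : Finset E3) → y ∈ ({a, b, c, d} : Finset E3) →
      z ∈ ({a, b, c, d} : Finset E3) → x ≠ y → x ≠ z → y ≠ z → AffineIndependent ℝ ![x, y, z] := by
    intro x y z hx hy hz hxy hxz hyz
    refine affineIndependent_of_mem h (fun i => ?_) (injective_three hxy hxz hyz)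
    fin_cases i
    exacts [hx, hy, hz]
  rw [Finset.sum_insert (by simp [hab, hac, had]), Finset.sum_insert (by simp [hbc, hbd]),
    Finset.sum_insert (by simp [hcd]), Finset.sum_singleton, voronoiVolume_eq hab hac had hbc hbd hcd,
    show ({a, b, c, d} : Finset E3) = {b, a, c, d} by ext; simp; tauto,
    voronoiVolume_eq hab.symm hbc hbd hac had hcd,
    show ({b, a, c, d} : Finset E3) = {c, a, b, d} by ext; simp; tauto,
    voronoiVolume_eq hac.symm hbc.symm hcd hab had hbd,
    show ({c, a, b, d} : Finset E3) = {d, a, b, c} by ext; simp; tauto,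
    voronoiVolume_eq had.symm hbd.symm hcd.symm hab hac hbc]
  -- The 24 Rogers simplices are grouped by the face of their first three vertices. The four cones
  -- obtained make up the simplex by `orient_five'`, wherever the circumcenter lies.
  have f1 := sum_rogersVolume_face d (hind (x := a) (y := b) (z := c) (by simp) (by simp) (by simp)
    hab hac hbc)
  have f2 := sum_rogersVolume_face c (hind (x := a) (y := d) (z := b) (by simp) (by simp) (by simp)
    had hab hbd.symm)
  have f3 := sum_rogersVolume_face b (hind (x := a) (y := c) (z := d) (by simp) (by simp) (by simp)
    hac had hcd)
  have f4 := sum_rogersVolume_face a (hind (x := b) (y := d) (z := c) (by simp) (by simp) (by simp)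
    hbd hbc hcd.symm)
  have e2 : orient a d b c = orient a b c d := by rw [orient_swap', orient_swap'', neg_neg]
  have e3 : orient a c d b = orient a b c d := by rw [orient_swap'', orient_swap', neg_neg]
  have e4 : orient b d c a = orient a b c d := by
    rw [orient_swap'', orient_swap', orient_swap, orient_swap'', neg_neg, neg_neg]
  have c2 : circumcenter ![a, d, b, c] = circumcenter ![a, b, c, d] := by
    rw [circumcenter_four_swap', circumcenter_four_swap'']
  have c3 : circumcenter ![a, c, d, b] = circumcenter ![a, b, c, d] := by
    rw [circumcenter_four_swap'', circumcenter_four_swap']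
  have c4 : circumcenter ![b, d, c, a] = circumcenter ![a, b, c, d] := by
    rw [circumcenter_four_swap'', circumcenter_four_swap', circumcenter_four_swap,
      circumcenter_four_swap'']
  rw [e2, c2] at f2
  rw [e3, c3] at f3
  rw [e4, c4] at f4
  have hv : volume.real (convexHull ℝ (({d, a, b, c} : Finset E3) : Set E3)) =
      SignType.sign (orient a b c d) * orient a b c d / 6 := by
    rw [show (({d, a, b, c} : Finset E3) : Set E3) = {a, b, c, d} by ext; simp; tauto,
      volume_convexHull_four, sign_mul_self]
    rfl
  rw [hv]
  linear_combination f1 + f2 + f3 + f4 + (SignType.sign (orient a b c d) : ℝ) / 6 *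
    orient_five' a b c d (circumcenter ![a, b, c, d])

lemma orient_ne_zero {S : Finset E3} (hcard : S.card = 4)
    (h : AffineIndependent ℝ (fun x : S => (x : E3))) {f : Fin 4 → E3}
    (hf : Set.range f = (S : Set E3)) : orient (f 0) (f 1) (f 2) (f 3) ≠ 0 := by
  intro h0
  have hne : (interior (convexHull ℝ (S : Set E3))).Nonempty := by
    rw [interior_convexHull_nonempty_iff_affineSpan_eq_top]
    have := (vertexBasis hcard h).tot
    rwa [range_vertexBasis] at this
  have hpos := isOpen_interior.measure_pos (volume : Measure E3) hne
  have hr : (S : Set E3) = {f 0, f 1, f 2, f 3} := by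
    rw [← hf]
    ext x
    simp only [Set.mem_range, exists_fin_four, Set.mem_insert_iff, Set.mem_singleton_iff]
    simp only [eq_comm]
  have hv := volume_convexHull_four (f 0) (f 1) (f 2) (f 3)
  rw [show det3 (f 1 - f 0) (f 2 - f 0) (f 3 - f 0) = 0 from h0, ← hr, abs_zero, zero_div] at hv
  have hfin : volume (convexHull ℝ (S : Set E3)) ≠ ⊤ :=
    (S.finite_toSet.isCompact_convexHull (𝕜 := ℝ)).measure_lt_top.ne
  rw [measureReal_def, ENNReal.toReal_eq_zero_iff] at hv
  have := measure_mono_null interior_subset (hv.resolve_right hfin)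
  exact hpos.ne' this

/-- The tuples, starting at the origin, with the edges that the vertices of a candidate may have. -/
def edgeTuples : Set (Fin 4 → E3) :=
  {f | f 0 = 0 ∧ (∀ i j, i ≠ j → 2 ≤ dist (f i) (f j) ∧ dist (f i) (f j) ≤ √8) ∧
    ∀ i j k l, i ≠ k → i ≠ l → j ≠ k → j ≠ l →
      dist (f i) (f j) ≤ 2 * t0 ∨ dist (f k) (f l) ≤ 2 * t0}

/-- The conditions are relaxed to non-strict ones, so the set is closed; fixing the first point at
the origin makes it bounded. -/
lemma isCompact_edgeTuples : IsCompact edgeTuples := by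
  have hle : ∀ i j, IsClosed {f : Fin 4 → E3 | dist (f i) (f j) ≤ 2 * t0} := fun i j =>
    isClosed_le (by fun_prop) continuous_const
  have hcl : IsClosed edgeTuples := by
    simp only [edgeTuples, Set.ofPred_and, Set.ofPred_forall]
    refine (isClosed_eq (by fun_prop) continuous_const).inter (IsClosed.inter ?_ ?_)
    · refine isClosed_iInter fun i => isClosed_iInter fun j => isClosed_iInter fun _ => ?_
      exact (isClosed_le continuous_const (by fun_prop)).inter
        (isClosed_le (by fun_prop) continuous_const)
    · refine isClosed_iInter fun i => isClosed_iInter fun j => isClosed_iInter fun k =>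
        isClosed_iInter fun l => isClosed_iInter fun _ => isClosed_iInter fun _ =>
        isClosed_iInter fun _ => isClosed_iInter fun _ => ?_
      rw [Set.ofPred_or]
      exact (hle i j).union (hle k l)
  refine (isCompact_closedBall (0 : Fin 4 → E3) (√8)).of_isClosed_subset hcl ?_
  rintro f ⟨h0, h1, -⟩
  rw [mem_closedBall_zero_iff, pi_norm_le_iff_of_nonneg (by positivity)]
  intro i
  by_cases hi : i = 0
  · rw [hi, h0, norm_zero]; positivity
  · have := (h1 i 0 hi).2
    rwa [h0, dist_zero_right] at this

lemma orient_ne_zero_of_mem_edgeTuples {f : Fin 4 → E3} (hf : f ∈ edgeTuples) :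
    orient (f 0) (f 1) (f 2) (f 3) ≠ 0 := by
  classical
  obtain ⟨-, h1, h2⟩ := hf
  have hinj : Function.Injective f := fun i j hij => by
    by_contra hne
    have := (h1 i j hne).1
    rw [hij, dist_self] at this
    norm_num at this
  have hcard : (Finset.univ.image f).card = 4 := by
    rw [Finset.card_image_of_injective _ hinj]; rfl
  refine orient_ne_zero hcard (affineIndependent_of_edges ?_ hcard ?_ ?_) (by simp)
  · intro v hv w hw hvw
    simp only [Finset.coe_image, Finset.coe_univ, Set.image_univ, Set.mem_range] at hv hw
    obtain ⟨i, rfl⟩ := hv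
    obtain ⟨j, rfl⟩ := hw
    exact (h1 i j fun h => hvw (by rw [h])).1
  · simp only [Finset.mem_image, Finset.mem_univ, true_and, forall_exists_index,
      forall_apply_eq_imp_iff]
    intro i j
    by_cases hij : i = j
    · simp [hij]
    · have := (h1 i j hij).2
      calc dist (f i) (f j) ^ 2 ≤ √8 ^ 2 := by gcongr
        _ = 8 := Real.sq_sqrt (by norm_num)
  · simp only [Finset.mem_image, Finset.mem_univ, true_and, forall_exists_index,
      forall_apply_eq_imp_iff, hinj.ne_iff]
    intro i j k l a1 a2 a3 a4
    exact (h2 i j k l a1 a2 a3 a4).imp lt_sqrt_eight_of_le lt_sqrt_eight_of_le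

/-- The volumes of the candidates are bounded away from zero. -/
lemma exists_orient_lower_bound : ∃ ε > 0, ∀ (P : Set E3) (S : Finset E3), IsPacking P →
    IsCandidate P S → ∀ f : Fin 4 → E3, Set.range f = (S : Set E3) →
      ε ≤ |orient (f 0) (f 1) (f 2) (f 3)| := by
  have hcont : Continuous fun f : Fin 4 → E3 => |orient (f 0) (f 1) (f 2) (f 3)| := by
    simp only [orient, det3_eq, PiLp.sub_apply]
    fun_prop
  have hmem : ∀ (P : Set E3) (S : Finset E3), IsPacking P →
      IsCandidate P S → ∀ f : Fin 4 → E3, Set.range f = (S : Set E3) →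
      (fun i => f i - f 0) ∈ edgeTuples := by
    intro P S hP hS f hf
    have hfS : ∀ i, f i ∈ S := fun i => by
      have : f i ∈ (S : Set E3) := hf ▸ Set.mem_range_self i
      exact this
    have hinj : Function.Injective f := by
      have h1 : Fintype.card (Fin 4) = S.card := by rw [hS.card]; rfl
      have h2 : Function.Surjective (fun i => (⟨f i, hfS i⟩ : S)) := by
        rintro ⟨x, hx⟩
        have : x ∈ Set.range f := by rw [hf]; exact hx
        obtain ⟨i, rfl⟩ := this
        exact ⟨i, rfl⟩
      have h3 := (Fintype.bijective_iff_surjective_and_card (fun i => (⟨f i, hfS i⟩ : S))).2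
        ⟨h2, by simpa using h1⟩
      exact fun i j hij => h3.1 (Subtype.ext hij)
    refine ⟨sub_self _, fun i j hij => ?_, fun i j k l a1 a2 a3 a4 => ?_⟩
    · rw [dist_sub_right]
      exact ⟨hP _ (hS.1 (hfS i)) _ (hS.1 (hfS j)) (hinj.ne hij), (hS.dist_lt (hfS i) (hfS j)).le⟩
    · rw [dist_sub_right, dist_sub_right]
      by_cases hij : i = j
      · left; rw [hij, dist_self]; norm_num [t0]
      rcases hS.short_or_quarter (hfS i) (hfS j) (hinj.ne hij) with h | h
      · exact Or.inl h
      · right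
        by_contra! hc
        rcases h.eq_or_eq (hfS k) (hfS l) hc with h | h
        · exact a1 (hinj h.1).symm
        · exact a3 (hinj h.1).symm
  have htrans : ∀ f : Fin 4 → E3, orient (f 0 - f 0) (f 1 - f 0) (f 2 - f 0) (f 3 - f 0) =
      orient (f 0) (f 1) (f 2) (f 3) := fun f => by
    simp only [orient, sub_sub_sub_cancel_right]
  rcases edgeTuples.eq_empty_or_nonempty with he | hne
  · exact ⟨1, one_pos, fun P S hP hS f hf => absurd (hmem P S hP hS f hf) (by simp [he])⟩
  · obtain ⟨f₀, hf₀, hmin⟩ := isCompact_edgeTuples.exists_isMinOn hne hcont.continuousOn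
    refine ⟨_, abs_pos.2 (orient_ne_zero_of_mem_edgeTuples hf₀), fun P S hP hS f hf => ?_⟩
    have := hmin (hmem P S hP hS f hf)
    simp only [Set.mem_ofPred_eq] at this
    rwa [htrans] at this

/-- Cramer's rule: the cross products form the dual basis up to the determinant, so `x` is recovered
from its inner products with `u, v, w`. -/
lemma det3_smul_eq (u v w x : E3) (i : Fin 3) : det3 u v w * x i =
    inner ℝ x u * !₂[v 1 * w 2 - v 2 * w 1, v 2 * w 0 - v 0 * w 2, v 0 * w 1 - v 1 * w 0] i +
    inner ℝ x v * !₂[w 1 * u 2 - w 2 * u 1, w 2 * u 0 - w 0 * u 2, w 0 * u 1 - w 1 * u 0] i +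
    inner ℝ x w * !₂[u 1 * v 2 - u 2 * v 1, u 2 * v 0 - u 0 * v 2, u 0 * v 1 - u 1 * v 0] i := by
  simp only [det3_eq, PiLp.inner_apply, Fin.sum_univ_three, RCLike.inner_apply, conj_trivial]
  fin_cases i <;> simp <;> ring

lemma abs_coord_le_norm (x : E3) (i : Fin 3) : |x i| ≤ ‖x‖ := by
  have := PiLp.norm_apply_le x i
  rwa [Real.norm_eq_abs] at this

lemma abs_cross_le {u v : E3} {r : ℝ} (hu : ‖u‖ ≤ r) (hv : ‖v‖ ≤ r) (i j : Fin 3) :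
    |u i * v j - u j * v i| ≤ 2 * r ^ 2 := by
  have h : ∀ i j, |u i * v j| ≤ r ^ 2 := fun i j => by
    rw [abs_mul, sq]
    exact mul_le_mul ((abs_coord_le_norm u i).trans hu) ((abs_coord_le_norm v j).trans hv)
      (abs_nonneg _) ((norm_nonneg u).trans hu)
  have := abs_sub (u i * v j) (u j * v i)
  linarith [h i j, h j i]

lemma abs_det3_le {x y z : E3} {r s t : ℝ} (hx : ‖x‖ ≤ r) (hy : ‖y‖ ≤ s) (hz : ‖z‖ ≤ t) :
    |det3 x y z| ≤ 6 * (r * s * t) := by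
  have h : ∀ i j k, |x i * (y j * z k)| ≤ r * s * t := fun i j k => by
    rw [abs_mul, abs_mul, mul_assoc]
    have hr := (norm_nonneg x).trans hx
    have hs := (norm_nonneg y).trans hy
    exact mul_le_mul ((abs_coord_le_norm x i).trans hx) (mul_le_mul ((abs_coord_le_norm y j).trans hy)
      ((abs_coord_le_norm z k).trans hz) (abs_nonneg _) hs) (by positivity) hr
  have e : det3 x y z = x 0 * (y 1 * z 2) - x 0 * (y 2 * z 1) - x 1 * (y 0 * z 2) +
    x 1 * (y 2 * z 0) + x 2 * (y 0 * z 1) - x 2 * (y 1 * z 0) := by rw [det3_eq]; ring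
  rw [e]
  have a1 := abs_le.1 (h 0 1 2)
  have a2 := abs_le.1 (h 0 2 1)
  have a3 := abs_le.1 (h 1 0 2)
  have a4 := abs_le.1 (h 1 2 0)
  have a5 := abs_le.1 (h 2 0 1)
  have a6 := abs_le.1 (h 2 1 0)
  rw [abs_le]
  constructor <;> linarith

lemma norm_le_of_coord {x : E3} {r : ℝ} (h : ∀ i, |x i| ≤ r) : ‖x‖ ≤ 2 * r := by
  have hr : 0 ≤ r := (abs_nonneg _).trans (h 0)
  rw [EuclideanSpace.norm_eq, Real.sqrt_le_left (by positivity), Fin.sum_univ_three]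
  simp only [Real.norm_eq_abs]
  have := pow_le_pow_left₀ (abs_nonneg _) (h 0) 2
  have := pow_le_pow_left₀ (abs_nonneg _) (h 1) 2
  have := pow_le_pow_left₀ (abs_nonneg _) (h 2) 2
  nlinarith

/-- This is the linear equation of the bisector of `f 0` and `f i`, on which the circumcenter lies.
-/
lemma inner_circumcenter {n : ℕ} {f : Fin (n + 1) → E3} (h : AffineIndependent ℝ f) (i : Fin (n + 1)) :
    2 * inner ℝ (circumcenter f - f 0) (f i - f 0) = ‖f i - f 0‖ ^ 2 := by
  have h0 := (⟨f, h⟩ : Affine.Simplex ℝ E3 n).dist_circumcenter_eq_circumradius 0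
  have hi := (⟨f, h⟩ : Affine.Simplex ℝ E3 n).dist_circumcenter_eq_circumradius i
  rw [circumcenter, dif_pos h]
  set z := (⟨f, h⟩ : Affine.Simplex ℝ E3 n).circumcenter
  have e : dist (f i) z = dist (f 0) z := hi.trans h0.symm
  have e1 : f i - z = (f i - f 0) - (z - f 0) := by abel
  rw [dist_eq_norm, dist_eq_norm, norm_sub_rev (f 0), e1] at e
  have e2 := @norm_sub_sq_real E3 _ _ (f i - f 0) (z - f 0)
  rw [e, real_inner_comm] at e2
  linarith

end Kepler

/-! ### Bounds and totals of the scores -/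

namespace Kepler

variable {P : Set E3} {c : Finset E3 → E3 × E3}

lemma solidAngle_nonneg (v : E3) (C : Set E3) : 0 ≤ solidAngle v C :=
  mul_nonneg (by norm_num) measureReal_nonneg

lemma volume_real_ball_one (v : E3) : volume.real (Metric.ball v 1) = 4 / 3 * Real.pi := by
  rw [measureReal_def, EuclideanSpace.volume_ball_fin_three, ENNReal.ofReal_one, one_pow, one_mul,
    ENNReal.toReal_ofReal (by positivity)]
  ring

lemma solidAngle_le (v : E3) (C : Set E3) : solidAngle v C ≤ 4 * Real.pi := by
  have := measureReal_mono (μ := volume) (Set.inter_subset_right (s := coneAt v C) (t := Metric.ball v 1))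
    measure_ball_lt_top.ne
  rw [volume_real_ball_one] at this
  rw [solidAngle]
  linarith

lemma volume_le_of_subset {v : E3} {C : Set E3} (h : C ⊆ Metric.closedBall v 3) :
    volume.real C ≤ 36 * Real.pi := by
  have := measureReal_mono (μ := volume) h measure_closedBall_lt_top.ne
  rw [volume_real_closedBall v (by norm_num), volume_real_ball_one] at this
  linarith

lemma abs_sovo_le {v : E3} {C : Set E3} (h : C ⊆ Metric.closedBall v 3) :
    |sovo v C| ≤ 4 * (deltaOct * (36 * Real.pi) + 4 * Real.pi / 3) := by
  have h1 := volume_le_of_subset h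
  have h2 : 0 ≤ volume.real C := measureReal_nonneg
  have h3 := solidAngle_nonneg v C
  have h4 := solidAngle_le v C
  have hd := deltaOct_pos
  have h5 := mul_le_mul_of_nonneg_left h1 hd.le
  have h6 := mul_nonneg hd.le h2
  rw [sovo, abs_le]
  constructor <;> linarith

lemma IsCandidate.hull_subset {S : Finset E3} (hS : IsCandidate P S) {v : E3} (hv : v ∈ S) :
    convexHull ℝ (S : Set E3) ⊆ Metric.closedBall v 3 := by
  refine convexHull_min (fun w hw => ?_) (convex_closedBall v 3)
  have h8 : √8 ≤ 3 := Real.sqrt_le_left (by norm_num) |>.2 (by norm_num)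
  exact (hS.dist_lt hw hv).le.trans h8

lemma exists_four_of_mem [DecidableEq E3] {S : Finset E3} (h : S.card = 4) {v : E3} (hv : v ∈ S) :
    ∃ b c d, v ≠ b ∧ v ≠ c ∧ v ≠ d ∧ b ≠ c ∧ b ≠ d ∧ c ≠ d ∧ S = {v, b, c, d} := by
  have h3 : (S.erase v).card = 3 := by rw [Finset.card_erase_of_mem hv, h]
  obtain ⟨b, c, d, hbc, hbd, hcd, he⟩ := Finset.card_eq_three.1 h3
  have hn : v ∉ ({b, c, d} : Finset E3) := he ▸ Finset.notMem_erase v S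
  simp only [Finset.mem_insert, Finset.mem_singleton, not_or] at hn
  exact ⟨b, c, d, hn.1, hn.2.1, hn.2.2, hbc, hbd, hcd, by rw [← he, Finset.insert_erase hv]⟩

/-- The circumcenter of a face is the orthogonal projection of that of the simplex. -/
lemma norm_circumcenter_face_le {a b c d : E3} (h : AffineIndependent ℝ ![a, b, c, d])
    (h' : AffineIndependent ℝ ![a, b, c]) :
    ‖circumcenter ![a, b, c] - a‖ ≤ ‖circumcenter ![a, b, c, d] - a‖ := by
  obtain ⟨y, z, hyz⟩ := exists_circumcenter_sub_eq h'
  have x1 : 2 * inner ℝ (circumcenter ![a, b, c, d] - a) (b - a) = ‖b - a‖ ^ 2 := inner_circumcenter h 1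
  have x2 : 2 * inner ℝ (circumcenter ![a, b, c, d] - a) (c - a) = ‖c - a‖ ^ 2 := inner_circumcenter h 2
  have y1 : 2 * inner ℝ (circumcenter ![a, b, c] - a) (b - a) = ‖b - a‖ ^ 2 := inner_circumcenter h' 1
  have y2 : 2 * inner ℝ (circumcenter ![a, b, c] - a) (c - a) = ‖c - a‖ ^ 2 := inner_circumcenter h' 2
  set X := circumcenter ![a, b, c, d] - a
  set Y := circumcenter ![a, b, c] - a
  have eW : ∀ W : E3, inner ℝ W Y = y * inner ℝ W (b - a) + z * inner ℝ W (c - a) := fun W => by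
    rw [← hyz, inner_add_right, real_inner_smul_right, real_inner_smul_right]
  have e : inner ℝ Y Y = inner ℝ X Y := by
    rw [eW Y, eW X]
    linear_combination y / 2 * (y1 - x1) + z / 2 * (y2 - x2)
  have h1 := real_inner_le_norm X Y
  rw [← e, real_inner_self_eq_norm_sq, sq] at h1
  rcases (norm_nonneg Y).eq_or_lt with h0 | h0
  · rw [← h0]; exact norm_nonneg X
  · exact le_of_mul_le_mul_right h1 h0

lemma exists_rogersVolume_bound : ∃ B, ∀ (P : Set E3) (S : Finset E3), IsPacking P →
    IsCandidate P S → ∀ f : Fin 4 → E3, Function.Injective f → Set.range f = (S : Set E3) →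
      |rogersVolume f| ≤ B := by
  obtain ⟨ε, hε, hlow⟩ := exists_orient_lower_bound
  refine ⟨3 * (486 / ε) ^ 2, fun P S hP hS f hinj hf => ?_⟩
  have hfS : ∀ i, f i ∈ S := fun i => by
    have : f i ∈ (S : Set E3) := hf ▸ Set.mem_range_self i
    exact this
  have hf4 : f = ![f 0, f 1, f 2, f 3] := by ext i; fin_cases i <;> rfl
  have h := affineIndependent_of_mem (hS.affineIndependent hP) hfS hinj
  have h' : AffineIndependent ℝ ![f 0, f 1, f 2] := by
    refine affineIndependent_of_mem (hS.affineIndependent hP) (fun i => ?_)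
      (injective_three (hinj.ne (by decide)) (hinj.ne (by decide)) (hinj.ne (by decide)))
    fin_cases i
    exacts [hfS 0, hfS 1, hfS 2]
  have h8 : √8 ≤ 3 := Real.sqrt_le_left (by norm_num) |>.2 (by norm_num)
  have hu : ∀ i, ‖f i - f 0‖ ≤ 3 := fun i => by
    rw [← dist_eq_norm]
    exact (hS.dist_lt (hfS i) (hfS 0)).le.trans h8
  have hin : ∀ i, |inner ℝ (circumcenter f - f 0) (f i - f 0)| ≤ 9 / 2 := fun i => by
    have e := inner_circumcenter h i
    have := pow_le_pow_left₀ (norm_nonneg _) (hu i) 2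
    rw [abs_le]
    constructor <;> nlinarith [sq_nonneg ‖f i - f 0‖]
  -- The circumcenter solves a linear system of determinant at least `ε`. By Cramer's rule each
  -- coordinate is at most `3 * (9 / 2 * 18) / ε = 243 / ε`, and the norm at most twice that.
  have hX : ‖circumcenter f - f 0‖ ≤ 486 / ε := by
    have hle : ‖circumcenter f - f 0‖ ≤ 2 * (243 / ε) := by
      refine norm_le_of_coord fun i => ?_
      rw [le_div_iff₀ hε]
      have hmul := det3_smul_eq (f 1 - f 0) (f 2 - f 0) (f 3 - f 0) (circumcenter f - f 0) i
      have hb : ∀ k (j l : Fin 4),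
          |!₂[(f j - f 0) 1 * (f l - f 0) 2 - (f j - f 0) 2 * (f l - f 0) 1,
            (f j - f 0) 2 * (f l - f 0) 0 - (f j - f 0) 0 * (f l - f 0) 2,
            (f j - f 0) 0 * (f l - f 0) 1 - (f j - f 0) 1 * (f l - f 0) 0] k| ≤ 18 := by
        intro k j l
        have := fun k k' => (abs_cross_le (hu j) (hu l) k k').trans_eq (show 2 * (3 : ℝ) ^ 2 = 18 by norm_num)
        fin_cases k
        exacts [this 1 2, this 2 0, this 0 1]
      have ht : ∀ m j l, |inner ℝ (circumcenter f - f 0) (f m - f 0) *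
          !₂[(f j - f 0) 1 * (f l - f 0) 2 - (f j - f 0) 2 * (f l - f 0) 1,
            (f j - f 0) 2 * (f l - f 0) 0 - (f j - f 0) 0 * (f l - f 0) 2,
            (f j - f 0) 0 * (f l - f 0) 1 - (f j - f 0) 1 * (f l - f 0) 0] i| ≤ 81 := by
        intro m j l
        rw [abs_mul]
        calc _ ≤ (9 / 2 : ℝ) * 18 := mul_le_mul (hin m) (hb i j l) (abs_nonneg _) (by norm_num)
          _ = 81 := by norm_num
      have hsum : |det3 (f 1 - f 0) (f 2 - f 0) (f 3 - f 0) * (circumcenter f - f 0) i| ≤ 243 := by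
        rw [hmul]
        refine (abs_add_three _ _ _).trans ?_
        linarith [ht 1 2 3, ht 2 3 1, ht 3 1 2]
      rw [abs_mul] at hsum
      have := hlow P S hP hS f hf
      calc |(circumcenter f - f 0) i| * ε ≤ |(circumcenter f - f 0) i| *
            |det3 (f 1 - f 0) (f 2 - f 0) (f 3 - f 0)| := by gcongr; exact this
        _ ≤ 243 := by rw [mul_comm]; exact hsum
    calc _ ≤ _ := hle
      _ = _ := by ring
  have hY : ‖circumcenter ![f 0, f 1, f 2] - f 0‖ ≤ 486 / ε := by
    refine (norm_circumcenter_face_le (d := f 3) (by rwa [← hf4]) h').trans ?_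
    rwa [← hf4]
  have hm : ‖midpoint ℝ (f 0) (f 1) - f 0‖ ≤ 3 := by
    rw [midpoint_sub_left, norm_smul]
    have := hu 1
    norm_num
    linarith [norm_nonneg (f 1 - f 0)]
  have hd := abs_det3_le hm hY hX
  have hs : |(SignType.sign (det3 (f 1 - f 0) (f 2 - f 0) (f 3 - f 0)) : ℝ)| ≤ 1 := by
    rcases SignType.sign (det3 (f 1 - f 0) (f 2 - f 0) (f 3 - f 0)) with _ | _ | _ <;> simp
  rw [rogersVolume, abs_div, abs_mul, abs_of_pos (show (0 : ℝ) < 6 by norm_num), div_le_iff₀ (by norm_num)]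
  calc _ ≤ 1 * (6 * (3 * (486 / ε) * (486 / ε))) := mul_le_mul hs hd (abs_nonneg _) zero_le_one
    _ = _ := by ring

lemma exists_voronoiVolume_bound : ∃ B, ∀ (P : Set E3) (S : Finset E3), IsPacking P →
    IsCandidate P S → ∀ v ∈ S, |voronoiVolume S v| ≤ B := by
  classical
  obtain ⟨B, hB⟩ := exists_rogersVolume_bound
  refine ⟨6 * B, fun P S hP hS v hv => ?_⟩
  obtain ⟨b, c, d, h1, h2, h3, h4, h5, h6, rfl⟩ := exists_four_of_mem hS.card hv
  have key : ∀ {x y z w : E3}, x ≠ y → x ≠ z → x ≠ w → y ≠ z → y ≠ w → z ≠ w →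
      ({x, y, z, w} : Finset E3) = {v, b, c, d} → |rogersVolume ![x, y, z, w]| ≤ B := by
    intro x y z w e1 e2 e3 e4 e5 e6 he
    refine hB P _ hP hS _ (injective_four e1 e2 e3 e4 e5 e6) ?_
    rw [← he]
    simp only [Matrix.range_cons, Matrix.range_empty, Set.union_empty, Set.singleton_union,
      Finset.coe_insert, Finset.coe_singleton]
  rw [voronoiVolume_eq h1 h2 h3 h4 h5 h6]
  have k1 := abs_le.1 (key h1 h2 h3 h4 h5 h6 rfl)
  have k2 := abs_le.1 (key h1 h3 h2 h5 h4 h6.symm (by ext; simp; tauto))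
  have k3 := abs_le.1 (key h2 h1 h3 h4.symm h6 h5 (by ext; simp; tauto))
  have k4 := abs_le.1 (key h2 h3 h1 h6 h4.symm h5.symm (by ext; simp; tauto))
  have k5 := abs_le.1 (key h3 h1 h2 h5.symm h6.symm h4 (by ext; simp; tauto))
  have k6 := abs_le.1 (key h3 h2 h1 h6.symm h5.symm h4.symm (by ext; simp; tauto))
  rw [abs_le]
  constructor <;> linarith

lemma exists_mu_bound : ∃ B, ∀ (P : Set E3) (S : Finset E3), IsPacking P →
    IsCandidate P S → ∀ v ∈ S, |mu S v| ≤ B := by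
  obtain ⟨B, hB⟩ := exists_voronoiVolume_bound
  refine ⟨4 * (deltaOct * (36 * Real.pi) + 16 * Real.pi / 3) + 4 * (deltaOct * B),
    fun P S hP hS v hv => ?_⟩
  have hd := deltaOct_pos
  have hpi := Real.pi_pos
  have hBv := abs_le.1 (hB P S hP hS v hv)
  have hB0 : 0 ≤ B := (abs_nonneg _).trans (hB P S hP hS v hv)
  have b1 := mul_le_mul_of_nonneg_left hBv.1 hd.le
  have b2 := mul_le_mul_of_nonneg_left hBv.2 hd.le
  have b0 := mul_nonneg hd.le hB0
  have d0 := mul_pos hd hpi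
  have h3 := solidAngle_nonneg v (convexHull ℝ (S : Set E3))
  have h4 := solidAngle_le v (convexHull ℝ (S : Set E3))
  rw [mu]
  split_ifs with hc
  · have h1 := volume_le_of_subset (hS.hull_subset hv)
    have h2 : 0 ≤ volume.real (convexHull ℝ (S : Set E3)) := measureReal_nonneg
    have h5 := mul_le_mul_of_nonneg_left h1 hd.le
    have h6 := mul_nonneg hd.le h2
    have h7 : 0 ≤ ∑ v ∈ S, solidAngle v (convexHull ℝ (S : Set E3)) :=
      Finset.sum_nonneg fun v _ => solidAngle_nonneg v _
    have h8 : ∑ v ∈ S, solidAngle v (convexHull ℝ (S : Set E3)) ≤ 4 * (4 * Real.pi) := by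
      have := Finset.sum_le_card_nsmul S (fun v => solidAngle v (convexHull ℝ (S : Set E3)))
        (4 * Real.pi) fun v _ => solidAngle_le v _
      rw [hS.card] at this
      simpa using this
    rw [compression, abs_le]
    constructor <;> linarith
  · rw [vor, abs_le]
    constructor <;> linarith

/-- The scores of all simplices of Q-systems are uniformly bounded. -/
lemma exists_simplexScore_bound : ∃ B, ∀ (c : Finset E3 → E3 × E3) (P : Set E3), IsPacking P →
    ∀ S ∈ qSystem c P, ∀ v ∈ S, |(decompositionStar c P v).simplexScore S| ≤ B := by
  obtain ⟨B, hB⟩ := exists_mu_bound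
  set T := 4 * (deltaOct * (36 * Real.pi) + 4 * Real.pi / 3) with hT
  have hT0 : 0 ≤ T := by
    have := deltaOct_pos
    positivity
  refine ⟨B + T, fun c P hP S hS v hv => ?_⟩
  have hS := isCandidate_of_mem hS
  have ht : ∀ w, |vorTruncated S w| ≤ T := fun w => abs_sovo_le fun x hx =>
    Metric.mem_closedBall.2 (hx.2.1.trans (by norm_num [t0]))
  have hv' := abs_le.1 (hB P S hP hS v hv)
  have hB0 : 0 ≤ B := (abs_nonneg _).trans (hB P S hP hS v hv)
  have hup : ∀ w ∈ S, |(decompositionStar c P v).uprightScore S w| ≤ B + T := by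
    intro w hwS
    obtain ⟨hv1, hv2⟩ := hv'
    obtain ⟨hw1, hw2⟩ := abs_le.1 (hB P S hP hS w hwS)
    obtain ⟨s1, s2⟩ := abs_le.1 (ht v)
    obtain ⟨s3, s4⟩ := abs_le.1 (ht w)
    rw [DecompositionStar.uprightScore]
    split_ifs
    · exact (abs_le.2 ⟨hv1, hv2⟩).trans (by linarith)
    · have h : |(mu S v + mu S w) / 2| ≤ B + T := abs_le.2 ⟨by linarith, by linarith⟩
      exact h
    · have h : |(mu S v + mu S w) / 2 + (vorTruncated S v - vorTruncated S w) / 2| ≤ B + T :=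
        abs_le.2 ⟨by linarith, by linarith⟩
      exact h
  rw [DecompositionStar.simplexScore]
  split_ifs with h
  · exact hup _ h.choose_spec.2.2.1
  · exact (hB P S hP hS v hv).trans (by linarith)

/-- Compression is the same at all four vertices, and the analytic Voronoi scores have the same
total by `sum_voronoiVolume`. -/
lemma sum_mu (hP : IsPacking P) {S : Finset E3} (hS : IsCandidate P S) :
    ∑ v ∈ S, mu S v = -4 * deltaOct * volume.real (convexHull ℝ (S : Set E3)) +
      4 / 3 * ∑ v ∈ S, solidAngle v (convexHull ℝ (S : Set E3)) := by
  by_cases hc : IsCompressed S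
  · simp only [mu, if_pos hc, Finset.sum_const, hS.card, compression]
    rw [nsmul_eq_mul]
    push_cast
    ring
  · simp only [mu, if_neg hc, vor, ← Finset.mul_sum, Finset.sum_add_distrib, ← Finset.sum_div]
    rw [sum_voronoiVolume hS.card (hS.affineIndependent hP)]
    ring

lemma IsStrictQuarter.right_unique {p q w : E3} {S : Finset E3} (h : IsStrictQuarter p q S)
    (h' : IsStrictQuarter p w S) : w = q := by
  rcases h.eq_or_eq h'.2.1 h'.2.2.1 h'.2.2.2.1.1 with hh | hh
  · exact hh.2
  · exact absurd hh.1 h.ne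

lemma simplexScore_of_isStrictQuarter {p q : E3} {S : Finset E3} (h : IsStrictQuarter p q S) :
    (decompositionStar c P p).simplexScore S = (decompositionStar c P p).uprightScore S q := by
  have hex : ∃ w, IsStrictQuarter (decompositionStar c P p).center w S := ⟨q, h⟩
  rw [DecompositionStar.simplexScore, dif_pos hex, h.right_unique hex.choose_spec]

/-- Anchors are within `2 * t0 < 4` of the center, so the truncation in the star loses none. -/
lemma anchorCount_decompositionStar (p q : E3) :
    (decompositionStar c P p).anchorCount q = (anchors P p q).ncard := by
  have : anchors (P ∩ Metric.closedBall p 4) p q = anchors P p q := by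
    ext u
    simp only [anchors, Set.mem_ofPred_eq, Set.mem_inter_iff, Metric.mem_closedBall]
    refine ⟨fun h => ⟨h.1.1, h.2⟩, fun h => ⟨⟨h.1, h.2.1.trans (by norm_num [t0])⟩, h.2⟩⟩
  change (anchors (P ∩ Metric.closedBall p 4) p q).ncard = _
  rw [this]

lemma quarterCount_decompositionStar (p q : E3) :
    (decompositionStar c P p).quarterCount q = {S | S ∈ qSystem c P ∧ IsStrictQuarter p q S}.ncard := by
  change {S | (S ∈ qSystem c P ∧ p ∈ S) ∧ IsStrictQuarter p q S}.ncard = _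
  congr 1
  ext S
  exact ⟨fun h => ⟨h.1.1, h.2⟩, fun h => ⟨⟨h.1, h.2.2.1⟩, h.2⟩⟩

/-- Both ends of the diagonal see the same numbers of anchors and quarters, hence fall under the
same case; the truncated correction is antisymmetric in the ends. -/
lemma uprightScore_add {p q : E3} {S : Finset E3} :
    (decompositionStar c P p).uprightScore S q + (decompositionStar c P q).uprightScore S p =
      mu S p + mu S q := by
  have hs : {S | S ∈ qSystem c P ∧ IsStrictQuarter q p S} =
      {S | S ∈ qSystem c P ∧ IsStrictQuarter p q S} := by
    ext S
    exact ⟨fun h => ⟨h.1, h.2.swap⟩, fun h => ⟨h.1, h.2.swap⟩⟩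
  rw [DecompositionStar.uprightScore, DecompositionStar.uprightScore, anchorCount_decompositionStar,
    anchorCount_decompositionStar, quarterCount_decompositionStar, quarterCount_decompositionStar,
    anchors_swap P q p, hs]
  change (if _ then mu S p else if _ then (mu S p + mu S q) / 2 else
      (mu S p + mu S q) / 2 + (vorTruncated S p - vorTruncated S q) / 2) +
    (if _ then mu S q else if _ then (mu S q + mu S p) / 2 else
      (mu S q + mu S p) / 2 + (vorTruncated S q - vorTruncated S p) / 2) = _
  split_ifs <;> ring

/-- The scores of a simplex at its vertices add up to four times its compression. -/
lemma sum_simplexScore (hP : IsPacking P) {S : Finset E3} (hS : S ∈ qSystem c P) :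
    ∑ v ∈ S, (decompositionStar c P v).simplexScore S =
      -4 * deltaOct * volume.real (convexHull ℝ (S : Set E3)) +
        4 / 3 * ∑ v ∈ S, solidAngle v (convexHull ℝ (S : Set E3)) := by
  classical
  have hcand := isCandidate_of_mem hS
  rw [← sum_mu hP hcand]
  have hmu : ∀ v, (¬∃ w, IsStrictQuarter v w S) → (decompositionStar c P v).simplexScore S = mu S v :=
    fun v (hv : ¬∃ w, IsStrictQuarter (decompositionStar c P v).center w S) => by
      rw [DecompositionStar.simplexScore, dif_neg hv]; rfl
  by_cases hq : ∃ p q, IsStrictQuarter p q S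
  · obtain ⟨p, q, hpq⟩ := hq
    rw [← sub_eq_zero, ← Finset.sum_sub_distrib, ← Finset.sum_subset (s₁ := {p, q})
      (Finset.insert_subset hpq.2.1 (Finset.singleton_subset_iff.2 hpq.2.2.1)),
      Finset.sum_pair hpq.ne, simplexScore_of_isStrictQuarter hpq,
      simplexScore_of_isStrictQuarter hpq.swap]
    · linarith [uprightScore_add (c := c) (P := P) (p := p) (q := q) (S := S)]
    · intro v hv hn
      simp only [Finset.mem_insert, Finset.mem_singleton, not_or] at hn
      rw [hmu, sub_self]
      rintro ⟨w, hw⟩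
      rcases hpq.eq_or_eq hw.2.1 hw.2.2.1 hw.2.2.2.1.1 with h | h
      · exact hn.1 h.1
      · exact hn.2 h.1
  · exact Finset.sum_congr rfl fun v _ => hmu v fun ⟨w, hw⟩ => hq ⟨v, w, hw⟩

end Kepler

/-! ### Summation over a ball and negligibility -/

namespace Kepler

variable {P : Set E3} {c : Finset E3 → E3 × E3}

/-- The simplices at `v` are subsets of the at most `(3 + 1) ^ 3 = 64` centers within distance
three. -/
lemma card_qSystem_le (hP : IsPacking P) (v : E3) :
    (qSystem_finite_of_mem (c := c) hP v).toFinset.card ≤ 2 ^ 64 := by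
  classical
  set B := (hP.finite_inter v 3).toFinset with hB
  have hsub : (qSystem_finite_of_mem (c := c) hP v).toFinset ⊆ B.powerset := by
    intro S hS
    rw [Set.Finite.mem_toFinset] at hS
    rw [Finset.mem_powerset]
    intro w hw
    rw [hB, Set.Finite.mem_toFinset]
    exact ⟨hS.1.1 hw, (isCandidate_of_mem hS.1).hull_subset hS.2 (subset_convexHull ℝ _ hw)⟩
  have hcard : (B.card : ℝ) ≤ (3 + 1) ^ 3 := hP.card_le (x := v) (by norm_num) (by simp [hB])
  have hcard : B.card ≤ 64 := by
    have : (B.card : ℝ) ≤ (64 : ℕ) := hcard.trans (by norm_num)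
    exact_mod_cast this
  calc _ ≤ B.powerset.card := Finset.card_le_card hsub
    _ = 2 ^ B.card := Finset.card_powerset B
    _ ≤ 2 ^ 64 := Nat.pow_le_pow_right (by norm_num) hcard

/-- The unit balls around these centers are disjoint and fit between the radii `r - 4` and `r + 1`.
For `r ≤ 4` the whole ball is counted, and `-(r - 4) ^ 3` is nonnegative. -/
lemma IsPacking.card_shell_le (hP : IsPacking P) {F : Finset E3} {x : E3} {r : ℝ} (hr : 1 ≤ r)
    (hF : ∀ v ∈ F, v ∈ P ∧ dist v x ≤ r ∧ r - 3 < dist v x) : (F.card : ℝ) ≤ 80 * r ^ 2 := by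
  have hle : (F.card : ℝ) ≤ (r + 1) ^ 3 - (r - 4) ^ 3 := by
    rcases le_total r 4 with h4 | h4
    · have h1 := hP.card_le (F := F) (x := x) (r := r) (by linarith)
        fun v hv => ⟨(hF v hv).1, (hF v hv).2.1⟩
      have h2 : (r - 4) ^ 3 ≤ 0 := (Odd.pow_nonpos_iff (by decide)).2 (by linarith)
      linarith
    · have h := hP.card_mul_le (F := F)
        (A := Metric.closedBall x (r + 1) \ Metric.closedBall x (r - 4)) (fun v hv => (hF v hv).1)
        (fun v hv y hy => by
          have h1 := (hF v hv).2
          have h2 := Metric.mem_ball.1 hy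
          simp only [Set.mem_sdiff, Metric.mem_closedBall, not_le]
          refine ⟨by linarith [dist_triangle y v x], ?_⟩
          have := dist_triangle v y x
          rw [dist_comm v y] at this
          linarith)
        (measure_ne_top_of_subset Set.sdiff_subset measure_closedBall_lt_top.ne)
      rw [measureReal_sdiff (Metric.closedBall_subset_closedBall (by linarith))
        measurableSet_closedBall measure_closedBall_lt_top.ne,
        volume_real_closedBall _ (by linarith), volume_real_closedBall _ (by linarith),
        ← sub_mul] at h
      exact le_of_mul_le_mul_right h volume_ball_pos
  nlinarith

lemma IsSaturated.voronoiCell_subset (hP : IsSaturated P) (v : E3) :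
    voronoiCell P v ⊆ Metric.ball v 2 := by
  intro y hy
  obtain ⟨w, hw, hyw⟩ := hP.2 y
  by_cases h : w = v
  · exact h ▸ hyw
  · exact (hy w hw h).trans hyw

/-- Almost every point lies in a Voronoi cell. -/
lemma IsSaturated.ae_mem_voronoiCell (hP : IsSaturated P) :
    ∀ᵐ y : E3, ∃ v ∈ P, y ∈ voronoiCell P v := by
  have hc : Countable P := hP.1.countable.to_subtype
  have h : ∀ᵐ y : E3, ∀ v w : P, (v : E3) ≠ w → dist y v ≠ dist y w := by
    refine ae_all_iff.2 fun v => ae_all_iff.2 fun w => ?_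
    by_cases hvw : (v : E3) = w
    · simp [hvw]
    · have := Measure.addHaar_affineSubspace volume (AffineSubspace.perpBisector (v : E3) w)
        (fun h => hvw (AffineSubspace.perpBisector_eq_top.1 h))
      filter_upwards [measure_eq_zero_iff_ae_notMem.1 this] with y hy _
      rwa [SetLike.mem_coe, AffineSubspace.mem_perpBisector_iff_dist_eq] at hy
  filter_upwards [h] with y hy
  obtain ⟨u, hu, hyu⟩ := hP.2 y
  obtain ⟨v, hv, hmin⟩ := Set.exists_min_image _ (fun v => dist y v) (hP.1.finite_inter y 2)
    ⟨u, hu, by rw [Metric.mem_closedBall, dist_comm]; exact hyu.le⟩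
  refine ⟨v, hv.1, fun w hw hwv => lt_of_le_of_ne ?_ (hy ⟨v, hv.1⟩ ⟨w, hw⟩ hwv.symm)⟩
  by_cases h2 : dist y w ≤ 2
  · exact hmin w ⟨hw, by rwa [Metric.mem_closedBall, dist_comm]⟩
  · refine le_trans ?_ (not_le.1 h2).le
    have := hv.2
    rwa [Metric.mem_closedBall, dist_comm] at this

/-- The Voronoi cells of the centers in a ball cover a slightly smaller ball. -/
lemma IsSaturated.le_sum_volume_voronoiCell (hP : IsSaturated P) {x : E3} {r : ℝ} {V : Finset E3}
    (hV : (V : Set E3) = P ∩ Metric.closedBall x r) :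
    (r - 2) ^ 3 * volume.real (Metric.ball (0 : E3) 1) ≤ ∑ v ∈ V, volume.real (voronoiCell P v) := by
  rcases le_total r 2 with h2 | h2
  · refine le_trans (mul_nonpos_of_nonpos_of_nonneg ?_ measureReal_nonneg)
      (Finset.sum_nonneg fun v _ => measureReal_nonneg)
    exact (Odd.pow_nonpos_iff (by decide)).2 (by linarith)
  rw [← volume_real_closedBall x (by linarith)]
  refine le_trans ?_ (measureReal_biUnion_finset_le V (voronoiCell P))
  refine ENNReal.toReal_mono ?_ (measure_mono_ae ?_)
  · exact ((measure_biUnion_finset_le V _).trans_lt (ENNReal.sum_lt_top.2 fun v _ =>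
      (measure_mono (hP.voronoiCell_subset v)).trans_lt measure_ball_lt_top)).ne
  · filter_upwards [hP.ae_mem_voronoiCell] with y hy hyx
    obtain ⟨v, hv, hyv⟩ := hy
    refine Set.mem_iUnion₂.2 ⟨v, ?_, hyv⟩
    have h3 := Metric.mem_ball.1 (hP.voronoiCell_subset v hyv)
    have h4 : dist y x ≤ r - 2 := hyx
    have : v ∈ (V : Set E3) := by
      rw [hV]
      refine ⟨hv, ?_⟩
      have := dist_triangle v y x
      rw [dist_comm v y] at this
      rw [Metric.mem_closedBall]
      linarith
    exact this

lemma residue_subset (v : E3) : residue c P v ⊆ Metric.ball v 2 := fun _ hx => hx.1.1.2.1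

/-- The residues of the centers in a ball and the simplices of the Q-system with vertices in this
ball fit into a slightly larger ball. -/
lemma sum_volume_le (hc : IsDiagonalChoice c) (hP : IsPacking P) {x : E3} {r : ℝ} (hr : 0 ≤ r)
    {V : Finset E3} (hV : (V : Set E3) ⊆ Metric.closedBall x r) {T : Finset (Finset E3)}
    (hT : ∀ S ∈ T, S ∈ qSystem c P ∧ S ⊆ V) :
    ∑ v ∈ V, volume.real (residue c P v) + ∑ S ∈ T, volume.real (convexHull ℝ (S : Set E3)) ≤
      (r + 2) ^ 3 * volume.real (Metric.ball (0 : E3) 1) := by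
  have hG : ⋃ v ∈ V, residue c P v ⊆ Metric.closedBall x (r + 2) := by
    refine Set.iUnion₂_subset fun v hv y hy => ?_
    have h1 := Metric.mem_ball.1 (residue_subset v hy)
    have h2 := Metric.mem_closedBall.1 (hV hv)
    rw [Metric.mem_closedBall]
    linarith [dist_triangle y v x]
  have hH : ⋃ S ∈ T, convexHull ℝ (S : Set E3) ⊆ Metric.closedBall x (r + 2) := by
    refine Set.iUnion₂_subset fun S hS => convexHull_min (fun v hv => ?_) (convex_closedBall _ _)
    exact Metric.closedBall_subset_closedBall (by linarith) (hV ((hT S hS).2 hv))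
  have hfin : volume (Metric.closedBall x (r + 2)) ≠ ⊤ := measure_closedBall_lt_top.ne
  have hGi : ∀ v ∈ V, volume (residue c P v) ≠ ⊤ := fun v hv =>
    measure_ne_top_of_subset ((Set.subset_iUnion₂ (s := fun v _ => residue c P v) v hv).trans hG) hfin
  have hHi : ∀ S ∈ T, volume (convexHull ℝ (S : Set E3)) ≠ ⊤ := fun S hS =>
    measure_ne_top_of_subset ((Set.subset_iUnion₂
      (s := fun (S : Finset E3) _ => convexHull ℝ (S : Set E3)) S hS).trans hH) hfin
  rw [← measureReal_biUnion_finset₀ (f := residue c P) (fun v _ w _ hvw => (Disjoint.aedisjoint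
      ((disjoint_vCell hvw).mono Set.sdiff_subset Set.sdiff_subset)))
      (fun v _ => (measurableSet_residue hP v).nullMeasurableSet) hGi,
    ← measureReal_biUnion_finset₀ (fun S hS S' hS' hne =>
      aedisjoint_hull hc hP (hT S hS).1 (hT S' hS').1 hne)
      (fun S _ => (measurableSet_convexHull S).nullMeasurableSet) hHi,
    ← measureReal_union₀ (Finset.measurableSet_biUnion T fun S _ =>
      measurableSet_convexHull S).nullMeasurableSet ?_ (measure_ne_top_of_subset hG hfin)
      (measure_ne_top_of_subset hH hfin), ← volume_real_closedBall x (by linarith)]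
  · exact measureReal_mono (Set.union_subset hG hH) hfin
  · rw [AEDisjoint, Set.iUnion₂_inter]
    refine (measure_biUnion_null_iff V.countable_toSet).2 fun v _ => ?_
    rw [Set.inter_iUnion₂]
    refine (measure_biUnion_null_iff T.countable_toSet).2 fun S hS => ?_
    exact aedisjoint_residue_hull hP (hT S hS).1

/-- In `-σ` the solid angle of the residue has a negative sign, so the lower bound from
`four_pi_le_solidAngle` may replace it. -/
lemma neg_sigma_le (hP : IsPacking P) {v : E3} (hv : v ∈ P) :
    -(decompositionStar c P v).sigma ≤ 4 * deltaOct * volume.real (residue c P v) -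
      16 * Real.pi / 3 + ∑ S ∈ (qSystem_finite_of_mem (c := c) hP v).toFinset,
        (4 / 3 * solidAngle v (convexHull ℝ (S : Set E3)) -
          (decompositionStar c P v).simplexScore S) := by
  have h1 : (decompositionStar c P v).sigma = sovo v (residue c P v) +
      ∑ S ∈ (qSystem_finite_of_mem (c := c) hP v).toFinset,
        (decompositionStar c P v).simplexScore S := by
    rw [← finsum_mem_eq_finite_toFinset_sum]
    rfl
  have h2 := four_pi_le_solidAngle (c := c) hP hv
  rw [h1, sovo, Finset.sum_sub_distrib, ← Finset.mul_sum]
  linarith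

/-- In a sum over the vertices in a ball, only the simplices that stick out of the ball contribute
more than four times their volume, and these are at vertices close to the boundary. -/
lemma exists_sum_excess_le : ∃ K : ℝ, ∀ (c : Finset E3 → E3 × E3) (P : Set E3) (hP : IsPacking P)
    (x : E3) (r : ℝ), 1 ≤ r → ∀ V : Finset E3, (V : Set E3) = P ∩ Metric.closedBall x r →
      ∃ T : Finset (Finset E3), (∀ S ∈ T, S ∈ qSystem c P ∧ S ⊆ V) ∧
        ∑ v ∈ V, ∑ S ∈ (qSystem_finite_of_mem (c := c) hP v).toFinset,
          (4 / 3 * solidAngle v (convexHull ℝ (S : Set E3)) -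
            (decompositionStar c P v).simplexScore S) ≤
        4 * deltaOct * ∑ S ∈ T, volume.real (convexHull ℝ (S : Set E3)) + K * r ^ 2 := by
  classical
  obtain ⟨B, hB⟩ := exists_simplexScore_bound
  set M : ℝ := 16 * Real.pi / 3 + |B| with hM
  have hM0 : 0 ≤ M := by positivity
  refine ⟨2 ^ 64 * M * 80, fun c P hP x r hr V hV => ?_⟩
  have hVP : ∀ v, v ∈ V ↔ v ∈ P ∧ dist v x ≤ r := fun v => by
    rw [← Finset.mem_coe, hV]; rfl
  set Q : E3 → Finset (Finset E3) := fun v => (qSystem_finite_of_mem (c := c) hP v).toFinset with hQ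
  have hmQ : ∀ v S, S ∈ Q v ↔ S ∈ qSystem c P ∧ v ∈ S := fun v S => Set.Finite.mem_toFinset _
  set e : E3 → Finset E3 → ℝ := fun v S => 4 / 3 * solidAngle v (convexHull ℝ (S : Set E3)) -
    (decompositionStar c P v).simplexScore S with he
  have heM : ∀ v, ∀ S ∈ Q v, e v S ≤ M := by
    intro v S hS
    have h1 := solidAngle_le v (convexHull ℝ (S : Set E3))
    have h2 := (abs_le.1 (hB c P hP S ((hmQ v S).1 hS).1 v ((hmQ v S).1 hS).2)).1
    simp only [he, hM]
    linarith [le_abs_self B]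
  set T := (V.biUnion Q).filter (· ⊆ V) with hT
  have hmT : ∀ S, S ∈ T → S ∈ qSystem c P ∧ S ⊆ V := by
    intro S hS
    obtain ⟨h1, h2⟩ := Finset.mem_filter.1 hS
    obtain ⟨v, _, h3⟩ := Finset.mem_biUnion.1 h1
    exact ⟨((hmQ v S).1 h3).1, h2⟩
  refine ⟨T, hmT, ?_⟩
  change ∑ v ∈ V, ∑ S ∈ Q v, e v S ≤ _
  have hsplit : ∀ v, ∑ S ∈ Q v, e v S =
      ∑ S ∈ (Q v).filter (· ⊆ V), e v S + ∑ S ∈ (Q v).filter (¬ · ⊆ V), e v S :=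
    fun v => (Finset.sum_filter_add_sum_filter_not _ _ _).symm
  -- When all vertices of `S` are in `V`, exchanging the sums collects its four excesses, and by
  -- `sum_simplexScore` only the volume is left.
  have hin : ∑ v ∈ V, ∑ S ∈ (Q v).filter (· ⊆ V), e v S =
      4 * deltaOct * ∑ S ∈ T, volume.real (convexHull ℝ (S : Set E3)) := by
    rw [Finset.sum_comm' (t' := T) (s' := fun S => S), Finset.mul_sum]
    · refine Finset.sum_congr rfl fun S hS => ?_
      simp only [he]
      rw [Finset.sum_sub_distrib, sum_simplexScore hP (hmT S hS).1, ← Finset.mul_sum]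
      ring
    · intro v S
      simp only [hT, Finset.mem_filter, Finset.mem_biUnion, hmQ]
      exact ⟨fun h => ⟨h.2.1.2, ⟨v, h.1, h.2.1⟩, h.2.2⟩,
        fun h => ⟨h.2.2 h.1, ⟨(h.2.1.choose_spec.2).1, h.1⟩, h.2.2⟩⟩
  -- A simplex not contained in `V` has diameter at most three, so its vertices in `V` lie in the
  -- outer shell of that width; each carries at most `2 ^ 64` simplices of excess at most `M`.
  have hout : ∑ v ∈ V, ∑ S ∈ (Q v).filter (¬ · ⊆ V), e v S ≤ 2 ^ 64 * M * 80 * r ^ 2 := by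
    have h1 : ∀ v ∈ V, ∑ S ∈ (Q v).filter (¬ · ⊆ V), e v S ≤
        if r - 3 < dist v x then 2 ^ 64 * M else 0 := by
      intro v hv
      split_ifs with h
      · calc _ ≤ ((Q v).filter (¬ · ⊆ V)).card • M :=
              Finset.sum_le_card_nsmul _ _ _ fun S hS => heM v S (Finset.mem_filter.1 hS).1
          _ ≤ _ := by
            rw [nsmul_eq_mul]
            gcongr
            have := (Finset.card_filter_le (Q v) (¬ · ⊆ V)).trans (card_qSystem_le hP v)
            exact_mod_cast this
      · rw [Finset.filter_false_of_mem, Finset.sum_empty]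
        intro S hS hn
        obtain ⟨hSQ, hvS⟩ := (hmQ v S).1 hS
        refine hn fun w hw => (hVP w).2 ⟨hSQ.1 hw, ?_⟩
        have := Metric.mem_closedBall.1
          ((isCandidate_of_mem hSQ).hull_subset hvS (subset_convexHull ℝ _ hw))
        linarith [dist_triangle w v x]
    refine (Finset.sum_le_sum h1).trans ?_
    rw [← Finset.sum_filter, Finset.sum_const, nsmul_eq_mul]
    have := hP.card_shell_le (F := V.filter (r - 3 < dist · x)) hr fun v hv =>
      ⟨((hVP v).1 (Finset.mem_filter.1 hv).1).1, ((hVP v).1 (Finset.mem_filter.1 hv).1).2,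
        (Finset.mem_filter.1 hv).2⟩
    calc _ ≤ 80 * r ^ 2 * (2 ^ 64 * M) := by gcongr
      _ = _ := by ring
  rw [Finset.sum_congr rfl fun v _ => hsplit v, Finset.sum_add_distrib, hin]
  linarith

/-- After multiplication by `4 * deltaOct` the terms `16 * π / 3` cancel. What remains compares
almost disjoint pieces within radius `r + 2` with Voronoi cells covering radius `r - 2`, up to the
boundary term `K * r ^ 2`. -/
theorem isNegligible_of_sigma (hc : IsDiagonalChoice c) (hP : IsSaturated P) :
    IsNegligible P fun v => -(decompositionStar c P v).sigma / (4 * deltaOct) +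
      4 * Real.pi / (3 * deltaOct) - volume.real (voronoiCell P v) := by
  obtain ⟨K, hK⟩ := exists_sum_excess_le
  have hd := deltaOct_pos
  refine ⟨28 * volume.real (Metric.ball (0 : E3) 1) + K / (4 * deltaOct), fun x r hr => ?_⟩
  have hfin : {v : P | (v : E3) ∈ Metric.closedBall x r}.Finite :=
    Set.Finite.of_finite_image ((hP.1.finite_inter x r).subset (by
      rintro _ ⟨v, hv, rfl⟩
      exact ⟨v.2, hv⟩)) Subtype.val_injective.injOn
  set V : Finset E3 := hfin.toFinset.map (Function.Embedding.subtype _) with hVdef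
  have hV : (V : Set E3) = P ∩ Metric.closedBall x r := by
    ext v
    simp [hVdef, and_comm]
  have hsum : ∑ᶠ (v : P) (_ : (v : E3) ∈ Metric.closedBall x r),
      (-(decompositionStar c P v).sigma / (4 * deltaOct) + 4 * Real.pi / (3 * deltaOct) -
        volume.real (voronoiCell P v)) =
      ∑ v ∈ V, (-(decompositionStar c P v).sigma / (4 * deltaOct) + 4 * Real.pi / (3 * deltaOct) -
        volume.real (voronoiCell P v)) := by
    rw [hVdef, Finset.sum_map]
    exact finsum_mem_eq_finite_toFinset_sum _ hfin
  rw [hsum]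
  obtain ⟨T, hT, hle⟩ := hK c P hP.1 x r hr V hV
  have hball := sum_volume_le hc hP.1 (zero_le_one.trans hr) (hV.subset.trans Set.inter_subset_right) hT
  have hvor := hP.le_sum_volume_voronoiCell hV
  have hσ := Finset.sum_le_sum fun v (hv : v ∈ V) =>
    neg_sigma_le (c := c) hP.1 (hV.subset (Finset.mem_coe.2 hv)).1
  rw [Finset.sum_add_distrib, Finset.sum_sub_distrib, ← Finset.mul_sum] at hσ
  have hscale : 4 * deltaOct * ∑ v ∈ V, (-(decompositionStar c P v).sigma / (4 * deltaOct) +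
      4 * Real.pi / (3 * deltaOct) - volume.real (voronoiCell P v)) =
      ∑ v ∈ V, -(decompositionStar c P v).sigma + ∑ v ∈ V, 16 * Real.pi / 3 -
        4 * deltaOct * ∑ v ∈ V, volume.real (voronoiCell P v) := by
    rw [Finset.mul_sum, Finset.mul_sum, ← Finset.sum_add_distrib, ← Finset.sum_sub_distrib]
    refine Finset.sum_congr rfl fun v _ => ?_
    field_simp
    ring
  have hgap : ∑ v ∈ V, volume.real (residue c P v) +
      ∑ S ∈ T, volume.real (convexHull ℝ (S : Set E3)) -
        ∑ v ∈ V, volume.real (voronoiCell P v) ≤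
      28 * volume.real (Metric.ball (0 : E3) 1) * r ^ 2 := by
    have h0 : 0 ≤ volume.real (Metric.ball (0 : E3) 1) := measureReal_nonneg
    -- The difference of cubes is `12 * r ^ 2 + 16`, at most `28 * r ^ 2` for `r ≥ 1`.
    have h1 : ((r + 2) ^ 3 - (r - 2) ^ 3) * volume.real (Metric.ball (0 : E3) 1) ≤
        28 * r ^ 2 * volume.real (Metric.ball (0 : E3) 1) := by
      gcongr
      nlinarith
    linarith
  have hgap := mul_le_mul_of_nonneg_left hgap (show 0 ≤ 4 * deltaOct by positivity)
  refine le_of_mul_le_mul_left ?_ (show 0 < 4 * deltaOct by positivity)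
  rw [hscale]
  have hK' : 4 * deltaOct * ((28 * volume.real (Metric.ball (0 : E3) 1) + K / (4 * deltaOct)) * r ^ 2) =
      4 * deltaOct * (28 * volume.real (Metric.ball (0 : E3) 1) * r ^ 2) + K * r ^ 2 := by
    field_simp
  rw [hK']
  linarith

end Kepler

theorem lemma2p3 (c : Finset Kepler.E3 → Kepler.E3 × Kepler.E3) (hc : Kepler.IsDiagonalChoice c)
    (hmax : IsGreatest (Kepler.DecompositionStar.sigma '' Kepler.decompositionStars c)
      (8 * Kepler.pt))
    (P : Set Kepler.E3) (hP : Kepler.IsSaturated P) :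
    ∃ a : P → ℝ,
      (∀ v : P, a v =
        -(Kepler.decompositionStar c P v).sigma / (4 * Kepler.deltaOct) +
          4 * Real.pi / (3 * Kepler.deltaOct) -
            MeasureTheory.volume.real (Kepler.voronoiCell P v)) ∧
      Kepler.IsNegligible P a ∧ Kepler.IsFccCompatible P a := by
  refine ⟨_, fun v => rfl, Kepler.isNegligible_of_sigma hc hP, ?_⟩
  exact Kepler.isFccCompatible_of_le fun v => hmax.2 ⟨_, ⟨P, v, v.2, hP, rfl⟩, rfl⟩
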